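/- Let $k$ be an integer with $k\not\equiv 0 \pmod{12}$ and let $v=v_\eta^{2k}$ be the $2k$-th power of the multiplier system of the Dedekind eta function, i.e. the character of $SL(2,\mathbb Z)$ given by $v(g)=\left(\frac{\eta(gz)^2}{(\gamma z+\delta)\,\eta(z)^2}\right)^{k}$ for $g=\left(\begin{smallmatrix}\alpha&\beta\\ \gamma&\delta\end{smallmatrix}\right)$ (independent of $z\in\mathbb H$). Put $\xi=e^{\pi i k/6}$ and $\chi_k(d)=i^{k(d-1)}$. Let $R\in\mathbb R$, $R\neq 0$, and let $f:\mathbb H\to\mathbb C$ be a Maass waveform of weight $k$ and multiplier $v$ with Laplace eigenvalue $\tfrac14+R^2$. That is, $f$ is twice continuously differentiable; $$e^{-ik\operatorname{Arg}(\gamma z+\delta)}f(gz)=v(g)f(z)$$ for all $g=\left(\begin{smallmatrix}\alpha&\beta\\ \gamma&\delta\end{smallmatrix}\right)\in SL(2,\mathbb Z)$ and $z\in\mathbb H$, where $\operatorname{Arg}$ is the principal argument; $$y^2\left(\frac{\partial^2 f}{\partial x^2}+\frac{\partial^2 f}{\partial y^2}\right)-iky\frac{\partial f}{\partial x}+\left(\tfrac14+R^2\right)f=0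 ;$$ and $\int_{SL(2,\mathbb Z)\backslash\mathbb H}|f|^2\,\frac{dx\,dy}{y^2}<\infty$. Let $c(l)$, $l\in\mathbb Z$, be the Fourier coefficients of $f$, defined by $$f(x+iy)=\sum_{n\in\mathbb Z}\frac{c(n)}{\sqrt{|\nu_n|}}\,W_{\frac k2\operatorname{sgn}\nu_n,\,iR}\big(4\pi|\nu_n|y\big)\,e^{2\pi i\nu_n x},\qquad \nu_n=n+\tfrac{k}{12},$$ where $W_{\kappa,\mu}$ is the Whittaker $W$-function. For a positive integer $n$ with $kn\equiv k\pmod{12}$ let $$T_nf(z)=\frac1{\sqrt n}\sum_{ad=n,\ d>0}\chi_k(d)\sum_{b=0}^{d-1}\xi^{-bd}f\left(\frac{az+b}{d}\right).$$ Suppose that $f$ is an eigenfunction of all $T_n$ with $n\ge 1$ and $kn\equiv k\pmod{12}$, and that $c(0)\neq0$. Then $c(l)/c(0)$ is real for every $l\in\mathbb Z$ with $k\mid 12l$. -/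

import Mathlib

open UpperHalfPlane MeasureTheory
open scoped UpperHalfPlane MatrixGroups

noncomputable section

namespace MaassEta

/-- The weight `k` automorphy factor `j_g(z; k) = exp (i k Arg (c z + d))`. -/
def autFactor (k : ℤ) (g : SL(2, ℤ)) (z : ℍ) : ℂ :=
  Complex.exp
    (Complex.I * k * (Complex.arg (((g 1 0 : ℤ) : ℂ) * (z : ℂ) + ((g 1 1 : ℤ) : ℂ)) : ℂ))

/-- The `2k`-th power `v_η ^ (2k)` of the multiplier system of the Dedekind eta function, for an
integer `k`. Here `v_η ^ 2` is defined by `η(g z) ^ 2 = v_η ^ 2(g) (c z + d) η(z) ^ 2`; the quotient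
does not depend on `z`, and it is read off at `z = i`. -/
def etaMultiplier (k : ℤ) (g : SL(2, ℤ)) : ℂ :=
  (ModularForm.eta ((g • UpperHalfPlane.I : ℍ) : ℂ) ^ 2 /
    ((((g 1 0 : ℤ) : ℂ) * Complex.I + ((g 1 1 : ℤ) : ℂ)) * ModularForm.eta Complex.I ^ 2)) ^ k

/-- The weight `k` Laplacian
`Δ_k = y ^ 2 (∂ ^ 2 / ∂ x ^ 2 + ∂ ^ 2 / ∂ y ^ 2) - i k y ∂ / ∂ x`, with partial derivatives
taken along the lines `t ↦ z + t` and `t ↦ z + i t`. -/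
def weightLaplacian (k : ℤ) (f : ℍ → ℂ) (z : ℍ) : ℂ :=
  (z.im : ℂ) ^ 2 *
      (iteratedDeriv 2 (fun t : ℝ => f (ofComplex ((z : ℂ) + (t : ℂ)))) 0 +
        iteratedDeriv 2 (fun t : ℝ => f (ofComplex ((z : ℂ) + (t : ℂ) * Complex.I))) 0) -
    Complex.I * k * (z.im : ℂ) * deriv (fun t : ℝ => f (ofComplex ((z : ℂ) + (t : ℂ)))) 0

/-- `f` is a Maass waveform of weight `k` for the multiplier system `v_η ^ (2k)` on `SL(2, ℤ)`, with
Laplace eigenvalue `1 / 4 + R ^ 2`. The measure on `ℍ` is `dx dy / y ^ 2`. -/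
structure IsMaassWaveform (k : ℤ) (R : ℝ) (f : ℍ → ℂ) : Prop where
  contDiffOn : ContDiffOn ℝ 2 (fun w : ℂ => f (ofComplex w)) {w : ℂ | 0 < w.im}
  slash_eq : ∀ (g : SL(2, ℤ)) (z : ℍ), (autFactor k g z)⁻¹ * f (g • z) = etaMultiplier k g * f z
  eigen : ∀ z : ℍ, weightLaplacian k f z + (1 / 4 + (R : ℂ) ^ 2) * f z = 0
  square_integrable : IntegrableOn (fun z : ℍ => ‖f z‖ ^ 2) ModularGroup.fd volume

/-- Kummer's confluent hypergeometric function `₁F₁(a; b; z)`; Mathlib's version is divided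
by `Γ(b)`. -/
def kummerM (a b z : ℂ) : ℂ := Complex.Gamma b * Complex.regularizedHGFun {a} {b} z

/-- The Whittaker function `M_{κ,μ}(y)`, `y > 0`, `2μ` not a negative integer. -/
def whittakerM (κ μ : ℂ) (y : ℝ) : ℂ :=
  Complex.exp (-(y : ℂ) / 2) * (y : ℂ) ^ (μ + 1 / 2) * kummerM (μ - κ + 1 / 2) (1 + 2 * μ) y

/-- The Whittaker function `W_{κ,μ}(y)`, `y > 0`, `2μ` not an integer. -/
def whittakerW (κ μ : ℂ) (y : ℝ) : ℂ :=
  Complex.Gamma (-2 * μ) / Complex.Gamma (1 / 2 - μ - κ) * whittakerM κ μ y +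
    Complex.Gamma (2 * μ) / Complex.Gamma (1 / 2 + μ - κ) * whittakerM κ (-μ) y

/-- The `n`-th term of the Fourier expansion at infinity, with `ν = n + k / 12`:
`|ν| ^ (-1/2) W_{(k/2) sgn ν, iR}(4 π |ν| y) e(ν x)`. -/
def fourierTerm (k : ℤ) (R : ℝ) (n : ℤ) (z : ℍ) : ℂ :=
  let ν : ℝ := (n : ℝ) + (k : ℝ) / 12
  ((1 / Real.sqrt |ν| : ℝ) : ℂ) *
    whittakerW (((k : ℝ) / 2 * Real.sign ν : ℝ) : ℂ) (Complex.I * R)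
      (4 * Real.pi * |ν| * z.im) *
    Complex.exp (2 * Real.pi * Complex.I * ((ν * z.re : ℝ) : ℂ))

/-- `c` is the sequence of Fourier coefficients of `f`. -/
def HasFourierCoeffs (k : ℤ) (R : ℝ) (f : ℍ → ℂ) (c : ℤ → ℂ) : Prop :=
  ∀ z : ℍ, HasSum (fun n : ℤ => c n * fourierTerm k R n z) (f z)

/-- `χ_k(d) = i ^ (k (d - 1))`. -/
def chi (k : ℤ) (d : ℕ) : ℂ := Complex.I ^ (k * ((d : ℤ) - 1))

/-- `ξ = e(k / 12)`, the value of `v_η ^ (2k)` at the translation `z ↦ z + 1`. -/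
def xi (k : ℤ) : ℂ := Complex.exp (2 * Real.pi * Complex.I * ((k : ℂ) / 12))

/-- The Hecke operator
`(T_n f)(z) = n ^ (-1/2) ∑_{a d = n, d > 0} χ_k(d) ∑_{b mod d} ξ ^ (-b d) f((a z + b) / d)`. -/
def heckeT (k : ℤ) (n : ℕ) (f : ℍ → ℂ) (z : ℍ) : ℂ :=
  ((1 / Real.sqrt n : ℝ) : ℂ) *
    ∑ p ∈ n.divisorsAntidiagonal, chi k p.2 *
      ∑ b ∈ Finset.range p.2, xi k ^ (-((b : ℤ) * (p.2 : ℤ))) *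
        f (ofComplex (((p.1 : ℂ) * (z : ℂ) + (b : ℂ)) / (p.2 : ℂ)))

/-- `f` is an eigenfunction of all `T_n` with `n ≥ 1` and `k n ≡ k` modulo `12`. -/
def IsHeckeEigenfunction (k : ℤ) (f : ℍ → ℂ) : Prop :=
  f ≠ 0 ∧ ∀ n : ℕ, 0 < n → k * (n : ℤ) ≡ k [ZMOD 12] →
    ∃ ev : ℂ, ∀ z : ℍ, heckeT k n f z = ev * f z

end MaassEta

end

noncomputable section

namespace MaassEta

/-! ### Exponential sums and Hecke operators on coefficient sequences -/

/-! Write $k/12=r/N$ in lowest terms, so that the frequencies of $f$ are $q/N$ with $q\equiv r\pmod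
N$; let $x(q)$ be the coefficient at $q/N$, so $x(r)=c(0)$. Here $N>1$ divides $12$, hence
$d^2\equiv1\pmod N$ for every $d$ prime to $N$. One shows that $D=\alpha x-\overline{\alpha x}$,
with $\alpha=1/x(r)$, vanishes.

Hecke side. For $m$ prime to $N$ the operator $T_m$ takes the multiplier class $\kappa$ to $\kappa
m$, and unfolding over integral matrices of determinant $m$ shows that its adjoint is $\chi(m)T_m$
(`petersson_heckeOp`). Hence the eigenvalues $\lambda_n$, $n\equiv1\pmod N$, are real
(`conj_eigenvalue`), and $D$ is again an eigenvector with these eigenvalues, with $D(r)=0$. Take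
$m=|r|$. The relation $T_mT_m=\sum_{e\mid m}\chi(e)T_{(m/e)^2}$ (`heckeCoeff_heckeCoeff`) makes
$T_m^2$ act on $f$ and on $D$ by one scalar $\Lambda$. The coefficient of $T_mf$ at the sign of $r$
is $\chi(m)x(r)\ne0$, so $\langle f,T_m^2f\rangle=\pm\|T_mf\|^2\neq0$ and $\Lambda\ne0$. If $q$ has
the sign of $r$ and $(T_mD)(q)\neq0$, then $n=|q|\equiv1\pmod N$ and
$(T_mD)(q)=\chi(m)(T_nD)(r)=\chi(m)\lambda_nD(r)=0$. So $T_mD$, hence $T_m^2D=\Lambda D$, hence $D$,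
vanishes on the side of $r$ (`coeff_eq_zero_of_side`).

Analytic side. The numbers $D(q)$ are the coefficients of $h(z)=\alpha f(z)-\overline{\alpha f(-\bar
z)}$, since $W_{\kappa,iR}$ is real for real $\kappa$; $h$ transforms under $z\mapsto-1/z$ like $f$.
Only frequencies of sign opposite to $k$ survive, where the Whittaker index is $-|k|/2<1/2$ and $W$
is a convergent Laplace integral. With $P=y-ix$, $Q=y+ix$ this turns $h$ into
$(P+Q)^\sigma\int_0^\infty\Phi(Q+s)s^{a-1}(P+Q+s)^{-c}ds$ up to a constant, $\Phi$ being a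
holomorphic Dirichlet series. The inversion becomes $(P,Q)\mapsto(1/P,1/Q)$, and by analytic
continuation $P,Q$ may be taken as independent positive reals (`inversion_real`). At $Q=1$, repeated
differentiation in $P$ gives $\int\psi(s)\,((1-\theta)^n-\theta^n)\,ds=0$ for all $n$, with
$\theta=1/(2+s)<1/2$. As $\theta$ and $1-\theta$ run through disjoint intervals, Weierstrass
approximation forces $\psi=0$, so $\Phi=0$ and $D=0$ (`one_sided_eq_zero`). -/

theorem eq_zero_of_hasSum_exp {N : ℝ} (hN : N ≠ 0) {u : ℤ → ℂ}
    (h : ∀ x : ℝ, HasSum (fun q : ℤ => u q * Complex.exp (2 * Real.pi * Complex.I *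
      ((q * x / N : ℝ) : ℂ))) 0) (q₀ : ℤ) : u q₀ = 0 := by
  have hu : Summable fun q => ‖u q‖ := by
    have := (h 0).summable
    simpa using this.norm
  set F : ℤ → ℝ → ℂ := fun q t => u q * Complex.exp (2 * Real.pi * Complex.I * ((q - q₀ : ℤ) : ℂ) * t)
    with hF
  have hnorm : ∀ q t, ‖F q t‖ = ‖u q‖ := by
    intro q t
    have : (2 * Real.pi * Complex.I * ((q - q₀ : ℤ) : ℂ) * t) =
      ((2 * Real.pi * (q - q₀ : ℤ) * t : ℝ) : ℂ) * Complex.I := by push_cast; ring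
    simp only [hF, norm_mul]
    rw [this, Complex.norm_exp_ofReal_mul_I, mul_one]
  have hsum : ∀ t : ℝ, HasSum (fun q => F q t) 0 := by
    intro t
    -- The substitution $x=Nt$ makes every term $1$-periodic, and the twist by $e(-q_0t)$ moves the
    -- coefficient sought to frequency zero.
    have := (h (N * t)).mul_right (Complex.exp (2 * Real.pi * Complex.I * ((-q₀ * t : ℝ) : ℂ)))
    rw [zero_mul] at this
    refine this.congr_fun ?_
    intro q
    rw [mul_assoc, ← Complex.exp_add]
    simp only [hF]
    congr 2
    rw [← mul_add, ← Complex.ofReal_add]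
    have : (q * (N * t) / N + -q₀ * t : ℝ) = (q - q₀ : ℤ) * t := by
      push_cast; field_simp; ring
    rw [this]; push_cast; ring
  have key := intervalIntegral.hasSum_integral_of_dominated_convergence (a := 0) (b := 1)
    (F := F) (f := fun _ => (0 : ℂ)) (μ := volume) (fun q _ => ‖u q‖)
    (fun q => by
      apply Continuous.aestronglyMeasurable
      simp only [hF]; fun_prop)
    (fun q => Filter.Eventually.of_forall fun t _ => (hnorm q t).le)
    (Filter.Eventually.of_forall fun t _ => hu)
    (by simp)
    (Filter.Eventually.of_forall fun t _ => hsum t)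
  have hint : ∀ q, (∫ t in (0:ℝ)..1, F q t) = if q = q₀ then u q₀ else 0 := by
    intro q
    split_ifs with hq
    · subst hq; simp [hF]
    · have hc : (2 * Real.pi * Complex.I * ((q - q₀ : ℤ) : ℂ)) ≠ 0 := by
        have : ((q - q₀ : ℤ) : ℂ) ≠ 0 := by exact_mod_cast sub_ne_zero.mpr hq
        simp [Real.pi_ne_zero]
        simpa [sub_eq_zero] using this
      simp only [hF]
      rw [intervalIntegral.integral_const_mul, integral_exp_mul_complex hc]
      have : Complex.exp (2 * Real.pi * Complex.I * ((q - q₀ : ℤ) : ℂ) * (1 : ℝ)) = 1 := by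
        rw [Complex.exp_eq_one_iff]
        exact ⟨q - q₀, by push_cast; ring⟩
      rw [this]; simp
  simp only [hint, intervalIntegral.integral_zero] at key
  have h2 := hasSum_ite_eq q₀ (u q₀)
  exact h2.unique key

/-- The Hecke operator on coefficient sequences. -/
def heckeCoeff (ψ : ℕ → ℂ) (m : ℕ) (x : ℤ → ℂ) (q : ℤ) : ℂ :=
  ∑ a ∈ m.divisors with ((a : ℕ) : ℤ) ∣ q, ψ (m / a) * x (((m / a : ℕ) : ℤ) * (q / (a : ℕ)))

/-- `ψ` behaves like a quadratic character on the integers prime to `N`. -/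
structure IsQuadratic (N : ℕ) (ψ : ℕ → ℂ) : Prop where
  map_mul : ∀ a b : ℕ, a.Coprime N → b.Coprime N → ψ (a * b) = ψ a * ψ b
  sq : ∀ a : ℕ, a.Coprime N → ψ a * ψ a = 1
  real : ∀ a : ℕ, a.Coprime N → (starRingEnd ℂ) (ψ a) = ψ a

/-- This is $T_mT_m=\sum_{e\mid m}\psi(e)T_{(m/e)^2}$. The two double sums are matched term by term,
so no prime factorisation of $m$ is needed. For $m=|r|$ the right-hand side involves only operators
of index $\equiv1\pmod N$, of which $f$ is an eigenfunction. -/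
theorem heckeCoeff_heckeCoeff {N : ℕ} {ψ : ℕ → ℂ} (hψ : IsQuadratic N ψ) {m : ℕ}
    (hm : m.Coprime N) (hm0 : 0 < m) (x : ℤ → ℂ) (q : ℤ) :
    heckeCoeff ψ m (heckeCoeff ψ m x) q =
      ∑ e ∈ m.divisors, ψ e * heckeCoeff ψ ((m / e) ^ 2) x q := by
  have hdiv : ∀ d : ℕ, d ∣ m → d.Coprime N := fun d hd => Nat.Coprime.coprime_dvd_left hd hm
  unfold heckeCoeff
  simp_rw [Finset.mul_sum, Finset.sum_sigma']
  -- One formula serves in both directions. With $m=bn$, $e=\gcd(a,n)$, $a=a'e$, $n=n'e$,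
  -- coprimality of $a'$ and $n'$ gives $a'\mid b$, and the pair $(b,a)$ corresponds to $(e,a'b)$.
  refine Finset.sum_nbij'
    (fun p => ⟨p.2.gcd (m / p.1), (p.2 / p.2.gcd (m / p.1)) * p.1⟩)
    (fun p => ⟨p.2.gcd (m / p.1), (p.2 / p.2.gcd (m / p.1)) * p.1⟩) ?_ ?_ ?_ ?_ ?_
  all_goals
    rintro ⟨b, a⟩ hp
    simp only [Finset.mem_sigma, Finset.mem_filter, Nat.mem_divisors] at hp
  -- Membership, left inverse and equality of terms use the same factorisation $m=a'b'n'e$; the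
  -- alternatives of `first` treat them in this order.
  case refine_1 | refine_3 | refine_5 =>
    obtain ⟨⟨⟨⟨n, rfl⟩, -⟩, ⟨q', rfl⟩⟩, ⟨ham, -⟩, haq⟩ := hp
    have hb0 : 0 < b := Nat.pos_of_mul_pos_right hm0
    have hn0 : 0 < n := Nat.pos_of_mul_pos_left hm0
    have ha0 : 0 < a := Nat.pos_of_dvd_of_pos ham hm0
    rw [Nat.mul_div_cancel_left _ hb0, Int.mul_ediv_cancel_left _ (by positivity)] at haq
    obtain ⟨e, a', n', he0, hcop, rfl, rfl⟩ := Nat.exists_coprime' (m := a) (n := n)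
      (Nat.gcd_pos_of_pos_left _ ha0)
    have ha'0 : 0 < a' := Nat.pos_of_mul_pos_right ha0
    have hn'0 : 0 < n' := Nat.pos_of_mul_pos_right hn0
    have h1 : a' ∣ b := by
      have : a' * e ∣ (b * n') * e := by convert ham using 1; ring
      exact hcop.dvd_of_dvd_mul_right (Nat.dvd_of_mul_dvd_mul_right he0 this)
    obtain ⟨b', rfl⟩ := h1
    have hb'0 : 0 < b' := Nat.pos_of_mul_pos_left hb0
    have h2 : (a' : ℤ) ∣ q' := by
      have : (a' : ℤ) * e ∣ ((n' : ℤ) * q') * e := by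
        convert haq using 1 <;> (push_cast; ring)
      have := Int.dvd_of_mul_dvd_mul_right (by positivity) this
      exact IsCoprime.dvd_of_dvd_mul_left (Nat.isCoprime_iff_coprime.mpr hcop) this
    obtain ⟨q'', rfl⟩ := h2
    have hgcd : (a' * e).gcd (a' * b' * (n' * e) / (a' * b')) = e := by
      rw [Nat.mul_div_cancel_left _ hb0, Nat.gcd_mul_right, hcop.gcd_eq_one, one_mul]
    have hme : a' * b' * (n' * e) / e = a' * b' * n' := by
      rw [← mul_assoc, Nat.mul_div_cancel _ he0]
    have hae : a' * e / e = a' := Nat.mul_div_cancel _ he0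
    dsimp only
    rw [hgcd, hae]
    first
      | (simp only [Finset.mem_sigma, Finset.mem_filter, Nat.mem_divisors, hme]
         refine ⟨⟨⟨a' * b' * n', by ring⟩, hm0.ne'⟩, ⟨⟨b' * n' ^ 2, by ring⟩, by positivity⟩,
           ⟨q'', by push_cast; ring⟩⟩)
      | (have hgcd2 : (a' * (a' * b')).gcd (a' * b' * n') = a' * b' := by
           rw [mul_comm a' (a' * b'), Nat.gcd_mul_left, hcop.gcd_eq_one, mul_one]
         simp only [hme, hgcd2]
         rw [Nat.mul_div_cancel _ hb0])
      | (have e1 : a' * b' * (n' * e) / (a' * b') = n' * e := Nat.mul_div_cancel_left _ hb0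
         have e2 : a' * b' * (n' * e) / (a' * e) = b' * n' := by
           rw [show a' * b' * (n' * e) = (a' * e) * (b' * n') by ring,
             Nat.mul_div_cancel_left _ ha0]
         have e3 : (a' * b' * n') ^ 2 / (a' * (a' * b')) = b' * n' * n' := by
           rw [show (a' * b' * n') ^ 2 = (a' * (a' * b')) * (b' * n' * n') by ring,
             Nat.mul_div_cancel_left _ (by positivity)]
         have e4 : ((a' * b' : ℕ) : ℤ) * (a' * q'') / ((a' * b' : ℕ) : ℤ) = a' * q'' :=
           Int.mul_ediv_cancel_left _ (by positivity)
         have e5 : ((n' * e : ℕ) : ℤ) * (a' * q'') / ((a' * e : ℕ) : ℤ) = n' * q'' := by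
           rw [show ((n' * e : ℕ) : ℤ) * (a' * q'') = ((a' * e : ℕ) : ℤ) * (n' * q'') by
             push_cast; ring, Int.mul_ediv_cancel_left _ (by positivity)]
         have e6 : ((a' * b' : ℕ) : ℤ) * (a' * q'') / ((a' * (a' * b') : ℕ) : ℤ) = q'' := by
           rw [show ((a' * b' : ℕ) : ℤ) * (a' * q'') = ((a' * (a' * b') : ℕ) : ℤ) * q'' by
             push_cast; ring, Int.mul_ediv_cancel_left _ (by positivity)]
         rw [e1, e2, hme, e3, e4, e5, e6]
         have cn : n'.Coprime N := hdiv _ ⟨a' * b' * e, by ring⟩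
         have ce : e.Coprime N := hdiv _ ⟨a' * b' * n', by ring⟩
         have cb : b'.Coprime N := hdiv _ ⟨a' * n' * e, by ring⟩
         rw [hψ.map_mul n' e cn ce, hψ.map_mul (b' * n') n' (cb.mul_left cn) cn,
           hψ.map_mul b' n' cb cn]
         rw [show ((b' * n' : ℕ) : ℤ) * (n' * q'') = ((b' * n' * n' : ℕ) : ℤ) * q'' by
           push_cast; ring]
         ring)
  case refine_2 | refine_4 =>
    obtain ⟨⟨⟨n, rfl⟩, -⟩, ⟨hgn, -⟩, hgq⟩ := hp
    have hb0 : 0 < b := Nat.pos_of_mul_pos_right hm0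
    have hn0 : 0 < n := Nat.pos_of_mul_pos_left hm0
    rw [Nat.mul_div_cancel_left _ hb0] at hgn
    have ha0 : 0 < a := Nat.pos_of_dvd_of_pos hgn (by positivity)
    obtain ⟨e, a', n', he0, hcop, rfl, rfl⟩ := Nat.exists_coprime' (m := a) (n := n)
      (Nat.gcd_pos_of_pos_left _ ha0)
    have h1 : a' ∣ e := by
      have : a' * e ∣ (e * n' ^ 2) * e := by convert hgn using 1; ring
      exact (hcop.pow_right 2).dvd_of_dvd_mul_right (Nat.dvd_of_mul_dvd_mul_right he0 this)
    obtain ⟨e', rfl⟩ := h1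
    obtain ⟨q', rfl⟩ := hgq
    have ha'0 : 0 < a' := Nat.pos_of_mul_pos_right ha0
    have hgcd : (a' * (a' * e')).gcd (b * (n' * (a' * e')) / b) = a' * e' := by
      rw [Nat.mul_div_cancel_left _ hb0, Nat.gcd_mul_right, hcop.gcd_eq_one, one_mul]
    have hae : a' * (a' * e') / (a' * e') = a' := Nat.mul_div_cancel _ he0
    have hmb : b * (n' * (a' * e')) / (a' * e') = b * n' := by
      rw [← mul_assoc, Nat.mul_div_cancel _ he0]
    dsimp only
    rw [hgcd, hae]
    first
      | (simp only [Finset.mem_sigma, Finset.mem_filter, Nat.mem_divisors, hmb]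
         refine ⟨⟨⟨⟨b * n', by ring⟩, hm0.ne'⟩, ⟨a' * q', by push_cast; ring⟩⟩,
           ⟨⟨n' * e', by ring⟩, hm0.ne'⟩, ?_⟩
         have e4 : ((a' * (a' * e') : ℕ) : ℤ) * q' / ((a' * e' : ℕ) : ℤ) = a' * q' := by
           rw [show ((a' * (a' * e') : ℕ) : ℤ) * q' = ((a' * e' : ℕ) : ℤ) * (a' * q') by
             push_cast; ring, Int.mul_ediv_cancel_left _ (by positivity)]
         rw [e4]
         exact ⟨n' * q', by push_cast; ring⟩)
      | (have hgcd2 : (a' * b).gcd (b * n') = b := by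
           rw [mul_comm a' b, Nat.gcd_mul_left, hcop.gcd_eq_one, mul_one]
         simp only [hmb, hgcd2]
         rw [Nat.mul_div_cancel _ hb0])

/-! ### Expansions with a radial profile and the Hecke operators on them -/

/-- The `q`-th term of an expansion with frequencies `q / N` and radial profile `w`. -/
def expTerm (N : ℕ) (w : ℝ → ℂ) (q : ℤ) (z : ℍ) : ℂ :=
  ((1 / Real.sqrt |(q : ℝ)| : ℝ) : ℂ) * w (q * z.im) *
    Complex.exp (2 * Real.pi * Complex.I * ((q * z.re / N : ℝ) : ℂ))

/-- The Hecke operator with weight `k` and multiplier class `κ`. -/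
def heckeOp (k κ : ℤ) (n : ℕ) (f : ℍ → ℂ) (z : ℍ) : ℂ :=
  ((1 / Real.sqrt n : ℝ) : ℂ) *
    ∑ p ∈ n.divisorsAntidiagonal, chi k p.2 *
      ∑ b ∈ Finset.range p.2, xi κ ^ (-((b : ℤ) * (p.2 : ℤ))) *
        f (ofComplex (((p.1 : ℂ) * (z : ℂ) + (b : ℂ)) / (p.2 : ℂ)))

/-- Fixing the height $t$ leaves an exponential series in $\operatorname{Re}z$. The index $q=0$ must
be excluded: there $1/\sqrt{|q|}$ takes the default value $0$ and the coefficient is invisible. -/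
theorem expTerm_unique {N : ℕ} (hN : N ≠ 0) {w : ℝ → ℂ} {x x' : ℤ → ℂ} {f : ℍ → ℂ}
    (hx : ∀ z, HasSum (fun q => x q * expTerm N w q z) (f z))
    (hx' : ∀ z, HasSum (fun q => x' q * expTerm N w q z) (f z))
    (q : ℤ) (hq : q ≠ 0) (hw : ∃ t : ℝ, 0 < t ∧ w (q * t) ≠ 0) : x q = x' q := by
  obtain ⟨t, ht, hwt⟩ := hw
  have h : ∀ s : ℝ, HasSum (fun q : ℤ => ((x q - x' q) * (((1 / Real.sqrt |(q : ℝ)| : ℝ) : ℂ) *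
      w (q * t))) * Complex.exp (2 * Real.pi * Complex.I * ((q * s / (N : ℝ) : ℝ) : ℂ))) 0 := by
    intro s
    have := (hx ⟨⟨s, t⟩, ht⟩).sub (hx' ⟨⟨s, t⟩, ht⟩)
    rw [sub_self] at this
    refine this.congr_fun fun q => ?_
    simp only [expTerm, UpperHalfPlane.im, UpperHalfPlane.re]
    ring
  have := eq_zero_of_hasSum_exp (by exact_mod_cast hN) h q
  have hs : ((1 / Real.sqrt |(q : ℝ)| : ℝ) : ℂ) ≠ 0 := by
    have : (0 : ℝ) < |(q : ℝ)| := by positivity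
    exact_mod_cast (by positivity : (1 / Real.sqrt |(q : ℝ)|) ≠ 0)
  rw [mul_eq_zero] at this
  rcases this with h | h
  · exact sub_eq_zero.mp h
  · exact absurd h (mul_ne_zero hs hwt)

theorem sum_range_exp_eq {d : ℕ} (hd : 0 < d) (s : ℤ) :
    ∑ b ∈ Finset.range d, Complex.exp (2 * Real.pi * Complex.I * (b * s / d)) =
      if (d : ℤ) ∣ s then (d : ℂ) else 0 := by
  have hd' : (d : ℂ) ≠ 0 := by exact_mod_cast hd.ne'
  set ζ : ℂ := Complex.exp (2 * Real.pi * Complex.I * (s / d)) with hζ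
  have hterm : ∀ b : ℕ, Complex.exp (2 * Real.pi * Complex.I * (b * s / d)) = ζ ^ b := by
    intro b
    rw [hζ, ← Complex.exp_nat_mul]
    congr 1; ring
  simp_rw [hterm]
  have hpow : ζ ^ d = 1 := by
    rw [hζ, ← Complex.exp_nat_mul, Complex.exp_eq_one_iff]
    exact ⟨s, by field_simp⟩
  split_ifs with h
  · have : ζ = 1 := by
      obtain ⟨t, rfl⟩ := h
      rw [hζ, Complex.exp_eq_one_iff]
      exact ⟨t, by push_cast; field_simp⟩
    simp [this]
  · have h1 : ζ ≠ 1 := by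
      intro h1
      apply h
      rw [hζ, Complex.exp_eq_one_iff] at h1
      obtain ⟨t, ht⟩ := h1
      refine ⟨t, ?_⟩
      have h2 : (2 * Real.pi * Complex.I : ℂ) ≠ 0 := by simp [Real.pi_ne_zero]
      have h3 : (s : ℂ) / d = t := by
        apply mul_left_cancel₀ h2
        rw [ht]; ring
      rw [div_eq_iff hd'] at h3
      have : (s : ℂ) = ((d * t : ℤ) : ℂ) := by rw [h3]; push_cast; ring
      exact_mod_cast this
    rw [geom_sum_eq h1, hpow, sub_self, zero_div]

theorem ofComplex_affine (z : ℍ) {a d : ℕ} (ha : 0 < a) (hd : 0 < d) (b : ℕ) :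
    ((ofComplex (((a : ℂ) * (z : ℂ) + (b : ℂ)) / (d : ℂ)) : ℍ).im = a * z.im / d) ∧
    ((ofComplex (((a : ℂ) * (z : ℂ) + (b : ℂ)) / (d : ℂ)) : ℍ).re = (a * z.re + b) / d) := by
  have e : ((a : ℂ) * (z : ℂ) + (b : ℂ)) / (d : ℂ) =
      ((⟨(a * z.re + b) / d, a * z.im / d⟩ : ℂ)) := by
    have hd' : (d : ℂ) ≠ 0 := by exact_mod_cast hd.ne'
    rw [div_eq_iff hd']
    have hd'' : (d : ℝ) ≠ 0 := by exact_mod_cast hd.ne'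
    apply Complex.ext
    · simp; field_simp
    · simp; field_simp
  have hpos : 0 < (((a : ℂ) * (z : ℂ) + (b : ℂ)) / (d : ℂ)).im := by
    rw [e]
    have := z.im_pos
    positivity
  rw [ofComplex_apply_of_im_pos hpos]
  constructor
  · simp only [UpperHalfPlane.im]; rw [e]; rfl
  · simp only [UpperHalfPlane.re]; rw [e]; rfl

/-- The effect of a Hecke operator on an expansion is the Hecke operator on coefficients. -/
theorem dvd_sq_sub_one {N : ℕ} (hN : 0 < N) (hN24 : N ∣ 24) {d : ℕ} (hd : d.Coprime N) :
    (N : ℤ) ∣ (d : ℤ) ^ 2 - 1 := by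
  have hN24' : N ∈ Nat.divisors 24 := by simp [hN24]
  have : ∀ N ∈ Nat.divisors 24, ∀ d ∈ Finset.range N, d.Coprime N → d ^ 2 % N = 1 % N := by
    decide
  have h1 := this N hN24' (d % N) (Finset.mem_range.mpr (Nat.mod_lt _ hN)) (by
    rw [Nat.Coprime, ← Nat.gcd_rec, Nat.gcd_comm]; exact hd)
  rw [← Nat.pow_mod] at h1
  have h2 : (1 : ℕ) ≡ d ^ 2 [MOD N] := h1.symm
  have := (Nat.modEq_iff_dvd.mp h2)
  simpa using this

/-- For one factorisation $m=ad$ the sum over $b$ is a complete character sum modulo $d$, which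
keeps only $q=dj$; the surviving term has frequency $aj/N$. The condition $d^2\equiv1\pmod N$ is
what makes the twist $\xi^{-bd}$ fit the support $q\equiv r\pmod N$. -/
theorem hasSum_heckeOp {N : ℕ} {k κ r : ℤ} (hN : 0 < N) (hN24 : N ∣ 24)
    (hξ : xi κ = Complex.exp (2 * Real.pi * Complex.I * (r / N))) {w : ℝ → ℂ} {x : ℤ → ℂ}
    {f : ℍ → ℂ} (hx : ∀ z, HasSum (fun q => x q * expTerm N w q z) (f z))
    (hsupp : ∀ q, x q ≠ 0 → (N : ℤ) ∣ q - r) {m : ℕ} (hm0 : 0 < m) (hm : m.Coprime N) (z : ℍ) :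
    HasSum (fun q => heckeCoeff (chi k) m x q * expTerm N w q z) (heckeOp k κ m f z) := by
  have hN' : (N : ℂ) ≠ 0 := by exact_mod_cast hN.ne'
  have hsq : ∀ d : ℕ, d.Coprime N → (N : ℤ) ∣ (d : ℤ) ^ 2 - 1 := fun d hd =>
    dvd_sq_sub_one hN hN24 hd
  -- the contribution of one pair `(a, d)`
  have key : ∀ p ∈ m.divisorsAntidiagonal, HasSum (fun Q : ℤ =>
      if ((p.1 : ℕ) : ℤ) ∣ Q then ((Real.sqrt m : ℝ) : ℂ) * (chi k p.2 * x (p.2 * (Q / (p.1 : ℕ))) *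
        expTerm N w Q z) else 0)
      (chi k p.2 * ∑ b ∈ Finset.range p.2, xi κ ^ (-((b : ℤ) * (p.2 : ℤ))) *
        f (ofComplex (((p.1 : ℂ) * (z : ℂ) + (b : ℂ)) / (p.2 : ℂ)))) := by
    rintro ⟨a, d⟩ hp
    obtain ⟨hp1, -⟩ := Nat.mem_divisorsAntidiagonal.mp hp
    dsimp only at hp1 ⊢
    have ha : 0 < a := Nat.pos_of_mul_pos_right (hp1 ▸ hm0)
    have hd : 0 < d := Nat.pos_of_mul_pos_left (hp1 ▸ hm0)
    have hdN : d.Coprime N := Nat.Coprime.coprime_dvd_left ⟨a, by rw [← hp1, mul_comm]⟩ hm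
    have hd' : (d : ℂ) ≠ 0 := by exact_mod_cast hd.ne'
    have hd'' : (d : ℝ) ≠ 0 := by exact_mod_cast hd.ne'
    have ha'' : (a : ℝ) ≠ 0 := by exact_mod_cast ha.ne'
    have h1 : HasSum (fun q : ℤ => ∑ b ∈ Finset.range d, xi κ ^ (-((b : ℤ) * (d : ℤ))) *
        (x q * expTerm N w q (ofComplex (((a : ℂ) * (z : ℂ) + (b : ℂ)) / (d : ℂ)))))
        (∑ b ∈ Finset.range d, xi κ ^ (-((b : ℤ) * (d : ℤ))) *
        f (ofComplex (((a : ℂ) * (z : ℂ) + (b : ℂ)) / (d : ℂ)))) :=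
      hasSum_sum fun b _ => (hx _).mul_left _
    have h2 : ∀ q : ℤ, (∑ b ∈ Finset.range d, xi κ ^ (-((b : ℤ) * (d : ℤ))) *
        (x q * expTerm N w q (ofComplex (((a : ℂ) * (z : ℂ) + (b : ℂ)) / (d : ℂ))))) =
        if (d : ℤ) ∣ q then (d : ℂ) * (x q * (((1 / Real.sqrt |(q : ℝ)| : ℝ) : ℂ) *
          w (q * (a * z.im / d)) *
          Complex.exp (2 * Real.pi * Complex.I * ((q * (a * z.re / d) / N : ℝ) : ℂ)))) else 0 := by
      intro q
      by_cases hxq : x q = 0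
      · simp [hxq]
      -- The twist contributes $e(-rbd/N)$ and the translation $e(qb/(dN))$; their product is
      -- $e(bs/d)$ with $Ns=q-rd^2$, and $d\mid s$ exactly when $d\mid q$.
      obtain ⟨s, hs⟩ : (N : ℤ) ∣ q - r * d ^ 2 := by
        have h3 := hsupp q hxq
        have h4 := (hsq d hdN).mul_left r
        have : q - r * d ^ 2 = (q - r) - r * (d ^ 2 - 1) := by ring
        rw [this]; exact dvd_sub h3 h4
      have hds : (d : ℤ) ∣ s ↔ (d : ℤ) ∣ q := by
        have hc : IsCoprime (d : ℤ) N := Nat.isCoprime_iff_coprime.mpr hdN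
        constructor
        · intro h
          have : q = N * s + r * d ^ 2 := by rw [← hs]; ring
          rw [this]
          exact dvd_add (h.mul_left _) (Dvd.intro_left (r * d) (by ring))
        · intro h
          have : (d : ℤ) ∣ N * s := by
            rw [← hs]; exact dvd_sub h (Dvd.intro_left (r * d) (by ring))
          exact hc.dvd_of_dvd_mul_left this
      have h5 := sum_range_exp_eq hd s
      simp only [hds] at h5
      have hsC : (q : ℂ) = N * s + r * d ^ 2 := by
        have : q = N * s + r * d ^ 2 := by rw [← hs]; ring
        exact_mod_cast this
      have h6 : ∀ b ∈ Finset.range d, xi κ ^ (-((b : ℤ) * (d : ℤ))) *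
        (x q * expTerm N w q (ofComplex (((a : ℂ) * (z : ℂ) + (b : ℂ)) / (d : ℂ)))) =
        Complex.exp (2 * Real.pi * Complex.I * (b * s / d)) *
          (x q * (((1 / Real.sqrt |(q : ℝ)| : ℝ) : ℂ) * w (q * (a * z.im / d)) *
          Complex.exp (2 * Real.pi * Complex.I * ((q * (a * z.re / d) / N : ℝ) : ℂ)))) := by
        intro b _
        obtain ⟨e1, e2⟩ := ofComplex_affine z ha hd b
        rw [expTerm, e1, e2, hξ, ← Complex.exp_int_mul]
        have : ∀ A B C D E F : ℂ, A * E = B * F → A * (C * (D * E)) = B * (C * (D * F)) := by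
          intro A B C D E F h; linear_combination C * D * h
        apply this
        rw [← Complex.exp_add, ← Complex.exp_add]
        congr 1
        push_cast
        rw [hsC]
        field_simp
        ring
      rw [Finset.sum_congr rfl h6, ← Finset.sum_mul, h5]
      split_ifs <;> simp
    simp_rw [h2] at h1
    -- reindex `q = d * j`, `Q = a * j`
    have inj : ∀ {c : ℕ}, 0 < c → Function.Injective (fun j : ℤ => (c : ℤ) * j) := by
      intro c hc j j' h
      exact mul_left_cancel₀ (by positivity) h
    rw [← (inj hd).hasSum_iff] at h1
    swap
    · intro q hq
      rw [if_neg]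
      rintro ⟨j, rfl⟩
      exact hq ⟨j, rfl⟩
    have h7 := h1.mul_left (chi k d)
    rw [← (inj ha).hasSum_iff]
    swap
    · intro q hq
      rw [if_neg]
      rintro ⟨j, rfl⟩
      exact hq ⟨j, rfl⟩
    refine h7.congr_fun fun j => ?_
    simp only [Function.comp, dvd_mul_right, if_true, expTerm]
    rw [Int.mul_ediv_cancel_left _ (by positivity : (a : ℤ) ≠ 0)]
    have e1 : ((a : ℤ) * j : ℤ) * z.im = ((d : ℤ) * j : ℤ) * (a * z.im / d) := by
      push_cast; field_simp
    have e2 : (((a : ℤ) * j : ℤ) * z.re / N : ℝ) = ((d : ℤ) * j : ℤ) * (a * z.re / d) / N := by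
      push_cast; field_simp
    rw [e1, e2]
    -- With $m=ad$ both sides are $\sqrt{d/|j|}$: the factor $d$ from the character sum is absorbed
    -- by the normalisation $1/\sqrt{|q|}$.
    have e3 : Real.sqrt m * (1 / Real.sqrt |(((a : ℤ) * j : ℤ) : ℝ)|) =
        d * (1 / Real.sqrt |(((d : ℤ) * j : ℤ) : ℝ)|) := by
      rw [← hp1]
      push_cast
      rw [abs_mul, abs_mul, Nat.abs_cast, Nat.abs_cast, Real.sqrt_mul (by positivity),
        Real.sqrt_mul (by positivity), Real.sqrt_mul (by positivity)]
      have s1 : Real.sqrt a ≠ 0 := by positivity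
      have s2 : Real.sqrt d ≠ 0 := by positivity
      by_cases hj : Real.sqrt |(j : ℝ)| = 0
      · simp [hj]
      field_simp
      exact Real.sq_sqrt (by positivity)
    have e3' : ((Real.sqrt m : ℝ) : ℂ) * ((1 / Real.sqrt |(((a : ℤ) * j : ℤ) : ℝ)| : ℝ) : ℂ) =
        d * ((1 / Real.sqrt |(((d : ℤ) * j : ℤ) : ℝ)| : ℝ) : ℂ) := by
      have := congrArg (fun t : ℝ => (t : ℂ)) e3
      simpa only [Complex.ofReal_mul, Complex.ofReal_natCast] using this
    linear_combination (chi k d * x (d * j) * w (((d : ℤ) * j : ℤ) * (a * z.im / d)) *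
      Complex.exp (2 * Real.pi * Complex.I * ((((d : ℤ) * j : ℤ) * (a * z.re / d) / N : ℝ) : ℂ)))
      * e3'
  have h := (hasSum_sum key).mul_left ((1 / Real.sqrt m : ℝ) : ℂ)
  refine h.congr_fun fun Q => ?_
  have hs : ((Real.sqrt m : ℝ) : ℂ) ≠ 0 := by
    have : (0 : ℝ) < m := by exact_mod_cast hm0
    exact_mod_cast (Real.sqrt_pos.mpr this).ne'
  rw [heckeCoeff, Finset.sum_mul, Finset.sum_filter,
    Nat.sum_divisorsAntidiagonal (f := fun a d => if ((a : ℕ) : ℤ) ∣ Q then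
      ((Real.sqrt m : ℝ) : ℂ) * (chi k d * x (d * (Q / (a : ℕ))) * expTerm N w Q z) else 0),
    Finset.mul_sum]
  refine Finset.sum_congr rfl fun a ha => ?_
  split_ifs
  · push_cast
    field_simp
  · simp

/-! ### The multiplier on integral matrices -/

/-- The exponent of the eta multiplier, as a polynomial in the entries of a matrix. -/
def etaPoly {R : Type*} [CommRing R] (a b c d : R) : R :=
  (a + d * (a * d - b * c)) * c - b * d * (c ^ 2 - 1) +
    3 * (-c ^ 3 + (1 - c ^ 2) * (d * (a * d - b * c) - 1 - c * d * (a * d - b * c))) -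
    3 * (a * d - b * c - 1)

theorem etaPoly_cast {R : Type*} [CommRing R] (a b c d : ℤ) :
    ((etaPoly a b c d : ℤ) : R) = etaPoly (a : R) b c d := by
  simp [etaPoly]

/-- In order: left multiplication by $T$ and $S$, right multiplication by $T$ and $S$, the adjugate,
and upper triangular matrices. All are polynomial identities in the residues of the entries, valid
as soon as the determinant is prime to $3$; the companion modulo $4$ needs an odd determinant,
expressed by $2\det\ne0$. -/
theorem etaPoly_identities_three : ∀ a b c d : ZMod 3, a * d - b * c ≠ 0 →
    etaPoly (a + c) (b + d) c d = etaPoly a b c d + 1 ∧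
    etaPoly (-c) (-d) a b = etaPoly a b c d - 3 ∧
    etaPoly a (a + b) c (c + d) = etaPoly a b c d + (a * d - b * c) ∧
    etaPoly b (-a) d (-c) = etaPoly a b c d - 3 * (a * d - b * c) ∧
    etaPoly d (-b) (-c) a = -(a * d - b * c) * etaPoly a b c d + 3 * (a * d - b * c - 1) ∧
    (c = 0 → etaPoly a b c d = b * d + 3 * (d - 1)) := by decide

theorem etaPoly_identities_four : ∀ a b c d : ZMod 4, 2 * (a * d - b * c) ≠ 0 →
    etaPoly (a + c) (b + d) c d = etaPoly a b c d + 1 ∧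
    etaPoly (-c) (-d) a b = etaPoly a b c d - 3 ∧
    etaPoly a (a + b) c (c + d) = etaPoly a b c d + (a * d - b * c) ∧
    etaPoly b (-a) d (-c) = etaPoly a b c d - 3 * (a * d - b * c) ∧
    etaPoly d (-b) (-c) a = -(a * d - b * c) * etaPoly a b c d + 3 * (a * d - b * c - 1) ∧
    (c = 0 → etaPoly a b c d = b * d + 3 * (d - 1)) := by decide

/-- `m` is prime to the order `12 / gcd(κ, 12)` of the multiplier of class `κ`. -/
def IsGood (κ m : ℤ) : Prop := (3 ∣ κ ∨ ¬ 3 ∣ m) ∧ (4 ∣ κ ∨ ¬ 2 ∣ m)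

theorem IsGood.mul_left {κ m : ℤ} (h : IsGood κ m) (t : ℤ) : IsGood (κ * t) m :=
  ⟨h.1.imp (fun h => h.mul_right t) id, h.2.imp (fun h => h.mul_right t) id⟩

theorem IsGood.dvd {κ m s : ℤ} (h : IsGood κ m) (h3 : ¬ (3 : ℤ) ∣ m → (3 : ℤ) ∣ s)
    (h4 : ¬ (2 : ℤ) ∣ m → (4 : ℤ) ∣ s) : (12 : ℤ) ∣ κ * s := by
  have e3 : (3 : ℤ) ∣ κ * s := by
    rcases h.1 with h | h
    · exact h.mul_right s
    · exact (h3 h).mul_left κ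
  have e4 : (4 : ℤ) ∣ κ * s := by
    rcases h.2 with h | h
    · exact h.mul_right s
    · exact (h4 h).mul_left κ
  have : IsCoprime (3 : ℤ) 4 := ⟨-1, 1, by norm_num⟩
  simpa using this.mul_dvd e3 e4

/-- At each of the primes $2$ and $3$, `IsGood` says that either $\kappa$ already supplies the
required power, or the determinant is prime to it and the finite check applies. Left multiplication
involves the class $\kappa$, right multiplication the class $\kappa m$: this is why $T_m$ changes
the class. -/
theorem etaPoly_identities {κ m : ℤ} (h : IsGood κ m) {a b c d : ℤ} (hdet : a * d - b * c = m) :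
    12 ∣ κ * (etaPoly (a + c) (b + d) c d - (etaPoly a b c d + 1)) ∧
    12 ∣ κ * (etaPoly (-c) (-d) a b - (etaPoly a b c d - 3)) ∧
    12 ∣ κ * (etaPoly a (a + b) c (c + d) - (etaPoly a b c d + m)) ∧
    12 ∣ κ * (etaPoly b (-a) d (-c) - (etaPoly a b c d - 3 * m)) ∧
    12 ∣ κ * (etaPoly d (-b) (-c) a - (-m * etaPoly a b c d + 3 * (m - 1))) ∧
    (c = 0 → 12 ∣ κ * (etaPoly a b c d - (b * d + 3 * (d - 1)))) := by
  have h3 : ¬ (3 : ℤ) ∣ m → ((a : ZMod 3) * d - b * c ≠ 0) := by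
    intro h h'
    apply h
    have : ((m : ℤ) : ZMod 3) = 0 := by rw [← hdet]; push_cast; exact h'
    exact (ZMod.intCast_zmod_eq_zero_iff_dvd m 3).mp this
  have h4 : ¬ (2 : ℤ) ∣ m → (2 * ((a : ZMod 4) * d - b * c) ≠ 0) := by
    intro h h'
    apply h
    have : ((2 * m : ℤ) : ZMod 4) = 0 := by rw [← hdet]; push_cast; exact h'
    have := (ZMod.intCast_zmod_eq_zero_iff_dvd (2 * m) 4).mp this
    push_cast at this
    omega
  have hc3 : ∀ s : ℤ, ((s : ZMod 3) = 0) → (3 : ℤ) ∣ s := fun s hs =>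
    (ZMod.intCast_zmod_eq_zero_iff_dvd s 3).mp hs
  have hc4 : ∀ s : ℤ, ((s : ZMod 4) = 0) → (4 : ℤ) ∣ s := fun s hs =>
    (ZMod.intCast_zmod_eq_zero_iff_dvd s 4).mp hs
  refine ⟨?_, ?_, ?_, ?_, ?_, ?_⟩
  · refine h.dvd (fun h => hc3 _ ?_) (fun h => hc4 _ ?_) <;>
      simp only [Int.cast_sub, Int.cast_add, Int.cast_one, etaPoly_cast]
    · rw [(etaPoly_identities_three _ _ _ _ (h3 h)).1, sub_self]
    · rw [(etaPoly_identities_four _ _ _ _ (h4 h)).1, sub_self]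
  · refine h.dvd (fun h => hc3 _ ?_) (fun h => hc4 _ ?_) <;>
      simp only [Int.cast_sub, Int.cast_neg, Int.cast_ofNat, etaPoly_cast]
    · rw [(etaPoly_identities_three _ _ _ _ (h3 h)).2.1, sub_self]
    · rw [(etaPoly_identities_four _ _ _ _ (h4 h)).2.1, sub_self]
  · refine h.dvd (fun h => hc3 _ ?_) (fun h => hc4 _ ?_) <;> rw [← hdet] <;>
      simp only [Int.cast_sub, Int.cast_add, Int.cast_mul, etaPoly_cast]
    · rw [(etaPoly_identities_three _ _ _ _ (h3 h)).2.2.1, sub_self]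
    · rw [(etaPoly_identities_four _ _ _ _ (h4 h)).2.2.1, sub_self]
  · refine h.dvd (fun h => hc3 _ ?_) (fun h => hc4 _ ?_) <;> rw [← hdet] <;>
      simp only [Int.cast_sub, Int.cast_neg, Int.cast_ofNat, Int.cast_mul, etaPoly_cast]
    · rw [(etaPoly_identities_three _ _ _ _ (h3 h)).2.2.2.1, sub_self]
    · rw [(etaPoly_identities_four _ _ _ _ (h4 h)).2.2.2.1, sub_self]
  · refine h.dvd (fun h => hc3 _ ?_) (fun h => hc4 _ ?_) <;> rw [← hdet] <;>
      simp only [Int.cast_sub, Int.cast_neg, Int.cast_ofNat, Int.cast_mul, Int.cast_add,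
        Int.cast_one, etaPoly_cast]
    · rw [(etaPoly_identities_three _ _ _ _ (h3 h)).2.2.2.2.1, sub_self]
    · rw [(etaPoly_identities_four _ _ _ _ (h4 h)).2.2.2.2.1, sub_self]
  · intro hc
    refine h.dvd (fun h => hc3 _ ?_) (fun h => hc4 _ ?_) <;>
      simp only [Int.cast_sub, Int.cast_ofNat, Int.cast_mul, Int.cast_add,
        Int.cast_one, etaPoly_cast]
    · rw [(etaPoly_identities_three _ _ _ _ (h3 h)).2.2.2.2.2 (by simp [hc]), sub_self]
    · rw [(etaPoly_identities_four _ _ _ _ (h4 h)).2.2.2.2.2 (by simp [hc]), sub_self]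

/-- `e(s / 12)`. -/
def e12 (s : ℤ) : ℂ := Complex.exp (2 * Real.pi * Complex.I * ((s : ℂ) / 12))

theorem e12_add (s t : ℤ) : e12 (s + t) = e12 s * e12 t := by
  rw [e12, e12, e12, ← Complex.exp_add]; congr 1; push_cast; ring

theorem e12_eq_one {s : ℤ} (h : (12 : ℤ) ∣ s) : e12 s = 1 := by
  obtain ⟨t, rfl⟩ := h
  rw [e12, Complex.exp_eq_one_iff]
  exact ⟨t, by push_cast; ring⟩

theorem e12_congr {s t : ℤ} (h : (12 : ℤ) ∣ s - t) : e12 s = e12 t := by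
  rw [show s = (s - t) + t by ring, e12_add, e12_eq_one h, one_mul]

theorem norm_e12 (s : ℤ) : ‖e12 s‖ = 1 := by
  rw [e12, show (2 * Real.pi * Complex.I * ((s : ℂ) / 12)) =
    ((2 * Real.pi * (s / 12) : ℝ) : ℂ) * Complex.I by push_cast; ring, Complex.norm_exp_ofReal_mul_I]

theorem e12_neg (s : ℤ) : e12 (-s) = (e12 s)⁻¹ := by
  apply eq_inv_of_mul_eq_one_left
  rw [← e12_add, neg_add_cancel, e12_eq_one (dvd_zero _)]

theorem conj_e12 (s : ℤ) : (starRingEnd ℂ) (e12 s) = e12 (-s) := by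
  rw [e12, e12, ← Complex.exp_conj]
  congr 1
  simp only [map_mul, map_div₀, Complex.conj_ofReal, Complex.conj_I, map_intCast, map_ofNat]
  push_cast
  ring

theorem e12_mul (s t : ℤ) : e12 (s * t) = e12 s ^ t := by
  rw [e12, e12, ← Complex.exp_int_mul]; congr 1; push_cast; ring

theorem xi_eq (κ : ℤ) : xi κ = e12 κ := rfl

theorem I_eq_e12 : Complex.I = e12 3 := by
  rw [e12, show (2 * Real.pi * Complex.I * (((3 : ℤ) : ℂ) / 12)) = Real.pi / 2 * Complex.I by
    push_cast; ring, Complex.exp_pi_div_two_mul_I]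

theorem chi_eq (k : ℤ) (d : ℕ) : chi k d = e12 (3 * (k * (d - 1))) := by
  rw [chi, I_eq_e12, ← e12_mul]

/-- The multiplier of class `κ`, on integral matrices. -/
def mult (κ : ℤ) (M : Matrix (Fin 2) (Fin 2) ℤ) : ℂ :=
  e12 (κ * etaPoly (M 0 0) (M 0 1) (M 1 0) (M 1 1))

/-- Since $ab-1=(a-1)+(b-1)+(a-1)(b-1)$, this is the multiplicativity of $\chi_k$ on admissible
integers. -/
theorem IsGood.four_dvd {k : ℤ} {a b : ℤ} (ha : IsGood k a) (hb : IsGood k b) :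
    (4 : ℤ) ∣ k * ((a - 1) * (b - 1)) := by
  rcases ha.2 with h | h
  · exact h.mul_right _
  rcases hb.2 with h' | h'
  · exact h'.mul_right _
  obtain ⟨s, hs⟩ : (2 : ℤ) ∣ a - 1 := by omega
  obtain ⟨t, ht⟩ : (2 : ℤ) ∣ b - 1 := by omega
  exact ⟨k * (s * t), by rw [hs, ht]; ring⟩

theorem IsGood.four_dvd_two {k : ℤ} {a : ℤ} (ha : IsGood k a) :
    (4 : ℤ) ∣ 2 * (k * (a - 1)) := by
  rcases ha.2 with h | h
  · exact (h.mul_right _).mul_left _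
  obtain ⟨s, hs⟩ : (2 : ℤ) ∣ a - 1 := by omega
  exact ⟨k * s, by rw [hs]; ring⟩

theorem isQuadratic_chi {N : ℕ} {k : ℤ} (hN : ∀ a : ℕ, a.Coprime N → IsGood k a) :
    IsQuadratic N (chi k) where
  map_mul a b ha hb := by
    rw [chi_eq, chi_eq, chi_eq, ← e12_add]
    apply e12_congr
    obtain ⟨t, ht⟩ := (hN a ha).four_dvd (hN b hb)
    refine ⟨t, ?_⟩
    push_cast
    linear_combination 3 * ht
  sq a ha := by
    rw [chi_eq, ← e12_add]
    apply e12_eq_one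
    obtain ⟨t, ht⟩ := (hN a ha).four_dvd_two
    exact ⟨t, by linear_combination 3 * ht⟩
  real a ha := by
    rw [chi_eq, conj_e12]
    apply e12_congr
    obtain ⟨t, ht⟩ := (hN a ha).four_dvd_two
    exact ⟨-t, by linear_combination -3 * ht⟩

set_option linter.unusedSectionVars false

/-! ### Integral matrices of fixed determinant -/

/-- Integral matrices of determinant `m`. -/
abbrev DetMat (m : ℕ) : Type := FixedDetMatrix (Fin 2) ℤ (m : ℤ)

section

variable {m : ℕ} [NeZero m]

/-- An integral matrix of determinant `m > 0` as an element of `GL(2, ℝ)`. -/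
def toGL (M : DetMat m) : GL (Fin 2) ℝ :=
  Matrix.GeneralLinearGroup.mkOfDetNeZero (M.1.map (Int.castRingHom ℝ)) (by
    rw [← RingHom.mapMatrix_apply, ← RingHom.map_det, M.2]
    simpa using NeZero.ne m)

theorem toGL_apply (M : DetMat m) (i j : Fin 2) : (toGL M) i j = (M.1 i j : ℝ) := rfl

theorem det_toGL (M : DetMat m) : ((toGL M).det.val : ℝ) = m := by
  have : (toGL M).val.det = ((M.1.det : ℤ) : ℝ) := by
    change (M.1.map (Int.castRingHom ℝ)).det = _
    rw [← RingHom.mapMatrix_apply, ← RingHom.map_det]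
    simp
  rw [Matrix.GeneralLinearGroup.val_det_apply, this, M.2]
  simp

theorem det_toGL_pos (M : DetMat m) : 0 < ((toGL M).det.val : ℝ) := by
  rw [det_toGL]; exact_mod_cast Nat.pos_of_ne_zero (NeZero.ne m)

/-- Multiplication on the right by an element of the modular group. -/
def mulRight (M : DetMat m) (γ : SL(2, ℤ)) : DetMat m :=
  ⟨M.1 * (γ : Matrix (Fin 2) (Fin 2) ℤ), by simp [M.2]⟩

/-- The adjugate matrix. -/
def adj (M : DetMat m) : DetMat m := ⟨M.1.adjugate, by simp [Matrix.det_adjugate, M.2]⟩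

theorem adj_adj (M : DetMat m) : adj (adj M) = M := by
  apply Subtype.ext
  simp only [adj]
  rw [Matrix.adjugate_adjugate _ (by simp)]
  simp

theorem toGL_smul (γ : SL(2, ℤ)) (M : DetMat m) : toGL (γ • M) = (γ : GL (Fin 2) ℝ) * toGL M := by
  ext i j
  rw [toGL_apply, FixedDetMatrices.smul_coe]
  simp [Matrix.mul_apply, toGL_apply]

theorem toGL_mulRight (M : DetMat m) (γ : SL(2, ℤ)) :
    toGL (mulRight M γ) = toGL M * (γ : GL (Fin 2) ℝ) := by
  ext i j
  rw [toGL_apply]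
  simp [mulRight, Matrix.mul_apply, toGL_apply]

theorem toGL_adj_mul (M : DetMat m) : toGL (adj M) * toGL M =
    Matrix.GeneralLinearGroup.scalar (Fin 2) (Units.mk0 (m : ℝ) (by exact_mod_cast NeZero.ne m)) := by
  ext i j
  have h : (adj M).1 * M.1 = (m : ℤ) • (1 : Matrix (Fin 2) (Fin 2) ℤ) := by
    simp only [adj]; rw [Matrix.adjugate_mul, M.2]
  have h2 := congrFun (congrFun (congrArg (fun A => A.map (Int.cast : ℤ → ℝ)) h) i) j
  simp only [Matrix.map_apply, Matrix.mul_apply, Fin.sum_univ_two, Int.cast_add,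
    Int.cast_mul] at h2
  simp only [Matrix.GeneralLinearGroup.coe_mul, Matrix.mul_apply, Fin.sum_univ_two, toGL_apply]
  rw [h2]
  fin_cases i <;> fin_cases j <;> simp [Matrix.GeneralLinearGroup.scalar, Matrix.natCast_apply]

theorem adj_smul_smul (M : DetMat m) (z : ℍ) : toGL (adj M) • toGL M • z = z := by
  rw [← mul_smul, toGL_adj_mul, glScalar_smul]

/-- The weight `k` automorphy factor of `GL(2, ℝ)`. -/
def autJ (k : ℤ) (g : GL (Fin 2) ℝ) (z : ℍ) : ℂ := (denom g z / ‖denom g z‖) ^ k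

theorem autJ_ne_zero (k : ℤ) (g : GL (Fin 2) ℝ) (z : ℍ) : autJ k g z ≠ 0 := by
  apply zpow_ne_zero
  have := denom_ne_zero g z
  exact div_ne_zero this (by exact_mod_cast norm_ne_zero_iff.mpr this)

theorem norm_autJ (k : ℤ) (g : GL (Fin 2) ℝ) (z : ℍ) : ‖autJ k g z‖ = 1 := by
  have := denom_ne_zero g z
  rw [autJ, norm_zpow, norm_div, Complex.norm_real, norm_norm,
    div_self (norm_ne_zero_iff.mpr this), one_zpow]

theorem autJ_mul (k : ℤ) (g : GL (Fin 2) ℝ) {h : GL (Fin 2) ℝ} (hh : 0 < (h.det.val : ℝ)) (z : ℍ) :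
    autJ k (g * h) z = autJ k g (h • z) * autJ k h z := by
  have e : denom (g * h) z = denom g ↑(h • z) * denom h z := by
    rw [coe_smul_of_det_pos hh, denom_cocycle g h z.im_ne_zero]
  rw [autJ, autJ, autJ, e, ← mul_zpow, norm_mul]
  congr 1
  push_cast
  rw [mul_div_mul_comm]

theorem conj_autJ (k : ℤ) (g : GL (Fin 2) ℝ) (z : ℍ) :
    (starRingEnd ℂ) (autJ k g z) = (autJ k g z)⁻¹ :=
  (Complex.inv_eq_conj (norm_autJ k g z)).symm

theorem autJ_scalar (k : ℤ) {u : ℝˣ} (hu : 0 < (u : ℝ)) (z : ℍ) :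
    autJ k (Matrix.GeneralLinearGroup.scalar (Fin 2) u) z = 1 := by
  have hne : ((u : ℝ) : ℂ) ≠ 0 := by exact_mod_cast hu.ne'
  rw [autJ, denom_scalar, Complex.norm_real, Real.norm_eq_abs, abs_of_pos hu, div_self hne,
    one_zpow]

theorem autJ_adj (k : ℤ) (M : DetMat m) (z : ℍ) :
    autJ k (toGL (adj M)) (toGL M • z) = (autJ k (toGL M) z)⁻¹ := by
  apply eq_inv_of_mul_eq_one_left
  rw [← autJ_mul k _ (det_toGL_pos M), toGL_adj_mul, autJ_scalar]
  simpa using Nat.pos_of_ne_zero (NeZero.ne m)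

theorem mult_smul_T {κ : ℤ} (h : IsGood κ m) (M : DetMat m) :
    mult κ (ModularGroup.T • M).1 = e12 κ * mult κ M.1 := by
  have hd : M.1 0 0 * M.1 1 1 - M.1 0 1 * M.1 1 0 = m := by rw [← Matrix.det_fin_two, M.2]
  obtain ⟨t, ht⟩ := (etaPoly_identities h hd).1
  rw [mult, mult, ← e12_add]
  apply e12_congr
  rw [FixedDetMatrices.smul_coe]
  simp only [ModularGroup.coe_T, Matrix.mul_apply, Fin.sum_univ_two]
  simp
  exact ⟨t, by linear_combination ht⟩

theorem mult_smul_S {κ : ℤ} (h : IsGood κ m) (M : DetMat m) :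
    mult κ (ModularGroup.S • M).1 = e12 (-3 * κ) * mult κ M.1 := by
  have hd : M.1 0 0 * M.1 1 1 - M.1 0 1 * M.1 1 0 = m := by rw [← Matrix.det_fin_two, M.2]
  obtain ⟨t, ht⟩ := (etaPoly_identities h hd).2.1
  rw [mult, mult, ← e12_add]
  apply e12_congr
  rw [FixedDetMatrices.smul_coe]
  simp only [ModularGroup.coe_S, Matrix.mul_apply, Fin.sum_univ_two]
  simp
  exact ⟨t, by linear_combination ht⟩

theorem mult_mulRight_T {κ : ℤ} (h : IsGood κ m) (M : DetMat m) :
    mult κ (mulRight M ModularGroup.T).1 = mult κ M.1 * e12 (κ * m) := by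
  have hd : M.1 0 0 * M.1 1 1 - M.1 0 1 * M.1 1 0 = m := by rw [← Matrix.det_fin_two, M.2]
  obtain ⟨t, ht⟩ := (etaPoly_identities h hd).2.2.1
  rw [mult, mult, ← e12_add]
  apply e12_congr
  simp only [mulRight, ModularGroup.coe_T, Matrix.mul_apply, Fin.sum_univ_two]
  simp
  exact ⟨t, by linear_combination ht⟩

theorem mult_mulRight_S {κ : ℤ} (h : IsGood κ m) (M : DetMat m) :
    mult κ (mulRight M ModularGroup.S).1 = mult κ M.1 * e12 (-3 * (κ * m)) := by
  have hd : M.1 0 0 * M.1 1 1 - M.1 0 1 * M.1 1 0 = m := by rw [← Matrix.det_fin_two, M.2]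
  obtain ⟨t, ht⟩ := (etaPoly_identities h hd).2.2.2.1
  rw [mult, mult, ← e12_add]
  apply e12_congr
  simp only [mulRight, ModularGroup.coe_S, Matrix.mul_apply, Fin.sum_univ_two]
  simp
  exact ⟨t, by linear_combination ht⟩

/-- The adjugate acts on the half-plane as the inverse, so this identity produces the adjoint of
$T_m$: it passes from class $\kappa$ to class $\kappa m$ and costs the sign $\chi_\kappa(m)$. -/
theorem mult_adj {κ : ℤ} (h : IsGood κ m) (M : DetMat m) :
    mult κ (adj M).1 = chi κ m * (starRingEnd ℂ) (mult (κ * m) M.1) := by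
  have hd : M.1 0 0 * M.1 1 1 - M.1 0 1 * M.1 1 0 = m := by rw [← Matrix.det_fin_two, M.2]
  obtain ⟨t, ht⟩ := (etaPoly_identities h hd).2.2.2.2.1
  rw [mult, mult, conj_e12, chi_eq, ← e12_add]
  apply e12_congr
  simp only [adj, Matrix.adjugate_fin_two]
  simp
  exact ⟨t, by linear_combination ht⟩

theorem mult_upper {κ : ℤ} (h : IsGood κ m) (M : DetMat m) (hc : M.1 1 0 = 0) :
    mult κ M.1 = e12 (κ * (M.1 0 1 * M.1 1 1 + 3 * (M.1 1 1 - 1))) := by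
  have hd : M.1 0 0 * M.1 1 1 - M.1 0 1 * M.1 1 0 = m := by rw [← Matrix.det_fin_two, M.2]
  obtain ⟨t, ht⟩ := (etaPoly_identities h hd).2.2.2.2.2 hc
  rw [mult]
  apply e12_congr
  exact ⟨t, by linear_combination ht⟩

theorem norm_mult (κ : ℤ) (M : Matrix (Fin 2) (Fin 2) ℤ) : ‖mult κ M‖ = 1 := norm_e12 _

end

/-! ### Unfolding -/

/-- Uniqueness of the Hermite normal form: both matrices are upper triangular with positive first
entry and upper right entry reduced modulo the lower right one. -/
theorem eq_one_of_smul_reps {m : ℕ} [NeZero m] {δ : SL(2, ℤ)} {r r' : DetMat m}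
    (hr : r ∈ FixedDetMatrices.reps (m : ℤ)) (hr' : r' ∈ FixedDetMatrices.reps (m : ℤ))
    (h : δ • r = r') : δ = 1 := by
  obtain ⟨h10, h00, h01, h11⟩ := hr
  obtain ⟨h10', h00', h01', h11'⟩ := hr'
  have hd := δ.det_coe
  rw [Matrix.det_fin_two] at hd
  have e : ∀ i j, r'.1 i j = δ i 0 * r.1 0 j + δ i 1 * r.1 1 j := by
    intro i j
    rw [← h, FixedDetMatrices.smul_coe, Matrix.mul_apply, Fin.sum_univ_two]
  have e10 := e 1 0
  rw [h10, h10', mul_zero, add_zero] at e10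
  have hc : δ 1 0 = 0 := by
    rcases mul_eq_zero.mp e10.symm with h | h
    · exact h
    · exact absurd h h00.ne'
  rw [hc, mul_zero, sub_zero] at hd
  have e00 := e 0 0
  rw [h10, mul_zero, add_zero] at e00
  have ha : δ 0 0 = 1 := by
    rcases Int.mul_eq_one_iff_eq_one_or_neg_one.mp hd with ⟨h, -⟩ | ⟨h, -⟩
    · exact h
    · rw [h] at e00; omega
  rw [ha, one_mul] at hd
  have e11 := e 1 1
  have e01 := e 0 1
  rw [hc, hd, zero_mul, zero_add, one_mul] at e11
  rw [ha, one_mul] at e01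
  -- The two upper right entries lie in $[0,|d|)$ and differ by a multiple of $d$.
  have hb : δ 0 1 = 0 := by
    rw [abs_of_nonneg h01] at h11
    rw [e11, abs_of_nonneg h01'] at h11'
    by_contra hne
    have h1 : |r.1 1 1| ≤ |δ 0 1| * |r.1 1 1| :=
      le_mul_of_one_le_left (abs_nonneg _) (Int.one_le_abs hne)
    rw [← abs_mul] at h1
    have h2 : |δ 0 1 * r.1 1 1| < |r.1 1 1| := by
      rw [abs_lt]
      constructor <;> linarith
    linarith
  ext i j
  fin_cases i <;> fin_cases j <;> simp [ha, hb, hc, hd]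

/-- Every integral matrix of determinant `m` is uniquely a product of a modular matrix and a
representative. -/
def repsEquiv (m : ℕ) [NeZero m] :
    SL(2, ℤ) × FixedDetMatrices.reps (m : ℤ) ≃ DetMat m :=
  Equiv.ofBijective (fun p => p.1 • p.2.1) (by
    constructor
    · rintro ⟨γ, r⟩ ⟨γ', r'⟩ h
      dsimp only at h
      have h1 : (γ'⁻¹ * γ) • r.1 = r'.1 := by rw [mul_smul, h, inv_smul_smul]
      have h2 := eq_one_of_smul_reps r.2 r'.2 h1
      have h3 : γ = γ' := by rw [inv_mul_eq_one] at h2; exact h2.symm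
      subst h3
      rw [h2, one_smul] at h1
      exact Prod.ext rfl (Subtype.ext h1)
    · intro M
      refine FixedDetMatrices.induction_on (A := M) (by exact_mod_cast NeZero.ne m)
        (fun A h1 h2 h3 h4 => ⟨⟨1, A, h1, h2, h3, h4⟩, one_smul _ _⟩) ?_ ?_
      · rintro B ⟨⟨γ, r⟩, rfl⟩
        exact ⟨⟨ModularGroup.S * γ, r⟩, mul_smul _ _ _⟩
      · rintro B ⟨⟨γ, r⟩, rfl⟩
        exact ⟨⟨ModularGroup.T * γ, r⟩, mul_smul _ _ _⟩)

theorem repsEquiv_apply (m : ℕ) [NeZero m] (γ : SL(2, ℤ)) (r : FixedDetMatrices.reps (m : ℤ)) :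
    repsEquiv m (γ, r) = γ • r.1 := rfl

instance : Countable SL(2, ℤ) :=
  Function.Injective.countable (f := fun (g : SL(2, ℤ)) (i j : Fin 2) => g i j)
    (fun g h e => by ext i j; exact congrFun (congrFun e i) j)

instance (m : ℕ) [NeZero m] : Countable (DetMat m) := (repsEquiv m).symm.injective.countable

theorem measurePreserving_smul_GL (g : GL (Fin 2) ℝ) :
    MeasurePreserving (fun z : ℍ => g • z) volume volume :=
  measurePreserving_smul g volume

theorem measurePreserving_smul_SL (g : SL(2, ℤ)) :
    MeasurePreserving (fun z : ℍ => g • z) volume volume :=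
  measurePreserving_smul (g : GL (Fin 2) ℝ) volume

theorem volume_re_eq (c : ℝ) : volume {z : ℂ | z.re = c} = 0 := by
  have h := Complex.volume_preserving_equiv_real_prod.measure_preimage_equiv ({c} ×ˢ Set.univ)
  have e : Complex.measurableEquivRealProd ⁻¹' ({c} ×ˢ Set.univ) = {z : ℂ | z.re = c} := by
    ext z; simp [Complex.measurableEquivRealProd]
  rw [e] at h
  rw [h, Measure.volume_eq_prod, Measure.prod_prod]
  simp

/-- The boundary of the fundamental domain lies in the unit circle and two vertical lines. -/
theorem volume_fd_diff_fdo : volume (ModularGroup.fd \ ModularGroup.fdo) = 0 := by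
  rw [volume_eq_lintegral]
  apply setLIntegral_measure_zero
  have hsub : (UpperHalfPlane.coe '' (ModularGroup.fd \ ModularGroup.fdo)) ⊆
      Metric.sphere (0 : ℂ) 1 ∪ ({z : ℂ | z.re = 1 / 2} ∪ {z : ℂ | z.re = -1 / 2}) := by
    rintro _ ⟨z, ⟨hz, hz'⟩, rfl⟩
    simp only [ModularGroup.fd, ModularGroup.fdo, Set.mem_ofPred_eq] at hz hz'
    by_cases h1 : (1 : ℝ) < Complex.normSq z
    · right
      have h2 : |z.re| = 1 / 2 := le_antisymm hz.2 (not_lt.mp fun h => hz' ⟨h1, h⟩)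
      rcases abs_eq (by norm_num : (0 : ℝ) ≤ 1 / 2) |>.mp h2 with h | h
      · left; exact h
      · right
        change z.re = -1 / 2
        linarith
    · left
      have h2 : Complex.normSq z = 1 := le_antisymm (not_lt.mp h1) hz.1
      rw [mem_sphere_zero_iff_norm]
      rw [Complex.normSq_eq_norm_sq] at h2
      have := norm_nonneg (z : ℂ)
      nlinarith
  refine measure_mono_null hsub ?_
  rw [measure_union_null_iff, measure_union_null_iff]
  exact ⟨Measure.addHaar_sphere volume _ _, volume_re_eq _, volume_re_eq _⟩

/-- The exceptional points lie in countably many translates of a null boundary. Working with the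
open domain matters because there the translating element is unique up to sign. -/
theorem ae_exists_smul_mem_fdo :
    ∀ᵐ z : ℍ, ∃ γ : SL(2, ℤ), γ • z ∈ ModularGroup.fdo := by
  have h : ∀ᵐ z : ℍ, ∀ γ : SL(2, ℤ), γ • z ∉ ModularGroup.fd \ ModularGroup.fdo := by
    rw [ae_all_iff]
    intro γ
    have h0 : ∀ᵐ z : ℍ, z ∉ ModularGroup.fd \ ModularGroup.fdo :=
      measure_eq_zero_iff_ae_notMem.mp volume_fd_diff_fdo
    have h1 : ∀ᵐ z : ℍ, (fun w : ℍ => w ∉ ModularGroup.fd \ ModularGroup.fdo) (γ • z) :=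
      (measurePreserving_smul_SL γ).quasiMeasurePreserving.ae (p := fun w : ℍ =>
        w ∉ ModularGroup.fd \ ModularGroup.fdo) h0
    exact h1
  filter_upwards [h] with z hz
  obtain ⟨γ, hγ⟩ := ModularGroup.exists_smul_mem_fd z
  refine ⟨γ, ?_⟩
  by_contra hn
  exact hz γ ⟨hγ, hn⟩

-- Exactly the two elements $\pm\gamma_0$ move $z$ into the open fundamental domain, whence $c+c$
-- and the factor $2$ in the unfolding formulas.
open Classical in
theorem hasSum_indicator_fdo {A : Type*} [AddCommMonoid A] [TopologicalSpace A] {z : ℍ}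
    (hz : ∃ γ : SL(2, ℤ), γ • z ∈ ModularGroup.fdo) (c : A) :
    HasSum (fun γ : SL(2, ℤ) => if γ • z ∈ ModularGroup.fdo then c else 0) (c + c) := by
  obtain ⟨γ₀, h₀⟩ := hz
  have hne : γ₀ ≠ -γ₀ := by
    intro h
    have h2 : γ₀⁻¹ * γ₀ = γ₀⁻¹ * -γ₀ := congrArg (γ₀⁻¹ * ·) h
    rw [mul_neg, inv_mul_cancel] at h2
    have := congrArg (fun g : SL(2, ℤ) => g 0 0) h2
    simp at this
  have key : ∀ γ : SL(2, ℤ), γ • z ∈ ModularGroup.fdo ↔ γ = γ₀ ∨ γ = -γ₀ := by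
    intro γ
    constructor
    · intro h
      have e : γ • z = (γ * γ₀⁻¹) • γ₀ • z := by rw [mul_smul, inv_smul_smul]
      rw [e] at h
      rcases ModularGroup.eq_one_or_neg_one_of_mem_fdo_mem_fdo h₀ h with h | h
      · left; exact mul_inv_eq_one.mp h
      · right
        rw [mul_inv_eq_iff_eq_mul] at h
        rw [h, neg_mul, one_mul]
    · rintro (rfl | rfl)
      · exact h₀
      · rwa [ModularGroup.SL_neg_smul]
  have : HasSum (fun γ : SL(2, ℤ) => if γ • z ∈ ModularGroup.fdo then c else 0)
      (∑ γ ∈ ({γ₀, -γ₀} : Finset SL(2, ℤ)), if γ • z ∈ ModularGroup.fdo then c else 0) :=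
    hasSum_sum_of_ne_finset_zero (by
      intro γ hγ
      rw [if_neg]
      rw [key]
      simpa using hγ)
  rw [Finset.sum_pair hne, if_pos h₀, if_pos ((key _).mpr (Or.inr rfl))] at this
  exact this

/-- The part of the fundamental domain mapped to itself by `M`. -/
def selfPart {m : ℕ} [NeZero m] (M : DetMat m) : Set ℍ :=
  {z | z ∈ ModularGroup.fdo ∧ toGL M • z ∈ ModularGroup.fdo}

theorem measurableSet_fdo : MeasurableSet ModularGroup.fdo := ModularGroup.isOpen_fdo.measurableSet

theorem ae_exists_smul_toGL (m : ℕ) [NeZero m] :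
    ∀ᵐ z : ℍ, ∀ M : DetMat m, ∃ γ : SL(2, ℤ), γ • (toGL M • z) ∈ ModularGroup.fdo := by
  rw [ae_all_iff]
  intro M
  exact (measurePreserving_smul_GL (toGL M)).quasiMeasurePreserving.ae ae_exists_smul_mem_fdo

-- Each integral matrix is uniquely $\gamma r$ with $r$ a representative, and for almost every $z$
-- exactly two $\gamma$ bring $rz$ back to the domain. The sum over representatives thus becomes a
-- sum over all matrices, which is symmetric under $M\mapsto\operatorname{adj}M$.
open Classical in
theorem lintegral_unfold {m : ℕ} [NeZero m] {F : DetMat m → ℍ → ENNReal}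
    (hF : ∀ M, Measurable (F M)) (hinv : ∀ (γ : SL(2, ℤ)) M z, F (γ • M) z = F M z) :
    2 * ∫⁻ z in ModularGroup.fdo, ∑ r : FixedDetMatrices.reps (m : ℤ), F r.1 z =
      ∑' M : DetMat m, ∫⁻ z in selfPart M, F M z := by
  have h1 : ∀ᵐ z : ℍ, 2 * ∑ r : FixedDetMatrices.reps (m : ℤ), F r.1 z =
      ∑' M : DetMat m, if toGL M • z ∈ ModularGroup.fdo then F M z else 0 := by
    filter_upwards [ae_exists_smul_toGL m] with z hz
    rw [← (repsEquiv m).tsum_eq, ENNReal.tsum_prod', ENNReal.tsum_comm, tsum_fintype,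
      Finset.mul_sum]
    refine Finset.sum_congr rfl fun r _ => ?_
    rw [two_mul, ← (hasSum_indicator_fdo (hz r.1) (F r.1 z)).tsum_eq]
    refine tsum_congr fun γ => ?_
    rw [repsEquiv_apply, hinv, toGL_smul, mul_smul]
    rfl
  rw [← lintegral_const_mul _ (Finset.measurable_fun_sum _ fun r _ => hF r.1),
    lintegral_congr_ae (ae_restrict_of_ae h1), lintegral_tsum]
  · refine tsum_congr fun M => ?_
    have hm : MeasurableSet {z : ℍ | toGL M • z ∈ ModularGroup.fdo} :=
      (measurePreserving_smul_GL (toGL M)).measurable measurableSet_fdo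
    have : (fun z => if toGL M • z ∈ ModularGroup.fdo then F M z else 0) =
        {z : ℍ | toGL M • z ∈ ModularGroup.fdo}.indicator (F M) := by
      ext z; simp [Set.indicator]
    rw [this, lintegral_indicator hm, Measure.restrict_restrict hm]
    congr 2
    rw [Set.inter_comm]; rfl
  · intro M
    have hm : MeasurableSet {z : ℍ | toGL M • z ∈ ModularGroup.fdo} :=
      (measurePreserving_smul_GL (toGL M)).measurable measurableSet_fdo
    exact (Measurable.ite hm (hF M) measurable_const).aemeasurable

-- The complex version of the same unfolding; the finiteness hypothesis gives absolute convergence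
-- through the version for nonnegative functions.
open Classical in
theorem integral_unfold {m : ℕ} [NeZero m] {F : DetMat m → ℍ → ℂ}
    (hF : ∀ M, Measurable (F M)) (hinv : ∀ (γ : SL(2, ℤ)) M z, F (γ • M) z = F M z)
    (hfin : ∫⁻ z in ModularGroup.fdo, ∑ r : FixedDetMatrices.reps (m : ℤ), ‖F r.1 z‖ₑ ≠ ⊤) :
    2 * ∫ z in ModularGroup.fdo, ∑ r : FixedDetMatrices.reps (m : ℤ), F r.1 z =
      ∑' M : DetMat m, ∫ z in selfPart M, F M z := by
  have hm : ∀ M : DetMat m, MeasurableSet {z : ℍ | toGL M • z ∈ ModularGroup.fdo} := fun M =>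
      (measurePreserving_smul_GL (toGL M)).measurable measurableSet_fdo
  have hfin2 : ∑' M : DetMat m, ∫⁻ z in selfPart M, ‖F M z‖ₑ ≠ ⊤ := by
    rw [← lintegral_unfold (fun M => (hF M).enorm) (fun γ M z => by rw [hinv])]
    exact ENNReal.mul_ne_top (by norm_num) hfin
  have hG : ∀ M : DetMat m, (fun z => if toGL M • z ∈ ModularGroup.fdo then F M z else 0) =
        {z : ℍ | toGL M • z ∈ ModularGroup.fdo}.indicator (F M) := by
      intro M; ext z; simp [Set.indicator]
  have hI : ∀ M : DetMat m, ∫ z in ModularGroup.fdo,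
      (if toGL M • z ∈ ModularGroup.fdo then F M z else 0) = ∫ z in selfPart M, F M z := by
    intro M
    rw [hG, integral_indicator (hm M), Measure.restrict_restrict (hm M)]
    congr 2
    rw [Set.inter_comm]; rfl
  have hIe : ∀ M : DetMat m, ∫⁻ z in ModularGroup.fdo,
      ‖(if toGL M • z ∈ ModularGroup.fdo then F M z else 0)‖ₑ = ∫⁻ z in selfPart M, ‖F M z‖ₑ := by
    intro M
    have : (fun z => ‖(if toGL M • z ∈ ModularGroup.fdo then F M z else 0)‖ₑ) =
        {z : ℍ | toGL M • z ∈ ModularGroup.fdo}.indicator (fun z => ‖F M z‖ₑ) := by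
      ext z; by_cases h : toGL M • z ∈ ModularGroup.fdo <;> simp [Set.indicator, h]
    rw [this, lintegral_indicator (hm M), Measure.restrict_restrict (hm M)]
    congr 2
    rw [Set.inter_comm]; rfl
  have h1 : ∀ᵐ z : ℍ ∂(volume.restrict ModularGroup.fdo),
      2 * ∑ r : FixedDetMatrices.reps (m : ℤ), F r.1 z =
      ∑' M : DetMat m, if toGL M • z ∈ ModularGroup.fdo then F M z else 0 := by
    have hs : ∀ᵐ z : ℍ ∂(volume.restrict ModularGroup.fdo),
        ∑' M : DetMat m, ‖(if toGL M • z ∈ ModularGroup.fdo then F M z else 0)‖ₑ < ⊤ := by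
      apply ae_lt_top
      · exact Measurable.tsum fun M => (Measurable.ite (hm M) (hF M) measurable_const).enorm
      · rw [lintegral_tsum fun M =>
          (Measurable.ite (hm M) (hF M) measurable_const).enorm.aemeasurable]
        simpa only [hIe] using hfin2
    filter_upwards [ae_restrict_of_ae (ae_exists_smul_toGL m), hs] with z hz hs
    have hsum : Summable fun M : DetMat m =>
        (if toGL M • z ∈ ModularGroup.fdo then F M z else 0) := by
      apply Summable.of_enorm
      exact hs.ne
    rw [← (repsEquiv m).summable_iff] at hsum
    rw [← (repsEquiv m).tsum_eq]
    have hsum' := hsum.prod_symm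
    rw [← (Equiv.prodComm _ _).tsum_eq]
    refine Eq.trans ?_ (Summable.tsum_prod hsum').symm
    rw [tsum_fintype, Finset.mul_sum]
    refine Finset.sum_congr rfl fun r _ => ?_
    rw [two_mul, ← (hasSum_indicator_fdo (hz r.1) (F r.1 z)).tsum_eq]
    refine tsum_congr fun γ => ?_
    simp only [Function.comp, Prod.swap_prod_mk]
    rw [repsEquiv_apply, hinv, toGL_smul, mul_smul]
    rfl
  rw [← integral_const_mul, integral_congr_ae h1, integral_tsum]
  · exact tsum_congr hI
  · exact fun M => (Measurable.ite (hm M) (hF M) measurable_const).aestronglyMeasurable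
  · simpa only [hIe] using hfin2

theorem preimage_selfPart_adj {m : ℕ} [NeZero m] (M : DetMat m) :
    (fun z : ℍ => toGL M • z) ⁻¹' selfPart (adj M) = selfPart M := by
  ext z
  simp only [selfPart, Set.mem_preimage, Set.mem_ofPred_eq, adj_smul_smul, and_comm]

/-- The substitution $z\mapsto Mz$ preserves the measure and carries `selfPart M` to `selfPart (adj
M)`. This exchange of $z$ and $Mz$ is the source of adjointness. -/
theorem tsum_selfPart_swap {m : ℕ} [NeZero m] (F : DetMat m → ℍ → ℂ) :
    ∑' M : DetMat m, ∫ z in selfPart M, F (adj M) (toGL M • z) =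
      ∑' M : DetMat m, ∫ z in selfPart M, F M z := by
  have h : ∀ M : DetMat m, ∫ z in selfPart M, F (adj M) (toGL M • z) =
      ∫ z in selfPart (adj M), F (adj M) z := by
    intro M
    rw [← (measurePreserving_smul_GL (toGL M)).setIntegral_preimage_emb
      (measurableEmbedding_const_smul (toGL M)) (fun z => F (adj M) z) (selfPart (adj M)),
      preimage_selfPart_adj]
  simp_rw [h]
  exact (Function.Involutive.toPerm adj adj_adj).tsum_eq (fun M => ∫ z in selfPart M, F M z)

theorem tsum_selfPart_swap_lintegral {m : ℕ} [NeZero m] (F : DetMat m → ℍ → ENNReal) :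
    ∑' M : DetMat m, ∫⁻ z in selfPart M, F (adj M) (toGL M • z) =
      ∑' M : DetMat m, ∫⁻ z in selfPart M, F M z := by
  have h : ∀ M : DetMat m, ∫⁻ z in selfPart M, F (adj M) (toGL M • z) =
      ∫⁻ z in selfPart (adj M), F (adj M) z := by
    intro M
    rw [← (measurePreserving_smul_GL (toGL M)).setLIntegral_comp_preimage_emb
      (measurableEmbedding_const_smul (toGL M)) (fun z => F (adj M) z) (selfPart (adj M)),
      preimage_selfPart_adj]
  simp_rw [h]
  exact (Function.Involutive.toPerm adj adj_adj).tsum_eq (fun M => ∫⁻ z in selfPart M, F M z)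

/-! ### Automorphic functions, Hecke operators and the Petersson product -/

/-- Continuous functions on the upper half-plane which transform with weight `k` and the multiplier
of class `κ` under the generators of the modular group. -/
structure IsAutomorphic (k κ : ℤ) (f : ℍ → ℂ) : Prop where
  continuous : Continuous f
  map_T : ∀ z : ℍ, f (ModularGroup.T • z) = e12 κ * f z
  map_S : ∀ z : ℍ, f (ModularGroup.S • z) =
    e12 (-3 * κ) * autJ k (ModularGroup.S : GL (Fin 2) ℝ) z * f z

theorem autJ_T (k : ℤ) (z : ℍ) : autJ k (ModularGroup.T : GL (Fin 2) ℝ) z = 1 := by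
  rw [autJ, ModularGroup.denom_apply]
  simp [ModularGroup.T]

/-- One summand of a Hecke operator. -/
def heckeSummand {m : ℕ} [NeZero m] (k κ : ℤ) (f : ℍ → ℂ) (M : DetMat m) (z : ℍ) : ℂ :=
  (starRingEnd ℂ) (mult κ M.1) * (autJ k (toGL M) z)⁻¹ * f (toGL M • z)

theorem det_SL_pos (γ : SL(2, ℤ)) : 0 < ((γ : GL (Fin 2) ℝ).det.val : ℝ) := by simp

section

variable {m : ℕ} [NeZero m] {k κ : ℤ} {f : ℍ → ℂ}

theorem conj_e12_mul_self (s : ℤ) : (starRingEnd ℂ) (e12 s) * e12 s = 1 := by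
  rw [conj_e12, ← e12_add, neg_add_cancel, e12_eq_one (dvd_zero _)]

/-- The summand depends only on the class of $M$ modulo left multiplication by the modular group, so
the Hecke sum does not depend on the representatives. The generators $S$ and $T$ suffice. -/
theorem heckeSummand_smul (hf : IsAutomorphic k κ f) (h : IsGood κ m) (γ : SL(2, ℤ))
    (M : DetMat m) (z : ℍ) : heckeSummand k κ f (γ • M) z = heckeSummand k κ f M z := by
  have hγ : γ ∈ Subgroup.closure {ModularGroup.S, ModularGroup.T} := by
    rw [SpecialLinearGroup.SL2Z_generators]; trivial
  induction hγ using Subgroup.closure_induction generalizing M with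
  | mem γ hγ =>
    simp only [Set.mem_insert_iff, Set.mem_singleton_iff] at hγ
    rcases hγ with rfl | rfl
    · rw [heckeSummand, heckeSummand, mult_smul_S h, toGL_smul, autJ_mul k _ (det_toGL_pos M),
        mul_smul, map_mul]
      have := hf.map_S (toGL M • z)
      rw [show (ModularGroup.S : GL (Fin 2) ℝ) • toGL M • z = ModularGroup.S • toGL M • z from rfl,
        this]
      have h1 := conj_e12_mul_self (-3 * κ)
      have h2 := autJ_ne_zero k (ModularGroup.S : GL (Fin 2) ℝ) (toGL M • z)
      have h3 := autJ_ne_zero k (toGL M) z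
      field_simp
      linear_combination (starRingEnd ℂ) (mult κ M.1) * f (toGL M • z) * h1
    · rw [heckeSummand, heckeSummand, mult_smul_T h, toGL_smul, autJ_mul k _ (det_toGL_pos M),
        mul_smul, map_mul, autJ_T]
      have := hf.map_T (toGL M • z)
      rw [show (ModularGroup.T : GL (Fin 2) ℝ) • toGL M • z = ModularGroup.T • toGL M • z from rfl,
        this]
      have h1 := conj_e12_mul_self κ
      rw [one_mul]
      linear_combination (starRingEnd ℂ) (mult κ M.1) * (autJ k (toGL M) z)⁻¹ *
        f (toGL M • z) * h1
  | one => rw [one_smul]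
  | mul a b _ _ ha hb => rw [mul_smul, ha, hb]
  | inv a _ ha => rw [← ha (a⁻¹ • M), smul_inv_smul]

theorem norm_heckeSummand (M : DetMat m) (z : ℍ) :
    ‖heckeSummand k κ f M z‖ = ‖f (toGL M • z)‖ := by
  rw [heckeSummand, norm_mul, norm_mul, RCLike.norm_conj, norm_mult, norm_inv, norm_autJ]
  simp

theorem continuous_autJ (k : ℤ) (g : GL (Fin 2) ℝ) : Continuous (autJ k g) := by
  unfold autJ
  have hd : Continuous fun z : ℍ => denom g z := by unfold denom; fun_prop
  have hne : ∀ z : ℍ, denom g z ≠ 0 := fun z => denom_ne_zero g z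
  have hne' : ∀ z : ℍ, ((‖denom g z‖ : ℝ) : ℂ) ≠ 0 := fun z =>
    Complex.ofReal_ne_zero.mpr (norm_ne_zero_iff.mpr (hne z))
  exact Continuous.zpow₀ (hd.div (by fun_prop) hne') k fun z => Or.inl (div_ne_zero (hne z) (hne' z))

theorem continuous_heckeSummand (hf : IsAutomorphic k κ f) (M : DetMat m) :
    Continuous (heckeSummand k κ f M) := by
  unfold heckeSummand
  refine (continuous_const.mul ((continuous_autJ k _).inv₀ fun z => autJ_ne_zero k _ z)).mul ?_
  exact hf.continuous.comp (continuous_const_smul _)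

theorem heckeSummand_mulRight_T (h : IsGood κ m) (M : DetMat m) (z : ℍ) :
    heckeSummand k κ f M (ModularGroup.T • z) =
      e12 (κ * m) * heckeSummand k κ f (mulRight M ModularGroup.T) z := by
  rw [heckeSummand, heckeSummand, mult_mulRight_T h, toGL_mulRight,
    autJ_mul k _ (det_SL_pos _), mul_smul, map_mul, autJ_T]
  change _ * (autJ k (toGL M) (ModularGroup.T • z))⁻¹ * f (toGL M • ModularGroup.T • z) =
    e12 (κ * m) * (_ * _ * (autJ k (toGL M) (ModularGroup.T • z) * 1)⁻¹ *
      f (toGL M • ModularGroup.T • z))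
  rw [mul_one]
  have h1 := conj_e12_mul_self (κ * m)
  linear_combination -(starRingEnd ℂ) (mult κ M.1) *
    (autJ k (toGL M) (ModularGroup.T • z))⁻¹ * f (toGL M • ModularGroup.T • z) * h1

theorem heckeSummand_mulRight_S (h : IsGood κ m) (M : DetMat m) (z : ℍ) :
    heckeSummand k κ f M (ModularGroup.S • z) =
      e12 (-3 * (κ * m)) * autJ k (ModularGroup.S : GL (Fin 2) ℝ) z *
        heckeSummand k κ f (mulRight M ModularGroup.S) z := by
  rw [heckeSummand, heckeSummand, mult_mulRight_S h, toGL_mulRight,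
    autJ_mul k _ (det_SL_pos _), mul_smul, map_mul]
  change _ * (autJ k (toGL M) (ModularGroup.S • z))⁻¹ * f (toGL M • ModularGroup.S • z) =
    e12 (-3 * (κ * m)) * _ * (_ * _ * (autJ k (toGL M) (ModularGroup.S • z) * _)⁻¹ *
      f (toGL M • ModularGroup.S • z))
  have h1 := conj_e12_mul_self (-3 * (κ * m))
  have h2 := autJ_ne_zero k (ModularGroup.S : GL (Fin 2) ℝ) z
  have h3 := autJ_ne_zero k (toGL M) (ModularGroup.S • z)
  field_simp
  linear_combination -(starRingEnd ℂ) (mult κ M.1) * f (toGL M • ModularGroup.S • z) * h1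

/-- Right multiplication by $\gamma$ permutes the finite set of left classes. -/
theorem sum_reps_mulRight {A : Type*} [AddCommMonoid A] (γ : SL(2, ℤ)) (F : DetMat m → A)
    (hF : ∀ (δ : SL(2, ℤ)) M, F (δ • M) = F M) :
    ∑ r : FixedDetMatrices.reps (m : ℤ), F (mulRight r.1 γ) =
      ∑ r : FixedDetMatrices.reps (m : ℤ), F r.1 := by
  set e := repsEquiv m with he
  set σ : FixedDetMatrices.reps (m : ℤ) → FixedDetMatrices.reps (m : ℤ) :=
    fun r => (e.symm (mulRight r.1 γ)).2 with hσ
  have hspec : ∀ r, (e.symm (mulRight r.1 γ)).1 • (σ r).1 = mulRight r.1 γ := by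
    intro r
    exact e.apply_symm_apply (mulRight r.1 γ)
  have hinj : Function.Injective σ := by
    intro r r' h
    have h1 := hspec r
    have h2 := hspec r'
    rw [← h] at h2
    set a := (e.symm (mulRight r.1 γ)).1
    set b := (e.symm (mulRight r'.1 γ)).1
    have h3 : mulRight ((b * a⁻¹) • r.1) γ = mulRight r'.1 γ := by
      rw [← h2]
      have : mulRight ((b * a⁻¹) • r.1) γ = (b * a⁻¹) • mulRight r.1 γ := by
        apply Subtype.ext
        rw [FixedDetMatrices.smul_coe]
        simp only [mulRight, FixedDetMatrices.smul_coe, Matrix.mul_assoc]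
      rw [this, ← h1, ← mul_smul, inv_mul_cancel_right]
    have h4 : (b * a⁻¹) • r.1 = r'.1 := by
      have h5 := congrArg (fun M => mulRight M γ⁻¹) h3
      have h6 : ∀ M : DetMat m, mulRight (mulRight M γ) γ⁻¹ = M := by
        intro M
        apply Subtype.ext
        simp only [mulRight]
        rw [Matrix.mul_assoc, ← Matrix.SpecialLinearGroup.coe_mul, mul_inv_cancel]
        simp
      simpa only [h6] using h5
    have h7 : e (b * a⁻¹, r) = e (1, r') := by
      rw [he, repsEquiv_apply, repsEquiv_apply, h4, one_smul]
    exact (Prod.ext_iff.mp (e.injective h7)).2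
  refine Fintype.sum_bijective σ (Finite.injective_iff_bijective.mp hinj) _ _ fun r => ?_
  rw [← hspec r, hF]

/-- The representatives are the matrices $\left(\begin{smallmatrix}a&b\\0&d\end{smallmatrix}\right)$
with $ad=m$, $0\le b<d$; their automorphy factor is $1$ and their multiplier is $\xi^{bd}$ times a
character value. The hypothesis `hchi` allows the class $\kappa$ to differ from $k$, as happens when
a second Hecke operator is applied. -/
theorem heckeOp_eq_sum (h : IsGood κ m)
    (hchi : ∀ d : ℕ, d ∣ m → (starRingEnd ℂ) (e12 (3 * (κ * (d - 1)))) = chi k d) (z : ℍ) :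
    heckeOp k κ m f z = ((1 / Real.sqrt m : ℝ) : ℂ) *
      ∑ r : FixedDetMatrices.reps (m : ℤ), heckeSummand k κ f r.1 z := by
  rw [heckeOp]
  congr 1
  simp_rw [Finset.mul_sum]
  rw [Finset.sum_sigma']
  have hm0 : m ≠ 0 := NeZero.ne m
  refine Finset.sum_bij' (fun p hp => (⟨⟨!![(p.1.1 : ℤ), (p.2 : ℤ); 0, (p.1.2 : ℤ)], by
      simp only [Finset.mem_sigma, Nat.mem_divisorsAntidiagonal] at hp
      rw [Matrix.det_fin_two]; simp; exact_mod_cast hp.1.1⟩, by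
      simp only [Finset.mem_sigma, Nat.mem_divisorsAntidiagonal, Finset.mem_range] at hp
      refine ⟨rfl, ?_, ?_, ?_⟩
      · have : p.1.1 ≠ 0 := by
          intro h0; rw [h0, zero_mul] at hp; exact hm0 hp.1.1.symm
        simpa using Nat.pos_of_ne_zero this
      · simp
      · simpa using hp.2⟩ : FixedDetMatrices.reps (m : ℤ)))
    (fun r _ => ⟨((r.1.1 0 0).toNat, (r.1.1 1 1).toNat), (r.1.1 0 1).toNat⟩) ?_ ?_ ?_ ?_ ?_
  · intros; exact Finset.mem_univ _
  · rintro ⟨r, h10, h00, h01, h11⟩ -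
    have hd : r.1 0 0 * r.1 1 1 - r.1 0 1 * r.1 1 0 = m := by rw [← Matrix.det_fin_two, r.2]
    rw [h10, mul_zero, sub_zero] at hd
    have hd0 : 0 < r.1 1 1 := by
      have : (0 : ℤ) < m := by exact_mod_cast Nat.pos_of_ne_zero hm0
      rw [← hd] at this
      exact (mul_pos_iff_of_pos_left h00).mp this
    rw [abs_of_nonneg h01, abs_of_pos hd0] at h11
    simp only [Finset.mem_sigma, Nat.mem_divisorsAntidiagonal, Finset.mem_range]
    refine ⟨⟨?_, hm0⟩, by omega⟩
    zify
    rw [Int.toNat_of_nonneg h00.le, Int.toNat_of_nonneg hd0.le, hd]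
  · rintro ⟨⟨a, d⟩, b⟩ -
    simp
  · rintro ⟨r, h10, h00, h01, h11⟩ -
    have hd : r.1 0 0 * r.1 1 1 - r.1 0 1 * r.1 1 0 = m := by rw [← Matrix.det_fin_two, r.2]
    rw [h10, mul_zero, sub_zero] at hd
    have hd0 : 0 < r.1 1 1 := by
      have : (0 : ℤ) < m := by exact_mod_cast Nat.pos_of_ne_zero hm0
      rw [← hd] at this
      exact (mul_pos_iff_of_pos_left h00).mp this
    apply Subtype.ext
    apply Subtype.ext
    ext i j
    fin_cases i <;> fin_cases j
    · simpa using h00.le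
    · simpa using h01
    · simpa using h10.symm
    · simpa using hd0.le
  · rintro ⟨⟨a, d⟩, b⟩ hp
    simp only [Finset.mem_sigma, Nat.mem_divisorsAntidiagonal, Finset.mem_range] at hp
    obtain ⟨⟨had, -⟩, hbd⟩ := hp
    have ha : 0 < a := Nat.pos_of_ne_zero fun h0 => hm0 (by rw [← had, h0, zero_mul])
    have hd : 0 < d := Nat.pos_of_ne_zero fun h0 => hm0 (by rw [← had, h0, mul_zero])
    have e1 : ∀ z : ℍ, ∀ M : DetMat m, M.1 = !![(a : ℤ), (b : ℤ); 0, (d : ℤ)] →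
        toGL M • z = ofComplex (((a : ℂ) * (z : ℂ) + (b : ℂ)) / (d : ℂ)) ∧
        autJ k (toGL M) z = 1 := by
      intro z M hM
      have hden : denom (toGL M) z = d := by simp [denom, toGL_apply, hM]
      have hnum : num (toGL M) z = a * z + b := by simp [num, toGL_apply, hM]
      constructor
      · apply UpperHalfPlane.ext_iff.mpr
        rw [coe_smul_of_det_pos (det_toGL_pos M), hden, hnum]
        rw [ofComplex_apply_of_im_pos]
        have : (((a : ℂ) * (z : ℂ) + (b : ℂ)) / (d : ℂ)).im = a * z.im / d := by
          rw [Complex.div_natCast_im]; simp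
        rw [this]
        have := z.im_pos
        positivity
      · rw [autJ, hden]
        have : (d : ℂ) ≠ 0 := by exact_mod_cast hd.ne'
        simp [this]
    have key : ∀ M : DetMat m, M.1 = !![(a : ℤ), (b : ℤ); 0, (d : ℤ)] →
        chi k d * (xi κ ^ (-((b : ℤ) * (d : ℤ))) *
          f (ofComplex (((a : ℂ) * (z : ℂ) + (b : ℂ)) / (d : ℂ)))) = heckeSummand k κ f M z := by
      intro M hM
      rw [heckeSummand, mult_upper h M (by simp [hM]), (e1 z M hM).1, (e1 z M hM).2]
      simp only [hM, Matrix.of_apply, Matrix.cons_val', Matrix.cons_val_one, Matrix.cons_val_zero,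
        Matrix.cons_val_fin_one]
      rw [mul_add, e12_add, map_mul, show κ * (3 * ((d : ℤ) - 1)) = 3 * (κ * (d - 1)) by ring,
        hchi d ⟨a, by rw [← had, mul_comm]⟩, conj_e12, xi_eq, ← e12_mul,
        show κ * -((b : ℤ) * d) = -(κ * (b * d)) by ring]
      ring
    exact key _ rfl

theorem isAutomorphic_heckeOp (hf : IsAutomorphic k κ f) (h : IsGood κ m)
    (hchi : ∀ d : ℕ, d ∣ m → (starRingEnd ℂ) (e12 (3 * (κ * (d - 1)))) = chi k d) :
    IsAutomorphic k (κ * m) (heckeOp k κ m f) where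
  continuous := by
    have : heckeOp k κ m f = fun z => ((1 / Real.sqrt m : ℝ) : ℂ) *
      ∑ r : FixedDetMatrices.reps (m : ℤ), heckeSummand k κ f r.1 z :=
      funext fun z => heckeOp_eq_sum h hchi z
    rw [this]
    exact continuous_const.mul (continuous_finsetSum _ fun r _ => continuous_heckeSummand hf r.1)
  map_T z := by
    rw [heckeOp_eq_sum h hchi, heckeOp_eq_sum h hchi,
      ← sum_reps_mulRight ModularGroup.T (fun M => heckeSummand k κ f M z)
        (fun δ M => heckeSummand_smul hf h δ M z)]
    simp_rw [heckeSummand_mulRight_T h]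
    rw [← Finset.mul_sum]
    ring
  map_S z := by
    rw [heckeOp_eq_sum h hchi, heckeOp_eq_sum h hchi,
      ← sum_reps_mulRight ModularGroup.S (fun M => heckeSummand k κ f M z)
        (fun δ M => heckeSummand_smul hf h δ M z)]
    simp_rw [heckeSummand_mulRight_S h]
    rw [← Finset.mul_sum]
    ring

end

/-! ### Square integrability, adjoints of Hecke operators and definiteness -/

/-- Square integrability on the fundamental domain. -/
def IsL2 (f : ℍ → ℂ) : Prop := MemLp f 2 (volume.restrict ModularGroup.fdo)

theorem isL2_iff {f : ℍ → ℂ} (hf : Continuous f) :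
    IsL2 f ↔ ∫⁻ z in ModularGroup.fdo, ‖f z‖ₑ ^ 2 < ⊤ := by
  rw [IsL2, MemLp, and_iff_right hf.aestronglyMeasurable,
    eLpNorm_lt_top_iff_lintegral_rpow_enorm_lt_top (by norm_num) (by norm_num)]
  simp

section

variable {m : ℕ} [NeZero m] {k κ : ℤ} {f : ℍ → ℂ}

theorem norm_smul_eq (hf : IsAutomorphic k κ f) (γ : SL(2, ℤ)) (z : ℍ) : ‖f (γ • z)‖ = ‖f z‖ := by
  have hγ : γ ∈ Subgroup.closure {ModularGroup.S, ModularGroup.T} := by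
    rw [SpecialLinearGroup.SL2Z_generators]; trivial
  induction hγ using Subgroup.closure_induction generalizing z with
  | mem γ hγ =>
    simp only [Set.mem_insert_iff, Set.mem_singleton_iff] at hγ
    rcases hγ with rfl | rfl
    · rw [hf.map_S, norm_mul, norm_mul, norm_e12, norm_autJ, one_mul, one_mul]
    · rw [hf.map_T, norm_mul, norm_e12, one_mul]
  | one => rw [one_smul]
  | mul a b _ _ ha hb => rw [mul_smul, ha, hb]
  | inv a _ ha => rw [← ha (a⁻¹ • z), smul_inv_smul]

/-- Unfold both $\|f(Mz)\|^2$ and $\|f(z)\|^2$; the exchange of $z$ with $Mz$ identifies the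
results. So the sum of the integrals of $\|f(rz)\|^2$ over the representatives is the number of
representatives times the integral of $\|f\|^2$. -/
theorem isL2_heckeSummand (hf : IsAutomorphic k κ f) (h2 : IsL2 f)
    (r : FixedDetMatrices.reps (m : ℤ)) : IsL2 (heckeSummand k κ f r.1) := by
  rw [isL2_iff (continuous_heckeSummand hf r.1)]
  rw [isL2_iff hf.continuous] at h2
  have hm1 : ∀ M : DetMat m, Measurable fun z : ℍ => ‖f (toGL M • z)‖ₑ ^ 2 := fun M =>
    (hf.continuous.comp (continuous_const_smul (toGL M))).enorm.measurable.pow_const 2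
  have hm2 : ∀ M : DetMat m, Measurable fun z : ℍ => ‖f z‖ₑ ^ 2 := fun M =>
    hf.continuous.enorm.measurable.pow_const 2
  have e1 := lintegral_unfold (m := m) (F := fun M z => ‖f (toGL M • z)‖ₑ ^ 2) hm1 (by
    intro γ M z
    rw [toGL_smul, mul_smul]
    have := norm_smul_eq hf γ (toGL M • z)
    rw [← ofReal_norm, ← ofReal_norm, ← this]
    rfl)
  have e2 := lintegral_unfold (m := m) (F := fun M z => ‖f z‖ₑ ^ 2) hm2 (fun _ _ _ => rfl)
  have e3 := tsum_selfPart_swap_lintegral (m := m) (fun M z => ‖f (toGL M • z)‖ₑ ^ 2)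
  simp only [adj_smul_smul] at e3
  rw [← e1, ← e2] at e3
  have hfin : 2 * ∫⁻ z in ModularGroup.fdo,
      ∑ r : FixedDetMatrices.reps (m : ℤ), ‖f (toGL r.1 • z)‖ₑ ^ 2 < ⊤ := by
    rw [← e3]
    refine ENNReal.mul_lt_top (by norm_num) ?_
    rw [lintegral_finsetSum _ fun r _ => hm2 r.1]
    exact ENNReal.sum_lt_top.mpr fun _ _ => h2
  have hfin2 := (ENNReal.lt_top_of_mul_ne_top_right hfin.ne (by norm_num))
  refine lt_of_le_of_lt (lintegral_mono fun z => ?_) hfin2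
  have : ‖heckeSummand k κ f r.1 z‖ₑ = ‖f (toGL r.1 • z)‖ₑ := by
    rw [← ofReal_norm, ← ofReal_norm, norm_heckeSummand]
  dsimp only
  rw [this]
  exact Finset.single_le_sum (f := fun r : FixedDetMatrices.reps (m : ℤ) =>
    ‖f (toGL r.1 • z)‖ₑ ^ 2) (fun _ _ => zero_le) (Finset.mem_univ r)

theorem isL2_heckeOp (hf : IsAutomorphic k κ f) (h2 : IsL2 f) (h : IsGood κ m)
    (hchi : ∀ d : ℕ, d ∣ m → (starRingEnd ℂ) (e12 (3 * (κ * (d - 1)))) = chi k d) :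
    IsL2 (heckeOp k κ m f) := by
  have : heckeOp k κ m f = fun z => ((1 / Real.sqrt m : ℝ) : ℂ) *
      ∑ r : FixedDetMatrices.reps (m : ℤ), heckeSummand k κ f r.1 z :=
    funext fun z => heckeOp_eq_sum h hchi z
  rw [this]
  apply MemLp.const_mul
  exact memLp_finsetSum _ fun r _ => isL2_heckeSummand hf h2 r

/-- The Petersson product. -/
def petersson (f g : ℍ → ℂ) : ℂ := ∫ z in ModularGroup.fdo, f z * (starRingEnd ℂ) (g z)

theorem IsL2.integrable_mul {f g : ℍ → ℂ} (hf : IsL2 f) (hg : IsL2 g) :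
    Integrable (fun z => f z * (starRingEnd ℂ) (g z)) (volume.restrict ModularGroup.fdo) := by
  have hg' : MemLp (fun z => (starRingEnd ℂ) (g z)) 2 (volume.restrict ModularGroup.fdo) :=
    MemLp.star hg
  exact MemLp.integrable_mul hf hg'

theorem petersson_conj (f g : ℍ → ℂ) :
    (starRingEnd ℂ) (petersson f g) = petersson g f := by
  rw [petersson, petersson, ← integral_conj]
  simp [mul_comm]

/-- The adjoint of $T_m$ is $\chi(m)T_m$. Both products unfold to sums over all integral matrices of
determinant $m$, and $z\mapsto Mz$, $M\mapsto\operatorname{adj}M$ carries one sum to the other by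
`mult_adj` and `autJ_adj`. -/
theorem petersson_heckeOp {g : ℍ → ℂ} (hf : IsAutomorphic k κ f) (hg : IsAutomorphic k (κ * m) g)
    (hf2 : IsL2 f) (hg2 : IsL2 g) (h : IsGood κ m)
    (hchi : ∀ d : ℕ, d ∣ m → (starRingEnd ℂ) (e12 (3 * (κ * (d - 1)))) = chi k d)
    (hchi' : ∀ d : ℕ, d ∣ m → (starRingEnd ℂ) (e12 (3 * (κ * m * (d - 1)))) = chi k d) :
    petersson (heckeOp k κ m f) g = chi κ m * petersson f (heckeOp k (κ * m) m g) := by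
  have h' : IsGood (κ * m) m := h.mul_left m
  set c : ℂ := ((1 / Real.sqrt m : ℝ) : ℂ) with hc
  have hcc : (starRingEnd ℂ) c = c := Complex.conj_ofReal _
  -- the two sides are unfolded to the same sum
  set F : DetMat m → ℍ → ℂ := fun M z => heckeSummand k κ f M z * (starRingEnd ℂ) (g z) with hF
  set G : DetMat m → ℍ → ℂ := fun M z => (starRingEnd ℂ) (heckeSummand k (κ * m) g M z) * f z
    with hG
  have hFG : ∀ M z, F (adj M) (toGL M • z) = (starRingEnd ℂ) (chi κ m) * G M z := by
    intro M z
    simp only [hF, hG, heckeSummand]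
    rw [mult_adj h, autJ_adj, adj_smul_smul]
    simp only [map_mul, Complex.conj_conj, map_inv₀, conj_autJ, inv_inv]
    ring
  have hchi1 : (starRingEnd ℂ) (chi κ m) = chi κ m := by
    rw [chi_eq, conj_e12]
    apply e12_congr
    obtain ⟨t, ht⟩ := h.four_dvd_two
    exact ⟨-t, by linear_combination -3 * ht⟩
  have key : ∀ {H : DetMat m → ℍ → ℂ},
      (∀ r : FixedDetMatrices.reps (m : ℤ), Integrable (H r.1)
        (volume.restrict ModularGroup.fdo)) → (∀ M, Continuous (H M)) →
      ∫⁻ z in ModularGroup.fdo, ∑ r : FixedDetMatrices.reps (m : ℤ), ‖H r.1 z‖ₑ ≠ ⊤ := by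
    intro H hH hHc
    rw [lintegral_finsetSum _ fun r _ => (hHc r.1).enorm.measurable]
    exact (ENNReal.sum_lt_top.mpr fun r _ => (hH r).hasFiniteIntegral).ne
  have hFc : ∀ M, Continuous (F M) := fun M =>
    (continuous_heckeSummand hf M).mul (Complex.continuous_conj.comp hg.continuous)
  have hGc : ∀ M, Continuous (G M) := fun M =>
    (Complex.continuous_conj.comp (continuous_heckeSummand hg M)).mul hf.continuous
  have hFi : ∀ r : FixedDetMatrices.reps (m : ℤ), Integrable (F r.1)
        (volume.restrict ModularGroup.fdo) := fun r =>
    (isL2_heckeSummand hf hf2 r).integrable_mul hg2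
  have hGi : ∀ r : FixedDetMatrices.reps (m : ℤ), Integrable (G r.1)
        (volume.restrict ModularGroup.fdo) := fun r => by
    have := hf2.integrable_mul (isL2_heckeSummand hg hg2 r)
    simpa only [hG, mul_comm] using this
  have e1 := integral_unfold (fun M => (hFc M).measurable)
    (fun γ M z => by simp only [hF]; rw [heckeSummand_smul hf h]) (key hFi hFc)
  have e2 := integral_unfold (fun M => (hGc M).measurable)
    (fun γ M z => by simp only [hG]; rw [heckeSummand_smul hg h']) (key hGi hGc)
  have e3 := tsum_selfPart_swap F
  simp only [hFG, integral_const_mul, tsum_mul_left] at e3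
  rw [← e1, ← e2, hchi1] at e3
  have e4 : ∫ z in ModularGroup.fdo, ∑ r : FixedDetMatrices.reps (m : ℤ), F r.1 z =
      chi κ m * ∫ z in ModularGroup.fdo, ∑ r : FixedDetMatrices.reps (m : ℤ), G r.1 z := by
    have two : (2 : ℂ) ≠ 0 := by norm_num
    apply mul_left_cancel₀ two
    rw [← e3]; ring
  have e5 : petersson (heckeOp k κ m f) g =
      c * ∫ z in ModularGroup.fdo, ∑ r : FixedDetMatrices.reps (m : ℤ), F r.1 z := by
    rw [petersson, ← integral_const_mul]
    congr 1
    ext z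
    rw [heckeOp_eq_sum h hchi, mul_assoc, Finset.sum_mul]
  have e6 : petersson f (heckeOp k (κ * m) m g) =
      c * ∫ z in ModularGroup.fdo, ∑ r : FixedDetMatrices.reps (m : ℤ), G r.1 z := by
    rw [petersson, ← integral_const_mul]
    congr 1
    ext z
    rw [heckeOp_eq_sum h' hchi', map_mul, hcc, map_sum, ← Finset.sum_mul]
    ring
  rw [e5, e6, e4]
  ring

/-- Vanishing almost everywhere on the fundamental domain spreads to the whole half-plane because
$|f|$ is invariant, and continuity removes the exceptional set. -/
theorem eq_zero_of_petersson_self (hf : IsAutomorphic k κ f) (h2 : IsL2 f)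
    (h0 : petersson f f = 0) : f = 0 := by
  have hint := h2.integrable_mul h2
  have h1 : ∫ z in ModularGroup.fdo, ‖f z‖ ^ 2 = 0 := by
    have : petersson f f = ((∫ z in ModularGroup.fdo, ‖f z‖ ^ 2 : ℝ) : ℂ) := by
      rw [petersson, ← integral_complex_ofReal]
      congr 1
      ext z
      rw [Complex.mul_conj, Complex.normSq_eq_norm_sq]
    rw [h0] at this
    exact_mod_cast this.symm
  have hint2 : Integrable (fun z => ‖f z‖ ^ 2) (volume.restrict ModularGroup.fdo) := by
    have := hint.norm
    refine this.congr (Filter.Eventually.of_forall fun z => ?_)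
    simp [sq]
  rw [integral_eq_zero_iff_of_nonneg (fun z => by positivity) hint2] at h1
  have h3 : ∀ᵐ z : ℍ, z ∈ ModularGroup.fdo → f z = 0 := by
    rw [← ae_restrict_iff' measurableSet_fdo]
    filter_upwards [h1] with z hz
    simpa using hz
  have h4 : ∀ᵐ z : ℍ, ∀ γ : SL(2, ℤ),
      (fun w : ℍ => w ∈ ModularGroup.fdo → f w = 0) (γ • z) := by
    rw [ae_all_iff]
    intro γ
    exact (measurePreserving_smul_SL γ).quasiMeasurePreserving.ae (p := fun w : ℍ =>
        w ∈ ModularGroup.fdo → f w = 0) h3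
  have h5 : f =ᵐ[volume] 0 := by
    filter_upwards [h4, ae_exists_smul_mem_fdo] with z hz hγ
    obtain ⟨γ, hγ⟩ := hγ
    have := hz γ hγ
    rw [← norm_eq_zero, norm_smul_eq hf, norm_eq_zero] at this
    exact this
  -- The invariant measure has nowhere vanishing density with respect to Lebesgue measure, so
  -- nonempty open sets have positive measure.
  have hopen : (volume : Measure ℍ).IsOpenPosMeasure := by
    constructor
    intro U hU hne h
    rw [volume_eq_lintegral] at h
    have hU' : IsOpen (UpperHalfPlane.coe '' U) := isOpenEmbedding_coe.isOpenMap U hU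
    rw [setLIntegral_eq_zero_iff hU'.measurableSet (by fun_prop)] at h
    have h6 : ∀ᵐ z : ℂ, z ∉ UpperHalfPlane.coe '' U := by
      filter_upwards [h] with z hz hzU
      have := hz hzU
      obtain ⟨w, -, rfl⟩ := hzU
      simp [w.im_ne_zero] at this
    have h7 := measure_eq_zero_iff_ae_notMem.mpr h6
    exact hU'.measure_ne_zero volume (hne.image _) h7
  exact (hf.continuous.ae_eq_iff_eq volume continuous_zero).mp h5

end

end MaassEta

end

noncomputable section

namespace MaassEta

open Filter Topology Set

/-! ### Kummer's equation -/

theorem hasDerivAt_powerSeries {c : ℕ → ℂ} (hc : ∀ r : ℝ, 0 ≤ r → Summable fun n => ‖c n‖ * r ^ n)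
    (z : ℂ) : HasDerivAt (fun w => ∑' n, c n * w ^ n) (∑' n : ℕ, ((n + 1) * c (n + 1)) * z ^ n) z ∧
      Summable fun n : ℕ => ((n + 1) * c (n + 1)) * z ^ n := by
  set r : ℝ := ‖z‖ + 1
  have hr : 0 ≤ r := by positivity
  have hU : IsOpen (Metric.ball (0 : ℂ) r) := Metric.isOpen_ball
  have hz : z ∈ Metric.ball (0 : ℂ) r := by simp [r]
  have hle : ∀ n, ∀ w ∈ Metric.ball (0 : ℂ) r, ‖c n * w ^ n‖ ≤ ‖c n‖ * r ^ n := by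
    intro n w hw
    rw [norm_mul, norm_pow]
    have : ‖w‖ ≤ r := (mem_ball_zero_iff.mp hw).le
    gcongr
  have hd : ∀ n, DifferentiableOn ℂ (fun w => c n * w ^ n) (Metric.ball (0 : ℂ) r) :=
    fun n => by fun_prop
  have h1 := Complex.hasSum_deriv_of_summable_norm (hc r hr) hd hU hle hz
  have h2 := (Complex.differentiableOn_tsum_of_summable_norm (hc r hr) hd hU hle).differentiableAt
    (hU.mem_nhds hz)
  have h3 : ∀ n, deriv (fun w => c n * w ^ n) z = c n * (n * z ^ (n - 1)) := by
    intro n; simp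
  simp_rw [h3] at h1
  have h4 : HasSum (fun n : ℕ => ((n + 1) * c (n + 1)) * z ^ n)
      (deriv (fun w => ∑' n, c n * w ^ n) z) := by
    have := (hasSum_nat_add_iff' 1).mpr h1
    simp only [Finset.range_one, Finset.sum_singleton, CharP.cast_eq_zero, zero_mul, mul_zero,
      sub_zero] at this
    refine this.congr_fun fun n => ?_
    simp only [Nat.add_sub_cancel, Nat.cast_add, Nat.cast_one]
    ring
  exact ⟨h4.tsum_eq ▸ h2.hasDerivAt, h4.summable⟩

theorem summable_norm_of_summable {c : ℕ → ℂ} (hc : ∀ z : ℂ, Summable fun n => c n * z ^ n)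
    (r : ℝ) (hr : 0 ≤ r) : Summable fun n => ‖c n‖ * r ^ n := by
  have := (hc r).norm
  simpa [norm_mul, norm_pow, abs_of_nonneg hr] using this

/-- The coefficients of Kummer's function. -/
def kummerCoeff (a b : ℂ) (n : ℕ) : ℂ :=
  Complex.Gamma b * Complex.regularizedHGFunCoeff {a} {b} n

theorem kummerM_eq_tsum (a b z : ℂ) : kummerM a b z = ∑' n, kummerCoeff a b n * z ^ n := by
  rw [kummerM, Complex.regularizedHGFun, FormalMultilinearSeries.sum, ← tsum_mul_left]
  refine tsum_congr fun n => ?_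
  rw [FormalMultilinearSeries.apply_eq_pow_smul_coeff, Complex.regularizedHGFunSeries_coeff,
    kummerCoeff, smul_eq_mul]
  ring

theorem summable_kummerCoeff (a b : ℂ) (r : ℝ) (hr : 0 ≤ r) :
    Summable fun n => ‖kummerCoeff a b n‖ * r ^ n := by
  refine summable_norm_of_summable (fun z => ?_) r hr
  have hrad : (Complex.regularizedHGFunSeries {a} {b}).radius = ⊤ :=
    Complex.radius_regularizedHGFunSeries_eq_top (by simp)
  have := (Complex.regularizedHGFunSeries {a} {b}).summable (x := z) (by
    rw [hrad]; simp)
  refine (this.mul_left (Complex.Gamma b)).congr fun n => ?_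
  rw [FormalMultilinearSeries.apply_eq_pow_smul_coeff, Complex.regularizedHGFunSeries_coeff,
    kummerCoeff, smul_eq_mul]
  ring

theorem kummerM_zero {a b : ℂ} (hb : ∀ n : ℕ, b ≠ -n) : kummerM a b 0 = 1 := by
  rw [kummerM_eq_tsum, tsum_eq_single 0]
  · simp [kummerCoeff, Complex.regularizedHGFunCoeff, Complex.Gamma_ne_zero hb]
  · intro n hn; simp [hn]

theorem kummerCoeff_succ {a b : ℂ} (hb : ∀ n : ℕ, b ≠ -n) (n : ℕ) :
    (n + 1) * (b + n) * kummerCoeff a b (n + 1) = (a + n) * kummerCoeff a b n := by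
  have h1 : (b + n) ≠ 0 := fun h => hb n (eq_neg_of_add_eq_zero_left h)
  have h2 : ((n : ℂ) + 1) ≠ 0 := by exact_mod_cast Nat.succ_ne_zero n
  rw [kummerCoeff, kummerCoeff, Complex.regularizedHGFunCoeff_add_one (by
    intro k hk; rw [Multiset.mem_singleton.mp hk]; exact hb n)]
  simp only [Multiset.map_singleton, Multiset.prod_singleton]
  field_simp

/-- The derivative of Kummer's function. -/
def kummerM' (a b z : ℂ) : ℂ := ∑' n : ℕ, ((n + 1) * kummerCoeff a b (n + 1)) * z ^ n

theorem hasDerivAt_kummerM (a b z : ℂ) : HasDerivAt (kummerM a b) (kummerM' a b z) z := by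
  have := (hasDerivAt_powerSeries (summable_kummerCoeff a b) z).1
  have e : kummerM a b = fun w => ∑' n, kummerCoeff a b n * w ^ n :=
    funext fun w => kummerM_eq_tsum a b w
  rw [e]; exact this

theorem hasDerivAt_kummerM' {a b : ℂ} (hb : ∀ n : ℕ, b ≠ -n) {z : ℂ} (hz : z ≠ 0) :
    HasDerivAt (kummerM' a b) (((z - b) * kummerM' a b z + a * kummerM a b z) / z) z := by
  have s0 := summable_kummerCoeff a b
  have s1 : ∀ r : ℝ, 0 ≤ r → Summable fun n : ℕ => ‖(n + 1) * kummerCoeff a b (n + 1)‖ * r ^ n :=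
    summable_norm_of_summable fun z => (hasDerivAt_powerSeries s0 z).2
  obtain ⟨h1, h2⟩ := hasDerivAt_powerSeries s1 z
  refine h1.congr_deriv (Eq.symm ?_)
  rw [div_eq_iff hz, kummerM_eq_tsum, kummerM']
  have S0 : Summable fun n : ℕ => kummerCoeff a b n * z ^ n := by
    have := s0 ‖z‖ (norm_nonneg _)
    refine Summable.of_norm (this.congr fun n => by simp)
  have S1 : Summable fun n : ℕ => ((n + 1) * kummerCoeff a b (n + 1)) * z ^ n :=
    (hasDerivAt_powerSeries s0 z).2
  have T1 : HasSum (fun n : ℕ => n * kummerCoeff a b n * z ^ n)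
      ((∑' n : ℕ, ((n + 1) * kummerCoeff a b (n + 1)) * z ^ n) * z) := by
    have := S1.hasSum.mul_right z
    rw [← hasSum_nat_add_iff' 1]
    simp only [Finset.range_one, Finset.sum_singleton, CharP.cast_eq_zero, zero_mul, sub_zero]
    refine this.congr_fun fun n => ?_
    push_cast; ring
  have T2 : HasSum (fun n : ℕ => n * ((n + 1) * kummerCoeff a b (n + 1)) * z ^ n)
      ((∑' n : ℕ, ((n + 1) * (((n + 1 : ℕ) + 1) * kummerCoeff a b (n + 1 + 1))) * z ^ n) * z) := by
    have := h2.hasSum.mul_right z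
    rw [← hasSum_nat_add_iff' 1]
    simp only [Finset.range_one, Finset.sum_singleton, CharP.cast_eq_zero, zero_mul, sub_zero]
    refine this.congr_fun fun n => ?_
    push_cast; ring
  have key := ((T1.sub (S1.hasSum.mul_left b)).add (S0.hasSum.mul_left a))
  have : HasSum (fun n : ℕ => n * ((n + 1) * kummerCoeff a b (n + 1)) * z ^ n)
      ((z - b) * (∑' n : ℕ, ((n + 1) * kummerCoeff a b (n + 1)) * z ^ n) +
        a * ∑' n : ℕ, kummerCoeff a b n * z ^ n) := by
    rw [sub_mul, mul_comm z]
    refine key.congr_fun fun n => ?_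
    linear_combination z ^ n * kummerCoeff_succ (a := a) hb n
  exact this.unique T2

theorem conj_kummerM (a b z : ℂ) : (starRingEnd ℂ) (kummerM a b z) =
    kummerM ((starRingEnd ℂ) a) ((starRingEnd ℂ) b) ((starRingEnd ℂ) z) := by
  rw [kummerM_eq_tsum, kummerM_eq_tsum, Complex.conj_tsum]
  refine tsum_congr fun n => ?_
  have hp : ∀ n : ℕ, (starRingEnd ℂ) ((ascPochhammer ℂ n).eval a) =
      (ascPochhammer ℂ n).eval ((starRingEnd ℂ) a) := by
    intro n
    induction n with
    | zero => simp
    | succ n ih => simp [ascPochhammer_succ_eval, ih]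
  rw [map_mul, map_pow, kummerCoeff, kummerCoeff, map_mul, ← Complex.Gamma_conj]
  simp only [Complex.regularizedHGFunCoeff, Multiset.map_singleton, Multiset.prod_singleton,
    map_div₀, map_mul, map_natCast, ← Complex.Gamma_conj, map_add, hp]

/-- `v` is a solution, with derivative `v'`, of Kummer's equation on the positive half-line. -/
structure IsKummer (a b : ℂ) (v v' : ℝ → ℂ) : Prop where
  deriv : ∀ t : ℝ, 0 < t → HasDerivAt v (v' t) t
  deriv' : ∀ t : ℝ, 0 < t → HasDerivAt v' (((t - b) * v' t + a * v t) / t) t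

theorem IsKummer.const_mul {a b : ℂ} {v v' : ℝ → ℂ} (hv : IsKummer a b v v') (c : ℂ) :
    IsKummer a b (fun t => c * v t) (fun t => c * v' t) where
  deriv t ht := (hv.deriv t ht).const_mul c
  deriv' t ht := by
    refine ((hv.deriv' t ht).const_mul c).congr_deriv ?_
    ring

theorem isKummer_kummerM {a b : ℂ} (hb : ∀ n : ℕ, b ≠ -n) :
    IsKummer a b (fun t => kummerM a b t) (fun t => kummerM' a b t) where
  deriv t _ := (hasDerivAt_kummerM a b t).comp_ofReal
  deriv' t ht := (hasDerivAt_kummerM' hb (by exact_mod_cast ht.ne')).comp_ofReal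

theorem hasDerivAt_ofReal_cpow_pos {t : ℝ} (ht : 0 < t) (s : ℂ) :
    HasDerivAt (fun t : ℝ => (t : ℂ) ^ s) (s * (t : ℂ) ^ (s - 1)) t := by
  have h := (hasDerivAt_id (t : ℂ)).cpow_const (c := s) (Or.inl (by simpa using ht))
  simpa using h.comp_ofReal

/-- The second Frobenius solution at zero, with exponent $1-b$. -/
theorem isKummer_second {a b : ℂ} (hb : ∀ n : ℕ, 2 - b ≠ -n) :
    IsKummer a b (fun t => (t : ℂ) ^ (1 - b) * kummerM (a - b + 1) (2 - b) t)
      (fun t => (t : ℂ) ^ (-b) * ((1 - b) * kummerM (a - b + 1) (2 - b) t +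
        t * kummerM' (a - b + 1) (2 - b) t)) where
  deriv t ht := by
    have ht' : (t : ℂ) ≠ 0 := by exact_mod_cast ht.ne'
    refine ((hasDerivAt_ofReal_cpow_pos ht (1 - b)).mul
      ((hasDerivAt_kummerM (a - b + 1) (2 - b) t).comp_ofReal)).congr_deriv ?_
    rw [show 1 - b - 1 = -b by ring, show 1 - b = -b + 1 by ring, Complex.cpow_add _ _ ht',
      Complex.cpow_one]
    ring
  deriv' t ht := by
    have ht' : (t : ℂ) ≠ 0 := by exact_mod_cast ht.ne'
    have h1 := (hasDerivAt_kummerM (a - b + 1) (2 - b) t).comp_ofReal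
    have h2 := (hasDerivAt_kummerM' (a := a - b + 1) hb ht').comp_ofReal
    have h3 := (hasDerivAt_id t).ofReal_comp
    refine ((hasDerivAt_ofReal_cpow_pos ht (-b)).mul
      ((h1.const_mul (1 - b)).add (h3.mul h2))).congr_deriv ?_
    rw [show 1 - b = -b + 1 by ring, Complex.cpow_add _ _ ht', Complex.cpow_sub _ _ ht',
      Complex.cpow_one]
    simp only [id, Complex.ofReal_one, Pi.add_apply, Pi.mul_apply]
    field_simp
    ring

theorem norm_cpow_of_re_zero {t : ℝ} (ht : 0 < t) {s : ℂ} (hs : s.re = 0) : ‖(t : ℂ) ^ s‖ = 1 := by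
  rw [Complex.norm_cpow_eq_rpow_re_of_pos ht, hs, Real.rpow_zero]

/-- A solution of Kummer's equation with `Re b = 1`, `b ≠ 1` is determined by its behaviour at
zero. -/
theorem IsKummer.eq_zero {a b : ℂ} {v v' : ℝ → ℂ} (h : IsKummer a b v v') (hb : b.re = 1)
    (hb1 : b ≠ 1) (hα : Tendsto (fun t : ℝ => v t + t * v' t / (b - 1)) (𝓝[>] 0) (𝓝 0))
    (hβ : Tendsto (fun t : ℝ => (t : ℂ) ^ b * v' t) (𝓝[>] 0) (𝓝 0)) (T : ℝ) (hT : 0 < T) :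
    v T = 0 := by
  have hb1' : b - 1 ≠ 0 := sub_ne_zero.mpr hb1
  -- For leading behaviour $A+Bt^{1-b}$ at zero these combinations tend to $A$ and $(1-b)B$: they
  -- read off the two Frobenius coefficients.
  set α : ℝ → ℂ := fun t => v t + t * v' t / (b - 1) with hαd
  set β : ℝ → ℂ := fun t => (t : ℂ) ^ b * v' t with hβd
  set X : ℝ → ℂ × ℂ := fun t => (α t, β t) with hX
  set X' : ℝ → ℂ × ℂ := fun t => ((t * v' t + a * v t) / (b - 1),
    (t : ℂ) ^ (b - 1) * (t * v' t + a * v t)) with hX'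
  have hderiv : ∀ t : ℝ, 0 < t → HasDerivAt X (X' t) t := by
    intro t ht
    have ht' : (t : ℂ) ≠ 0 := by exact_mod_cast ht.ne'
    have d1 := h.deriv t ht
    have d2 := h.deriv' t ht
    have d3 := (hasDerivAt_id t).ofReal_comp
    have e1 : HasDerivAt α ((t * v' t + a * v t) / (b - 1)) t := by
      refine (d1.add ((d3.mul d2).div_const (b - 1))).congr_deriv ?_
      simp only [id, Complex.ofReal_one]
      field_simp
      ring
    have e2 : HasDerivAt β ((t : ℂ) ^ (b - 1) * (t * v' t + a * v t)) t := by
      refine ((hasDerivAt_ofReal_cpow_pos ht b).mul d2).congr_deriv ?_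
      rw [Complex.cpow_sub _ _ ht', Complex.cpow_one]
      field_simp
      ring
    exact e1.prodMk e2
  -- In the variables $(\alpha,\beta)$ the equation is a linear system with coefficients bounded
  -- near zero, because $|t^{b-1}|=1$. Grönwall's inequality can therefore be started at
  -- $\varepsilon\to0$.
  set C : ℝ := (‖b - 1‖⁻¹ + 1) * (1 + ‖a‖ * (1 + ‖b - 1‖⁻¹)) with hC
  have hbound : ∀ t : ℝ, 0 < t → ‖X' t‖ ≤ C * ‖X t‖ := by
    intro t ht
    have ht' : (t : ℂ) ≠ 0 := by exact_mod_cast ht.ne'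
    have n1 : ‖(t : ℂ) ^ (b - 1)‖ = 1 := norm_cpow_of_re_zero ht (by simp [hb])
    have n2 : ‖(t : ℂ) * v' t‖ = ‖β t‖ := by
      have : β t = (t : ℂ) ^ (b - 1) * (t * v' t) := by
        simp only [hβd]
        rw [Complex.cpow_sub _ _ ht', Complex.cpow_one]
        field_simp
      rw [this, norm_mul _ ((t : ℂ) * v' t), n1, one_mul]
    have n3 : ‖v t‖ ≤ ‖α t‖ + ‖b - 1‖⁻¹ * ‖β t‖ := by
      have : v t = α t - t * v' t / (b - 1) := by simp [hαd]
      rw [this]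
      refine (norm_sub_le _ _).trans ?_
      rw [norm_div, n2, div_eq_inv_mul]
    have n4 : ‖(t : ℂ) * v' t + a * v t‖ ≤ (1 + ‖a‖ * (1 + ‖b - 1‖⁻¹)) * ‖X t‖ := by
      have m1 : ‖α t‖ ≤ ‖X t‖ := norm_fst_le (X t)
      have m2 : ‖β t‖ ≤ ‖X t‖ := norm_snd_le (X t)
      have hpos : 0 ≤ ‖b - 1‖⁻¹ := by positivity
      calc ‖(t : ℂ) * v' t + a * v t‖ ≤ ‖β t‖ + ‖a‖ * (‖α t‖ + ‖b - 1‖⁻¹ * ‖β t‖) := by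
            refine (norm_add_le _ _).trans ?_
            rw [n2, norm_mul a (v t)]
            gcongr
        _ ≤ ‖X t‖ + ‖a‖ * (‖X t‖ + ‖b - 1‖⁻¹ * ‖X t‖) := by gcongr
        _ = _ := by ring
    rw [hC]
    have hpos : 0 ≤ ‖b - 1‖⁻¹ := by positivity
    have hx := norm_nonneg ((t : ℂ) * v' t + a * v t)
    rw [Prod.norm_def]
    refine max_le ?_ ?_
    · rw [norm_div, div_eq_inv_mul, mul_assoc]
      calc ‖b - 1‖⁻¹ * ‖(t : ℂ) * v' t + a * v t‖ ≤
          (‖b - 1‖⁻¹ + 1) * ‖(t : ℂ) * v' t + a * v t‖ := by gcongr; linarith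
        _ ≤ _ := by gcongr
    · rw [norm_mul, n1, one_mul, mul_assoc]
      calc ‖(t : ℂ) * v' t + a * v t‖ = 1 * ‖(t : ℂ) * v' t + a * v t‖ := (one_mul _).symm
        _ ≤ (‖b - 1‖⁻¹ + 1) * ‖(t : ℂ) * v' t + a * v t‖ := by gcongr; linarith
        _ ≤ _ := by gcongr
  have hC0 : 0 ≤ C := by positivity
  have hX0 : Tendsto (fun t => ‖X t‖ * Real.exp (C * T)) (𝓝[>] 0) (𝓝 0) := by
    have : Tendsto X (𝓝[>] 0) (𝓝 0) := hα.prodMk_nhds hβ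
    simpa using this.norm.mul_const (Real.exp (C * T))
  have hle : ∀ᶠ ε in 𝓝[>] (0 : ℝ), ‖X T‖ ≤ ‖X ε‖ * Real.exp (C * T) := by
    filter_upwards [Ioo_mem_nhdsGT hT] with ε hε
    have := norm_le_gronwallBound_of_norm_deriv_right_le (f := X) (f' := X') (δ := ‖X ε‖) (K := C)
      (ε := 0) (a := ε) (b := T)
      (fun t ht => (hderiv t (hε.1.trans_le ht.1)).continuousAt.continuousWithinAt)
      (fun t ht => (hderiv t (hε.1.trans_le ht.1)).hasDerivWithinAt) le_rfl
      (fun t ht => by rw [add_zero]; exact hbound t (hε.1.trans_le ht.1)) T ⟨hε.2.le, le_rfl⟩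
    rw [gronwallBound_ε0] at this
    refine this.trans ?_
    have := hε.1
    gcongr
    linarith
  have hXT : ‖X T‖ ≤ 0 := ge_of_tendsto hX0 hle
  have hXT' : X T = 0 := norm_le_zero_iff.mp hXT
  have a0 : α T = 0 := congrArg Prod.fst hXT'
  have b0 : β T = 0 := congrArg Prod.snd hXT'
  have hT' : (T : ℂ) ≠ 0 := by exact_mod_cast hT.ne'
  have : v' T = 0 := by
    simp only [hβd] at b0
    rcases mul_eq_zero.mp b0 with h | h
    · exact absurd h (by simp [Complex.cpow_eq_zero_iff, hT'])
    · exact h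
  simp only [hαd, this] at a0
  simpa using a0

/-! ### Laplace integrals -/

/-- The integrand of `laplaceInt`. -/
def laplaceKer (p q : ℂ) (t s : ℝ) : ℂ :=
  Complex.exp (-(t * s)) * (s : ℂ) ^ (p - 1) * (1 + s : ℂ) ^ q

/-- `∫₀^∞ e^{-ts} s^{p-1} (1+s)^q ds`, a multiple of Tricomi's function. -/
def laplaceInt (p q : ℂ) (t : ℝ) : ℂ := ∫ s in Ioi (0 : ℝ), laplaceKer p q t s

theorem one_add_ofReal_eq (s : ℝ) : (1 + s : ℂ) = ((1 + s : ℝ) : ℂ) := by push_cast; rfl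

theorem norm_laplaceKer_le {p q : ℂ} (hq : q.re ≤ 0) (t : ℝ) {s : ℝ} (hs : 0 < s) :
    ‖laplaceKer p q t s‖ ≤ s ^ (p.re - 1) * Real.exp (-t * s) := by
  have h1 : (0 : ℝ) < 1 + s := by linarith
  rw [laplaceKer, norm_mul, norm_mul, one_add_ofReal_eq, Complex.norm_cpow_eq_rpow_re_of_pos hs,
    Complex.norm_cpow_eq_rpow_re_of_pos h1, Complex.norm_exp, mul_comm (Real.exp _)]
  have : (1 + s) ^ q.re ≤ 1 := Real.rpow_le_one_of_one_le_of_nonpos (by linarith) hq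
  have e : (-((t : ℂ) * s)).re = -t * s := by
    rw [← Complex.ofReal_mul, ← Complex.ofReal_neg, Complex.ofReal_re]; ring
  rw [e]
  simp only [Complex.sub_re, Complex.one_re]
  exact mul_le_of_le_one_right (by positivity) this

theorem continuousOn_laplaceKer (p q : ℂ) (t : ℝ) : ContinuousOn (laplaceKer p q t) (Ioi 0) := by
  unfold laplaceKer
  refine ((Continuous.continuousOn (by fun_prop)).mul ?_).mul ?_
  · exact fun s hs => ((Complex.continuousAt_ofReal_cpow_const s (p - 1)
      (Or.inr (ne_of_gt hs)))).continuousWithinAt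
  · intro s hs
    have : (1 + (s : ℂ)) ∈ Complex.slitPlane := by
      rw [one_add_ofReal_eq]; exact Complex.ofReal_mem_slitPlane.mpr (by have := mem_Ioi.mp hs; linarith)
    exact (ContinuousAt.cpow (f := fun s : ℝ => (1 + s : ℂ)) (by fun_prop) continuousAt_const
      this).continuousWithinAt

theorem integrableOn_rpow_mul_exp {A t : ℝ} (hA : 0 < A) (ht : 0 < t) :
    IntegrableOn (fun s : ℝ => s ^ (A - 1) * Real.exp (-t * s)) (Ioi 0) := by
  have := integrableOn_rpow_mul_exp_neg_mul_rpow (p := 1) (s := A - 1) (b := t) (by linarith)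
    one_pos ht
  simpa using this

theorem integrableOn_laplaceKer {p q : ℂ} (hp : 0 < p.re) (hq : q.re ≤ 0) {t : ℝ} (ht : 0 < t) :
    IntegrableOn (laplaceKer p q t) (Ioi 0) := by
  refine (integrableOn_rpow_mul_exp hp ht).mono'
    ((continuousOn_laplaceKer p q t).aestronglyMeasurable measurableSet_Ioi) ?_
  filter_upwards [ae_restrict_mem measurableSet_Ioi] with s hs
  exact norm_laplaceKer_le hq t hs

theorem laplaceKer_add_one (p q : ℂ) (t : ℝ) {s : ℝ} (hs : 0 < s) :
    laplaceKer (p + 1) q t s = s * laplaceKer p q t s := by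
  have hs' : (s : ℂ) ≠ 0 := by exact_mod_cast hs.ne'
  rw [laplaceKer, laplaceKer, show p + 1 - 1 = p - 1 + 1 by ring, Complex.cpow_add _ _ hs',
    Complex.cpow_one]
  ring

theorem hasDerivAt_laplaceInt {p q : ℂ} (hp : 0 < p.re) (hq : q.re ≤ 0) {t : ℝ} (ht : 0 < t) :
    HasDerivAt (laplaceInt p q) (-laplaceInt (p + 1) q t) t := by
  have hp1 : 0 < (p + 1).re := by simp; linarith
  have := (hasDerivAt_integral_of_dominated_loc_of_deriv_le (𝕜 := ℝ)
    (μ := volume.restrict (Ioi (0 : ℝ))) (F := fun t s => laplaceKer p q t s)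
    (F' := fun t s => -laplaceKer (p + 1) q t s) (x₀ := t) (s := Ioi (t / 2))
    (bound := fun s => s ^ ((p + 1).re - 1) * Real.exp (-(t / 2) * s))
    (Ioi_mem_nhds (by linarith))
    (Eventually.of_forall fun t =>
      (continuousOn_laplaceKer p q t).aestronglyMeasurable measurableSet_Ioi)
    (integrableOn_laplaceKer hp hq ht)
    ((continuousOn_laplaceKer (p + 1) q t).aestronglyMeasurable measurableSet_Ioi).neg
    ?_ (integrableOn_rpow_mul_exp hp1 (by linarith)) ?_).2
  · rwa [integral_neg] at this
  · filter_upwards [ae_restrict_mem measurableSet_Ioi] with s hs x hx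
    rw [norm_neg]
    refine (norm_laplaceKer_le hq x hs).trans ?_
    have hs' := mem_Ioi.mp hs
    have hx' := mem_Ioi.mp hx
    gcongr
  · filter_upwards [ae_restrict_mem measurableSet_Ioi] with s hs x hx
    rw [laplaceKer_add_one _ _ _ hs]
    have h1 : HasDerivAt (fun x : ℝ => Complex.exp (-((x : ℂ) * s)))
        (Complex.exp (-((x : ℂ) * s)) * -(1 * s)) x :=
      (((hasDerivAt_id x).ofReal_comp.mul_const (s : ℂ)).neg.cexp)
    refine ((h1.mul_const ((s : ℂ) ^ (p - 1))).mul_const ((1 + s : ℂ) ^ q)).congr_deriv ?_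
    rw [laplaceKer]; ring

/-- This is Kummer's equation for the Laplace integral, since differentiation in $t$ raises $p$ by
one up to sign. -/
theorem laplaceInt_recurrence {p q : ℂ} (hp : 0 < p.re) (hq : q.re ≤ 0) {t : ℝ} (ht : 0 < t) :
    t * laplaceInt (p + 2) q t = (p + q + 1 - t) * laplaceInt (p + 1) q t + p * laplaceInt p q t := by
  have hp1 : 0 < (p + 1).re := by simp; linarith
  have hp2 : 0 < (p + 2).re := by simp; linarith
  have i0 := integrableOn_laplaceKer hp hq ht
  have i1 := integrableOn_laplaceKer hp1 hq ht
  have i2 := integrableOn_laplaceKer hp2 hq ht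
  have hp0 : p ≠ 0 := by rintro rfl; simp at hp
  -- A primitive of the required combination of integrands, vanishing at both ends of the half-line.
  set F : ℝ → ℂ := fun s => Complex.exp (-(t * s)) * (s : ℂ) ^ p * (1 + s : ℂ) ^ (q + 1) with hF
  set F' : ℝ → ℂ := fun s => -t * laplaceKer (p + 2) q t s + (p + q + 1 - t) * laplaceKer (p + 1) q t s
    + p * laplaceKer p q t s with hF'
  have hd : ∀ s ∈ Ioi (0 : ℝ), HasDerivAt F (F' s) s := by
    intro s hs
    have hs0 : 0 < s := hs
    have hs' : (s : ℂ) ≠ 0 := by exact_mod_cast hs0.ne'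
    have hs1 : (1 + (s : ℂ)) ∈ Complex.slitPlane := by
      rw [one_add_ofReal_eq]; exact Complex.ofReal_mem_slitPlane.mpr (by linarith)
    have h1 : HasDerivAt (fun s : ℝ => Complex.exp (-((t : ℂ) * s)))
        (Complex.exp (-((t : ℂ) * s)) * -(t * 1)) s :=
      (((hasDerivAt_id s).ofReal_comp.const_mul (t : ℂ)).neg.cexp)
    have h2 := hasDerivAt_ofReal_cpow_pos hs0 p
    have h3 : HasDerivAt (fun s : ℝ => (1 + s : ℂ) ^ (q + 1)) ((q + 1) * (1 + s : ℂ) ^ q) s := by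
      have := (((hasDerivAt_id (s : ℂ)).const_add 1).cpow_const (c := q + 1) hs1).comp_ofReal
      simpa using this
    refine ((h1.mul h2).mul h3).congr_deriv ?_
    simp only [hF', Pi.mul_apply]
    rw [show p + 2 = p + 1 + 1 by ring, laplaceKer_add_one _ _ _ hs0, laplaceKer_add_one _ _ _ hs0,
      laplaceKer, Complex.cpow_add _ _ (Complex.slitPlane_ne_zero hs1), Complex.cpow_one,
      Complex.cpow_sub _ _ hs', Complex.cpow_one]
    field_simp
    ring
  have hbd : ∀ s : ℝ, 0 < s → ‖F s‖ ≤ s ^ p.re * Real.exp (-t * s) + s ^ (p.re + 1) * Real.exp (-t * s) := by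
    intro s hs
    have hs1 : (0 : ℝ) < 1 + s := by linarith
    have e : F s = laplaceKer (p + 1) q t s + laplaceKer (p + 2) q t s := by
      have hs1' : (1 + (s : ℂ)) ≠ 0 := by rw [one_add_ofReal_eq]; exact_mod_cast hs1.ne'
      rw [show p + 2 = p + 1 + 1 by ring, laplaceKer_add_one (p + 1) q t hs, laplaceKer]
      simp only [hF]
      rw [Complex.cpow_add _ _ hs1', Complex.cpow_one, add_sub_cancel_right]
      ring
    rw [e]
    refine (norm_add_le _ _).trans (add_le_add ?_ ?_)
    · have := norm_laplaceKer_le (p := p + 1) hq t hs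
      simpa using this
    · have := norm_laplaceKer_le (p := p + 2) hq t hs
      rwa [show (p + 2).re - 1 = p.re + 1 by simp; ring] at this
  have hlim : Tendsto F atTop (𝓝 0) := by
    rw [tendsto_zero_iff_norm_tendsto_zero]
    refine squeeze_zero' (Eventually.of_forall fun _ => norm_nonneg _)
      ((eventually_gt_atTop 0).mono hbd) ?_
    simpa using (tendsto_rpow_mul_exp_neg_mul_atTop_nhds_zero p.re t ht).add
      (tendsto_rpow_mul_exp_neg_mul_atTop_nhds_zero (p.re + 1) t ht)
  have hcont : ContinuousWithinAt F (Ici 0) 0 := by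
    refine ContinuousAt.continuousWithinAt ?_
    simp only [hF]
    refine (ContinuousAt.mul (by fun_prop) (Complex.continuousAt_ofReal_cpow_const 0 p (Or.inl hp))).mul ?_
    refine ContinuousAt.cpow (by fun_prop) continuousAt_const ?_
    simp
  have hint : IntegrableOn F' (Ioi 0) :=
    ((i2.const_mul _).add (i1.const_mul _)).add (i0.const_mul _)
  have key := integral_Ioi_of_hasDerivAt_of_tendsto hcont hd hint hlim
  have hF0 : F 0 = 0 := by simp [hF, hp0]
  rw [hF0, sub_zero] at key
  simp only [hF'] at key
  have hA : IntegrableOn (fun s => -(t : ℂ) * laplaceKer (p + 2) q t s +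
      (p + q + 1 - t) * laplaceKer (p + 1) q t s) (Ioi 0) :=
    (i2.const_mul _).add (i1.const_mul _)
  rw [integral_add hA (i0.const_mul _),
    integral_add (i2.const_mul _) (i1.const_mul _)] at key
  simp only [integral_const_mul] at key
  rw [← sub_eq_zero, laplaceInt, laplaceInt, laplaceInt]
  linear_combination -key

theorem isKummer_laplaceInt {p q : ℂ} (hp : 0 < p.re) (hq : q.re ≤ 0) :
    IsKummer p (p + q + 1) (laplaceInt p q) (fun t => -laplaceInt (p + 1) q t) where
  deriv t ht := hasDerivAt_laplaceInt hp hq ht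
  deriv' t ht := by
    have hp1 : 0 < (p + 1).re := by simp; linarith
    have ht' : (t : ℂ) ≠ 0 := by exact_mod_cast ht.ne'
    refine (hasDerivAt_laplaceInt hp1 hq ht).neg.congr_deriv ?_
    have := laplaceInt_recurrence hp hq ht
    rw [show p + 1 + 1 = p + 2 by ring]
    field_simp
    linear_combination this

/-- Rescaling the variable of integration. -/
theorem laplaceInt_mul (p q : ℂ) {t : ℝ} (ht : 0 < t) (ω : ℝ) :
    (t : ℂ) ^ (p + q) * laplaceInt p q (t * ω) =
      ∫ s in Ioi (0 : ℝ), Complex.exp (-(ω * s)) * (s : ℂ) ^ (p - 1) * (t + s : ℂ) ^ q := by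
  have ht' : (t : ℂ) ≠ 0 := by exact_mod_cast ht.ne'
  have := integral_comp_mul_left_Ioi
    (fun s : ℝ => Complex.exp (-(ω * s)) * (s : ℂ) ^ (p - 1) * (t + s : ℂ) ^ q) 0 ht
  rw [mul_zero] at this
  rw [eq_comm, inv_smul_eq_iff₀ ht.ne'] at this
  rw [this, laplaceInt, ← integral_const_mul, ← integral_smul]
  refine setIntegral_congr_fun measurableSet_Ioi fun s hs => ?_
  have hs0 : 0 < s := hs
  simp only [laplaceKer, Complex.real_smul]
  rw [show (t : ℂ) + ((t * s : ℝ) : ℂ) = (t : ℂ) * ((1 + s : ℝ) : ℂ) by push_cast; ring,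
    Complex.mul_cpow_ofReal_nonneg ht.le (by linarith), Complex.ofReal_mul t s,
    Complex.mul_cpow_ofReal_nonneg ht.le hs0.le, one_add_ofReal_eq, Complex.cpow_add _ _ ht',
    Complex.cpow_sub _ _ ht', Complex.cpow_one,
    show (ω : ℂ) * (t * s) = ((t * ω : ℝ) : ℂ) * s by push_cast; ring]
  field_simp

theorem laplaceInt_scaling (p q : ℂ) {t : ℝ} (ht : 0 < t) :
    (t : ℂ) ^ (p + q) * laplaceInt p q t =
      ∫ s in Ioi (0 : ℝ), Complex.exp (-s) * (s : ℂ) ^ (p - 1) * (t + s : ℂ) ^ q := by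
  simpa using laplaceInt_mul p q ht 1

/-- Both sides are the double integral of $s^{p-1}e^{-ts}\,r^{q-1}e^{-r}\,e^{-sr}$ over the
quadrant, integrated in the two orders. -/
theorem laplaceInt_symm {p q : ℂ} (hp : 0 < p.re) (hq : 0 < q.re) {t : ℝ} (ht : 0 < t) :
    Complex.Gamma q * laplaceInt p (-q) t =
      Complex.Gamma p * ((t : ℂ) ^ (q - p) * laplaceInt q (-p) t) := by
  have hG : ∀ {c : ℂ} {r : ℝ}, 0 < c.re → 0 < r →
      ∫ s in Ioi (0 : ℝ), (s : ℂ) ^ (c - 1) * Complex.exp (-(r * s)) =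
        (r : ℂ) ^ (-c) * Complex.Gamma c := by
    intro c r hc hr
    rw [Complex.integral_cpow_mul_exp_neg_mul_Ioi hc hr, one_div, Complex.inv_cpow _ _ (by
      rw [Complex.arg_ofReal_of_nonneg hr.le]; exact Real.pi_pos.ne), Complex.cpow_neg]
  set f : ℝ → ℝ → ℂ := fun s r =>
    (s : ℂ) ^ (p - 1) * Complex.exp (-(t * s)) * ((r : ℂ) ^ (q - 1) * Complex.exp (-r)) *
      Complex.exp (-(s * r)) with hf
  have m1 : ∀ c : ℂ, ∀ t : ℝ, AEStronglyMeasurable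
      (fun s : ℝ => (s : ℂ) ^ (c - 1) * Complex.exp (-(t * s))) (volume.restrict (Ioi 0)) := by
    intro c t
    refine ContinuousOn.aestronglyMeasurable ?_ measurableSet_Ioi
    refine ContinuousOn.mul (fun s hs => ((Complex.continuousAt_ofReal_cpow_const s (c - 1)
      (Or.inr (ne_of_gt hs)))).continuousWithinAt) (Continuous.continuousOn (by fun_prop))
  have i1 : ∀ {c : ℂ} {t : ℝ}, 0 < c.re → 0 < t → IntegrableOn
      (fun s : ℝ => (s : ℂ) ^ (c - 1) * Complex.exp (-(t * s))) (Ioi 0) := by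
    intro c t hc ht
    refine (integrableOn_rpow_mul_exp hc ht).mono' (m1 c t) ?_
    filter_upwards [ae_restrict_mem measurableSet_Ioi] with s hs
    rw [norm_mul, Complex.norm_cpow_eq_rpow_re_of_pos hs, Complex.norm_exp]
    simp
  have i2 := i1 hq one_pos
  simp only [Complex.ofReal_one, one_mul] at i2
  have hint : Integrable (Function.uncurry f)
      ((volume.restrict (Ioi 0)).prod (volume.restrict (Ioi 0))) := by
    refine ((i1 hp ht).mul_prod i2).mono
      (((i1 hp ht).mul_prod i2).aestronglyMeasurable.mul
        (Continuous.aestronglyMeasurable (by fun_prop))) ?_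
    rw [Measure.prod_restrict]
    filter_upwards [ae_restrict_mem (measurableSet_Ioi.prod measurableSet_Ioi)] with z hz
    simp only [Function.uncurry, hf]
    rw [norm_mul]
    refine mul_le_of_le_one_right (norm_nonneg _) ?_
    rw [Complex.norm_exp, Real.exp_le_one_iff]
    have : 0 ≤ z.1 * z.2 := mul_nonneg (le_of_lt hz.1) (le_of_lt hz.2)
    simpa using this
  have hsw := integral_integral_swap hint
  have L : ∫ s in Ioi (0 : ℝ), ∫ r in Ioi (0 : ℝ), f s r = Complex.Gamma q * laplaceInt p (-q) t := by
    rw [laplaceInt, ← integral_const_mul]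
    refine setIntegral_congr_fun measurableSet_Ioi fun s hs => ?_
    have hs0 : 0 < s := hs
    have := hG hq (show 0 < 1 + s by linarith)
    simp only [laplaceKer, hf]
    rw [one_add_ofReal_eq]
    calc _ = ∫ r in Ioi (0 : ℝ), ((s : ℂ) ^ (p - 1) * Complex.exp (-(t * s))) *
          ((r : ℂ) ^ (q - 1) * Complex.exp (-(((1 + s : ℝ) : ℂ) * r))) := by
          refine integral_congr_ae (Eventually.of_forall fun r => ?_)
          simp only
          rw [show -(((1 + s : ℝ) : ℂ) * r) = -r + -(s * r) by push_cast; ring, Complex.exp_add]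
          ring
      _ = _ := by rw [integral_const_mul, this]; ring
  have Rr : ∫ r in Ioi (0 : ℝ), ∫ s in Ioi (0 : ℝ), f s r =
      Complex.Gamma p * ((t : ℂ) ^ (q - p) * laplaceInt q (-p) t) := by
    rw [show q - p = q + -p by ring, laplaceInt_scaling q (-p) ht, ← integral_const_mul]
    refine setIntegral_congr_fun measurableSet_Ioi fun r hr => ?_
    have hr0 : 0 < r := hr
    have := hG hp (show 0 < t + r by linarith)
    simp only [hf]
    calc _ = ∫ s in Ioi (0 : ℝ), ((r : ℂ) ^ (q - 1) * Complex.exp (-r)) *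
          ((s : ℂ) ^ (p - 1) * Complex.exp (-(((t + r : ℝ) : ℂ) * s))) := by
          refine integral_congr_ae (Eventually.of_forall fun s => ?_)
          simp only
          rw [show -(((t + r : ℝ) : ℂ) * s) = -(t * s) + -(s * r) by push_cast; ring,
            Complex.exp_add]
          ring
      _ = _ := by rw [integral_const_mul, this]; push_cast; ring
  rw [← L, ← Rr, hsw]

/-- If `Re p = Re q` then `t^b J'(t) → -Γ(b)` as `t → 0`, with `b = 1 + p - q`. -/
theorem tendsto_laplaceInt_zero {p q : ℂ} (hq : 0 ≤ q.re) (hpq : p.re = q.re) :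
    Tendsto (fun t : ℝ => (t : ℂ) ^ (1 + p - q) * laplaceInt (p + 1) (-q) t) (𝓝[>] 0)
      (𝓝 (Complex.Gamma (1 + p - q))) := by
  have hre : (1 + p - q).re = 1 := by simp [hpq]
  have e : Complex.Gamma (1 + p - q) = ∫ s in Ioi (0 : ℝ), Complex.exp (-s) * (s : ℂ) ^ p * (s : ℂ) ^ (-q) := by
    rw [Complex.Gamma_eq_integral (by rw [hre]; exact one_pos), Complex.GammaIntegral]
    refine setIntegral_congr_fun measurableSet_Ioi fun s hs => ?_
    have hs' : (s : ℂ) ≠ 0 := by exact_mod_cast (ne_of_gt hs : s ≠ 0)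
    rw [show 1 + p - q - 1 = p + -q by ring, Complex.cpow_add _ _ hs']
    push_cast; ring
  have hmeas : ∀ t : ℝ, 0 ≤ t → ContinuousOn
      (fun s : ℝ => Complex.exp (-s) * (s : ℂ) ^ p * (t + s : ℂ) ^ (-q)) (Ioi 0) := by
    intro t ht
    refine ((Continuous.continuousOn (by fun_prop)).mul ?_).mul ?_
    · exact fun s hs => ((Complex.continuousAt_ofReal_cpow_const s p
        (Or.inr (ne_of_gt hs)))).continuousWithinAt
    · intro s hs
      have : (t + (s : ℂ)) ∈ Complex.slitPlane := by
        rw [← Complex.ofReal_add]; exact Complex.ofReal_mem_slitPlane.mpr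
          (by have := mem_Ioi.mp hs; linarith)
      exact (ContinuousAt.cpow (f := fun s : ℝ => (t + s : ℂ)) (by fun_prop) continuousAt_const
        this).continuousWithinAt
  have key : Tendsto (fun t : ℝ => ∫ s in Ioi (0 : ℝ), Complex.exp (-s) * (s : ℂ) ^ p *
      (t + s : ℂ) ^ (-q)) (𝓝[>] 0) (𝓝 (∫ s in Ioi (0 : ℝ), Complex.exp (-s) * (s : ℂ) ^ p *
      (s : ℂ) ^ (-q))) := by
    refine tendsto_integral_filter_of_dominated_convergence (fun s => Real.exp (-s)) ?_ ?_ ?_ ?_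
    · filter_upwards [self_mem_nhdsWithin] with t ht
      exact (hmeas t (le_of_lt ht)).aestronglyMeasurable measurableSet_Ioi
    · filter_upwards [self_mem_nhdsWithin] with t ht
      filter_upwards [ae_restrict_mem measurableSet_Ioi] with s hs
      have hs0 : 0 < s := hs
      have ht0 : 0 < t := ht
      rw [norm_mul, norm_mul, Complex.norm_cpow_eq_rpow_re_of_pos hs, ← Complex.ofReal_add,
        Complex.norm_cpow_eq_rpow_re_of_pos (by linarith), Complex.norm_exp, mul_assoc]
      simp only [Complex.neg_re, Complex.ofReal_re]
      refine mul_le_of_le_one_right (Real.exp_pos _).le ?_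
      calc s ^ p.re * (t + s) ^ (-q.re) ≤ s ^ p.re * s ^ (-q.re) :=
            mul_le_mul_of_nonneg_left (Real.rpow_le_rpow_of_nonpos hs0 (by linarith) (by linarith))
              (by positivity)
        _ = 1 := by rw [← Real.rpow_add hs0, hpq]; simp
    · simpa [IntegrableOn] using integrableOn_rpow_mul_exp one_pos one_pos
    · filter_upwards [ae_restrict_mem measurableSet_Ioi] with s hs
      have hs' : (0 + (s : ℂ)) ∈ Complex.slitPlane := by
        rw [zero_add]; exact Complex.ofReal_mem_slitPlane.mpr hs
      have c1 : ContinuousAt (fun t : ℝ => (t + s : ℂ) ^ (-q)) 0 :=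
        ContinuousAt.cpow (by fun_prop) continuousAt_const (by simpa using hs')
      have c2 := (c1.tendsto.mono_left (nhdsWithin_le_nhds (s := Ioi 0))).const_mul
        (Complex.exp (-s) * (s : ℂ) ^ p)
      simpa using c2
  rw [e]
  refine key.congr' ?_
  filter_upwards [self_mem_nhdsWithin] with t ht
  have := laplaceInt_scaling (p + 1) (-q) (t := t) ht
  rw [show p + 1 + -q = 1 + p - q by ring, add_sub_cancel_right] at this
  exact this.symm

/-! ### The Whittaker function -/

theorem IsKummer.sub {a b : ℂ} {v v' w w' : ℝ → ℂ} (hv : IsKummer a b v v')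
    (hw : IsKummer a b w w') : IsKummer a b (fun t => v t - w t) (fun t => v' t - w' t) where
  deriv t ht := (hv.deriv t ht).sub (hw.deriv t ht)
  deriv' t ht := by
    refine ((hv.deriv' t ht).sub (hw.deriv' t ht)).congr_deriv ?_
    ring

theorem tendsto_ofReal_zero : Tendsto (fun t : ℝ => (t : ℂ)) (𝓝[>] 0) (𝓝 0) := by
  have : Tendsto (fun t : ℝ => (t : ℂ)) (𝓝 0) (𝓝 ((0 : ℝ) : ℂ)) := Complex.continuous_ofReal.tendsto 0
  simpa using this.mono_left nhdsWithin_le_nhds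

theorem tendsto_zero_mul_bounded {φ g : ℝ → ℂ} {c : ℂ}
    (hφ : ∀ t, 0 < t → ‖φ t‖ = 1) (hg : Tendsto g (𝓝[>] 0) (𝓝 c)) :
    Tendsto (fun t : ℝ => φ t * (t * g t)) (𝓝[>] 0) (𝓝 0) := by
  have h1 : Tendsto (fun t : ℝ => (t : ℂ) * g t) (𝓝[>] 0) (𝓝 0) := by
    simpa using tendsto_ofReal_zero.mul hg
  rw [tendsto_zero_iff_norm_tendsto_zero] at h1 ⊢
  refine h1.congr' ?_
  filter_upwards [self_mem_nhdsWithin] with t ht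
  rw [norm_mul (φ t), hφ t ht, one_mul]

theorem continuous_kummerM (a b : ℂ) : Continuous (kummerM a b) :=
  continuous_iff_continuousAt.mpr fun z => (hasDerivAt_kummerM a b z).continuousAt

theorem continuous_kummerM' (a b : ℂ) : Continuous (kummerM' a b) := by
  have s1 : ∀ r : ℝ, 0 ≤ r → Summable fun n : ℕ => ‖(n + 1) * kummerCoeff a b (n + 1)‖ * r ^ n :=
    summable_norm_of_summable fun z => (hasDerivAt_powerSeries (summable_kummerCoeff a b) z).2
  exact continuous_iff_continuousAt.mpr fun z => (hasDerivAt_powerSeries s1 z).1.continuousAt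

theorem tendsto_kummerM_zero {a b : ℂ} (hb : ∀ n : ℕ, b ≠ -n) :
    Tendsto (fun t : ℝ => kummerM a b t) (𝓝[>] 0) (𝓝 1) := by
  have := ((continuous_kummerM a b).tendsto 0).comp tendsto_ofReal_zero
  rwa [kummerM_zero hb] at this

/-- Both sides solve the same Kummer equation, so by `IsKummer.eq_zero` it suffices to compare the
two invariants at zero. For the Laplace integral the second comes from `tendsto_laplaceInt_zero`,
and the first from the same limit after exchanging $p$ and $q$ by `laplaceInt_symm`. -/
theorem laplaceInt_eq_kummerM {p q : ℂ} (hp : 0 < p.re) (hpq : p.re = q.re) (hne : p ≠ q)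
    {t : ℝ} (ht : 0 < t) : laplaceInt p (-q) t =
      Complex.Gamma p / Complex.Gamma q * Complex.Gamma (q - p) * kummerM p (1 + p - q) t +
        Complex.Gamma (p - q) * ((t : ℂ) ^ (q - p) * kummerM q (1 + q - p) t) := by
  have hq : 0 < q.re := hpq ▸ hp
  have hb : ∀ n : ℕ, 1 + p - q ≠ -n := fun n h => by
    have := congrArg Complex.re h
    simp [hpq] at this
    have h2 : (0 : ℝ) ≤ n := n.cast_nonneg
    linarith
  have hb' : ∀ n : ℕ, 1 + q - p ≠ -n := fun n h => by
    have := congrArg Complex.re h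
    simp [hpq] at this
    have h2 : (0 : ℝ) ≤ n := n.cast_nonneg
    linarith
  have hd : p - q ≠ 0 := sub_ne_zero.mpr hne
  have hd' : q - p ≠ 0 := sub_ne_zero.mpr hne.symm
  have hGq : Complex.Gamma q ≠ 0 := Complex.Gamma_ne_zero_of_re_pos hq
  set A : ℂ := Complex.Gamma p / Complex.Gamma q * Complex.Gamma (q - p) with hA
  have k1 : IsKummer p (1 + p - q) (laplaceInt p (-q)) (fun t => -laplaceInt (p + 1) (-q) t) := by
    have := isKummer_laplaceInt hp (q := -q) (by simpa using hq.le)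
    rwa [show p + -q + 1 = 1 + p - q by ring] at this
  have k2 := (isKummer_kummerM (a := p) hb).const_mul A
  have k3 : IsKummer p (1 + p - q) (fun t : ℝ => (t : ℂ) ^ (q - p) * kummerM q (1 + q - p) t)
      (fun t => (t : ℂ) ^ (-(1 + p - q)) * ((q - p) * kummerM q (1 + q - p) t +
        t * kummerM' q (1 + q - p) t)) := by
    have := isKummer_second (a := p) (b := 1 + p - q) (by
      rw [show (2 : ℂ) - (1 + p - q) = 1 + q - p by ring]; exact hb')
    rwa [show (1 : ℂ) - (1 + p - q) = q - p by ring, show (2 : ℂ) - (1 + p - q) = 1 + q - p by ring,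
      show p - (1 + p - q) + 1 = q by ring] at this
  have K := (k1.sub k2).sub (k3.const_mul (Complex.Gamma (p - q)))
  have hbre : (1 + p - q).re = 1 := by simp [hpq]
  have hb1 : 1 + p - q ≠ 1 := fun h => hd (by linear_combination h)
  have hGb : Complex.Gamma (1 + p - q) = (p - q) * Complex.Gamma (p - q) := by
    rw [show 1 + p - q = (p - q) + 1 by ring, Complex.Gamma_add_one _ hd]
  have hGb' : Complex.Gamma (1 + q - p) = (q - p) * Complex.Gamma (q - p) := by
    rw [show 1 + q - p = (q - p) + 1 by ring, Complex.Gamma_add_one _ hd']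
  have M1 := tendsto_kummerM_zero (a := p) hb
  have M2 := tendsto_kummerM_zero (a := q) hb'
  have M1' := ((continuous_kummerM' p (1 + p - q)).tendsto 0).comp tendsto_ofReal_zero
  have M2' := ((continuous_kummerM' q (1 + q - p)).tendsto 0).comp tendsto_ofReal_zero
  have tM1' : Tendsto (fun t : ℝ => (t : ℂ) * kummerM' p (1 + p - q) t) (𝓝[>] 0) (𝓝 0) := by
    simpa using tendsto_ofReal_zero.mul M1'
  have tM2' : Tendsto (fun t : ℝ => (t : ℂ) * kummerM' q (1 + q - p) t) (𝓝[>] 0) (𝓝 0) := by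
    simpa using tendsto_ofReal_zero.mul M2'
  have hz := K.eq_zero hbre hb1 ?_ ?_ t ht
  · linear_combination hz
  · -- the first invariant
    have uα : Tendsto (fun t : ℝ => laplaceInt p (-q) t + t * (-laplaceInt (p + 1) (-q) t) /
        (1 + p - q - 1)) (𝓝[>] 0) (𝓝 A) := by
      have hlim := (tendsto_laplaceInt_zero (p := q) (q := p) hp.le hpq.symm).const_mul
        (-(Complex.Gamma p / Complex.Gamma q / (p - q)))
      rw [hGb', show -(Complex.Gamma p / Complex.Gamma q / (p - q)) * ((q - p) *
        Complex.Gamma (q - p)) = A by rw [hA]; field_simp; ring] at hlim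
      refine hlim.congr' ?_
      filter_upwards [self_mem_nhdsWithin] with t ht
      have ht0 : 0 < t := ht
      have ht' : (t : ℂ) ≠ 0 := by exact_mod_cast ht0.ne'
      -- Differentiating this symmetric form, the derivative of $t^{q-p}$ cancels the leading term
      -- of the invariant; what remains is the limit already computed, with $p$ and $q$ exchanged.
      have e1 : ∀ s : ℝ, 0 < s → laplaceInt p (-q) s =
          Complex.Gamma p / Complex.Gamma q * ((s : ℂ) ^ (q - p) * laplaceInt q (-p) s) := by
        intro s hs
        have := laplaceInt_symm hp hq hs
        field_simp
        linear_combination this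
      have d1 := hasDerivAt_laplaceInt hp (q := -q) (by simpa using hq.le) ht0
      have d2 : HasDerivAt (laplaceInt p (-q)) _ t :=
        (((hasDerivAt_ofReal_cpow_pos ht0 (q - p)).mul (hasDerivAt_laplaceInt hq (q := -p)
          (by simpa using hp.le) ht0)).const_mul (Complex.Gamma p / Complex.Gamma q)).congr_of_eventuallyEq
          ((lt_mem_nhds ht0).mono e1)
      rw [d1.unique d2, e1 t ht0]
      rw [show q - p - 1 = (q - p) + -1 by ring, Complex.cpow_add _ _ ht', Complex.cpow_neg_one,
        show 1 + q - p = (q - p) + 1 by ring, Complex.cpow_add _ _ ht', Complex.cpow_one,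
        show 1 + p - q - 1 = p - q by ring]
      field_simp
      ring
    have v1 : Tendsto (fun t : ℝ => A * kummerM p (1 + p - q) t +
        A * (t * kummerM' p (1 + p - q) t) / (p - q)) (𝓝[>] 0) (𝓝 A) := by
      simpa using (M1.const_mul A).add ((tM1'.const_mul A).div_const (p - q))
    have v2 : Tendsto (fun t : ℝ => (t : ℂ) ^ (q - p) * (t * (Complex.Gamma (p - q) / (p - q) *
        kummerM' q (1 + q - p) t))) (𝓝[>] 0) (𝓝 0) :=
      tendsto_zero_mul_bounded (fun t ht => norm_cpow_of_re_zero ht (by simp [hpq]))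
        (M2'.const_mul _)
    have := (uα.sub v1).sub v2
    simp only [sub_self] at this
    refine this.congr' ?_
    filter_upwards [self_mem_nhdsWithin] with t ht
    have ht0 : 0 < t := ht
    have ht' : (t : ℂ) ≠ 0 := by exact_mod_cast ht0.ne'
    rw [show -(1 + p - q) = (q - p) + -1 by ring, Complex.cpow_add _ _ ht', Complex.cpow_neg_one,
      show 1 + p - q - 1 = p - q by ring]
    field_simp
    ring
  · -- the second invariant
    have uβ := (tendsto_laplaceInt_zero hq.le hpq).neg
    have v1 : Tendsto (fun t : ℝ => (t : ℂ) ^ (p - q) * (t * (A * kummerM' p (1 + p - q) t)))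
        (𝓝[>] 0) (𝓝 0) :=
      tendsto_zero_mul_bounded (fun t ht => norm_cpow_of_re_zero ht (by simp [hpq]))
        (M1'.const_mul _)
    have v2 : Tendsto (fun t : ℝ => Complex.Gamma (p - q) * ((q - p) * kummerM q (1 + q - p) t +
        t * kummerM' q (1 + q - p) t)) (𝓝[>] 0) (𝓝 (Complex.Gamma (p - q) * ((q - p) * 1 + 0))) :=
      ((M2.const_mul _).add tM2').const_mul _
    have := (uβ.sub v1).sub v2
    rw [hGb, show -((p - q) * Complex.Gamma (p - q)) - 0 - Complex.Gamma (p - q) *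
      ((q - p) * 1 + 0) = 0 by ring] at this
    refine this.congr' ?_
    filter_upwards [self_mem_nhdsWithin] with t ht
    have ht0 : 0 < t := ht
    have ht' : (t : ℂ) ≠ 0 := by exact_mod_cast ht0.ne'
    have hne0 : (t : ℂ) ^ (p - q) ≠ 0 := by simp [Complex.cpow_eq_zero_iff, ht']
    rw [Complex.cpow_neg, show 1 + p - q = (p - q) + 1 by ring, Complex.cpow_add _ _ ht',
      Complex.cpow_one]
    field_simp

/-- The bound $\kappa<1/2$ makes the Laplace integral converge at zero. It holds for
$\kappa=-|k|/2$, the index on the side of frequencies with sign opposite to $k$. -/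
theorem whittakerW_eq_laplaceInt {κ : ℝ} (hκ : κ < 1 / 2) {R : ℝ} (hR : R ≠ 0) {y : ℝ}
    (hy : 0 < y) : whittakerW κ (Complex.I * R) y =
      Complex.exp (-(y : ℂ) / 2) * (y : ℂ) ^ (Complex.I * R + 1 / 2) /
        Complex.Gamma (1 / 2 + Complex.I * R - κ) *
        laplaceInt (1 / 2 + Complex.I * R - κ) (-(1 / 2 - Complex.I * R - κ)) y := by
  have hre : (1 / 2 + Complex.I * R - κ : ℂ).re = 1 / 2 - κ := by simp
  have hre' : (1 / 2 - Complex.I * R - κ : ℂ).re = 1 / 2 - κ := by simp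
  have hy' : (y : ℂ) ≠ 0 := by exact_mod_cast hy.ne'
  have hp : 0 < (1 / 2 + Complex.I * R - κ : ℂ).re := by rw [hre]; linarith
  have hG : Complex.Gamma (1 / 2 + Complex.I * R - κ) ≠ 0 := Complex.Gamma_ne_zero_of_re_pos hp
  have hG' : Complex.Gamma (1 / 2 - Complex.I * R - κ) ≠ 0 :=
    Complex.Gamma_ne_zero_of_re_pos (by rw [hre']; linarith)
  rw [laplaceInt_eq_kummerM hp (hre.trans hre'.symm) (fun h => hR (by
    have := congrArg Complex.im h
    simp at this
    linarith)) hy]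
  rw [whittakerW, whittakerM, whittakerM,
    show 1 / 2 - Complex.I * R - κ - (1 / 2 + Complex.I * R - κ) = -2 * (Complex.I * R) by ring,
    show 1 / 2 + Complex.I * R - κ - (1 / 2 - Complex.I * R - κ) = 2 * (Complex.I * R) by ring,
    show 1 + (1 / 2 + Complex.I * R - κ) - (1 / 2 - Complex.I * R - κ) = 1 + 2 * (Complex.I * R) by ring,
    show 1 + (1 / 2 - Complex.I * R - κ) - (1 / 2 + Complex.I * R - κ) = 1 + 2 * -(Complex.I * R) by ring,
    show Complex.I * R - κ + 1 / 2 = 1 / 2 + Complex.I * R - κ by ring,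
    show -(Complex.I * R) - κ + 1 / 2 = 1 / 2 - Complex.I * R - κ by ring,
    show -(Complex.I * R) + 1 / 2 = Complex.I * R + 1 / 2 + (-2 * (Complex.I * R)) by ring,
    Complex.cpow_add (Complex.I * R + 1 / 2) _ hy']
  generalize Complex.Gamma (1 / 2 + Complex.I * R - κ) = G at *
  generalize Complex.Gamma (1 / 2 - Complex.I * R - κ) = G' at *
  generalize (y : ℂ) ^ (Complex.I * R + 1 / 2) = Y
  generalize (y : ℂ) ^ (-2 * (Complex.I * R)) = Z
  generalize Complex.Gamma (-2 * (Complex.I * R)) = A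
  generalize Complex.Gamma (2 * (Complex.I * R)) = B
  generalize kummerM _ _ y = M₁
  generalize kummerM _ _ y = M₂
  field_simp

theorem conj_ofReal_cpow {y : ℝ} (hy : 0 < y) (s : ℂ) :
    (starRingEnd ℂ) ((y : ℂ) ^ s) = (y : ℂ) ^ (starRingEnd ℂ) s := by
  rw [Complex.cpow_conj _ _ (by rw [Complex.arg_ofReal_of_nonneg hy.le]; exact Real.pi_pos.ne),
    Complex.conj_ofReal]

theorem conj_whittakerM (κ : ℝ) (μ : ℂ) {y : ℝ} (hy : 0 < y) :
    (starRingEnd ℂ) (whittakerM κ μ y) = whittakerM κ ((starRingEnd ℂ) μ) y := by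
  rw [whittakerM, whittakerM, map_mul, map_mul, conj_kummerM, conj_ofReal_cpow hy,
    ← Complex.exp_conj]
  simp [map_div₀, Complex.conj_ofNat]

/-- Conjugation replaces $\mu=iR$ by $-\mu$ and so exchanges the two terms of the definition. -/
theorem conj_whittakerW (κ R : ℝ) {y : ℝ} (hy : 0 < y) :
    (starRingEnd ℂ) (whittakerW κ (Complex.I * R) y) = whittakerW κ (Complex.I * R) y := by
  rw [whittakerW, map_add, map_mul, map_mul, conj_whittakerM κ _ hy, conj_whittakerM κ _ hy,
    map_div₀, map_div₀, ← Complex.Gamma_conj, ← Complex.Gamma_conj, ← Complex.Gamma_conj,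
    ← Complex.Gamma_conj]
  simp only [map_mul, map_neg, map_sub, map_add, map_div₀, map_one, Complex.conj_I,
    Complex.conj_ofReal, map_ofNat, neg_mul, neg_neg, mul_neg]
  rw [add_comm, sub_neg_eq_add, ← sub_eq_add_neg]

/-- The Whittaker function oscillates at zero, so it does not vanish identically. -/
theorem exists_whittakerW_ne_zero (κ : ℝ) {R : ℝ} (hR : R ≠ 0) :
    ∃ y : ℝ, 0 < y ∧ whittakerW κ (Complex.I * R) y ≠ 0 := by
  by_contra! hcon
  set A : ℂ := Complex.Gamma (-2 * (Complex.I * R)) / Complex.Gamma (1 / 2 - Complex.I * R - κ) with hA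
  set B : ℂ := Complex.Gamma (2 * (Complex.I * R)) / Complex.Gamma (1 / 2 + Complex.I * R - κ) with hB
  set M₁ : ℝ → ℂ := fun y => kummerM (Complex.I * R - κ + 1 / 2) (1 + 2 * (Complex.I * R)) y with hM1
  set M₂ : ℝ → ℂ := fun y => kummerM (-(Complex.I * R) - κ + 1 / 2) (1 + 2 * -(Complex.I * R)) y with hM2
  have hne : ∀ z : ℂ, z.im ≠ 0 → ∀ n : ℕ, z ≠ -n := by
    rintro z hz n rfl
    simp at hz
  have hA0 : A ≠ 0 := div_ne_zero (Complex.Gamma_ne_zero (hne _ (by simpa using hR)))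
    (Complex.Gamma_ne_zero (hne _ (by simpa using hR)))
  have h1 : Tendsto M₁ (𝓝[>] 0) (𝓝 1) := tendsto_kummerM_zero (hne _ (by simpa using hR))
  have h2 : Tendsto M₂ (𝓝[>] 0) (𝓝 1) := tendsto_kummerM_zero (hne _ (by simpa using hR))
  have hyp : ∀ y : ℝ, 0 < y → A * (y : ℂ) ^ (2 * (Complex.I * R)) * M₁ y + B * M₂ y = 0 := by
    intro y hy
    have hy' : (y : ℂ) ≠ 0 := by exact_mod_cast hy.ne'
    have := hcon y hy
    rw [whittakerW, whittakerM, whittakerM,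
      show Complex.I * R + 1 / 2 = -(Complex.I * R) + 1 / 2 + 2 * (Complex.I * R) by ring,
      Complex.cpow_add (-(Complex.I * R) + 1 / 2) _ hy'] at this
    have e : Complex.exp (-(y : ℂ) / 2) * (y : ℂ) ^ (-(Complex.I * R) + 1 / 2) *
        (A * (y : ℂ) ^ (2 * (Complex.I * R)) * M₁ y + B * M₂ y) = 0 := by
      rw [← this]; ring
    refine (mul_eq_zero.mp e).resolve_left (mul_ne_zero (Complex.exp_ne_zero _) ?_)
    simp [Complex.cpow_eq_zero_iff, hy']
  have hlim : Tendsto (fun y : ℝ => A * (y : ℂ) ^ (2 * (Complex.I * R))) (𝓝[>] 0) (𝓝 (-B)) := by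
    have e1 : Tendsto (fun y : ℝ => -(B * M₂ y)) (𝓝[>] 0) (𝓝 (-B)) := by
      simpa using (h2.const_mul B).neg
    have e2 : Tendsto (fun y : ℝ => A * (y : ℂ) ^ (2 * (Complex.I * R)) * (M₁ y - 1)) (𝓝[>] 0) (𝓝 0) := by
      have : Tendsto (fun y : ℝ => A * (M₁ y - 1)) (𝓝[>] 0) (𝓝 0) := by
        simpa using (h1.sub_const 1).const_mul A
      rw [tendsto_zero_iff_norm_tendsto_zero] at this ⊢
      refine this.congr' ?_
      filter_upwards [self_mem_nhdsWithin] with y hy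
      rw [norm_mul (A * _), norm_mul A, norm_mul A, norm_cpow_of_re_zero hy (by simp), mul_one]
    have := e1.sub e2
    rw [sub_zero] at this
    refine this.congr' ?_
    filter_upwards [self_mem_nhdsWithin] with y hy
    linear_combination -hyp y hy
  -- Chosen so that $r^{2iR}=-1$: rescaling $y$ by $r$ changes the sign of the oscillating term,
  -- which can then have no limit other than zero.
  set r : ℝ := Real.exp (Real.pi / (2 * R)) with hr
  have hr0 : 0 < r := Real.exp_pos _
  have hmul : Tendsto (fun y : ℝ => r * y) (𝓝[>] 0) (𝓝[>] 0) := by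
    refine tendsto_nhdsWithin_iff.mpr ⟨?_, ?_⟩
    · have : Tendsto (fun y : ℝ => r * y) (𝓝 0) (𝓝 (r * 0)) := (continuous_const_mul r).tendsto 0
      rw [mul_zero] at this
      exact this.mono_left nhdsWithin_le_nhds
    · filter_upwards [self_mem_nhdsWithin] with y hy
      exact mul_pos hr0 hy
  have hrc : (r : ℂ) ^ (2 * (Complex.I * R)) = -1 := by
    rw [Complex.cpow_def_of_ne_zero (by exact_mod_cast hr0.ne'), ← Complex.ofReal_log hr0.le, hr,
      Real.log_exp]
    have hR' : (R : ℂ) ≠ 0 := by exact_mod_cast hR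
    rw [show ((Real.pi / (2 * R) : ℝ) : ℂ) * (2 * (Complex.I * R)) = Real.pi * Complex.I by
      push_cast; field_simp]
    exact Complex.exp_pi_mul_I
  have hlim2 := hlim.comp hmul
  have hlim3 : Tendsto (fun y : ℝ => A * (y : ℂ) ^ (2 * (Complex.I * R))) (𝓝[>] 0) (𝓝 B) := by
    have := hlim2.neg
    rw [neg_neg] at this
    refine this.congr' ?_
    filter_upwards [self_mem_nhdsWithin] with y hy
    simp only [Function.comp]
    rw [Complex.ofReal_mul, Complex.mul_cpow_ofReal_nonneg hr0.le (le_of_lt hy), hrc]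
    ring
  have hB0 : -B = B := tendsto_nhds_unique hlim hlim3
  have hB0' : B = 0 := self_eq_neg.mp hB0.symm
  rw [hB0', neg_zero, tendsto_zero_iff_norm_tendsto_zero] at hlim
  have hlim4 : Tendsto (fun _ : ℝ => ‖A‖) (𝓝[>] 0) (𝓝 0) := by
    refine hlim.congr' ?_
    filter_upwards [self_mem_nhdsWithin] with y hy
    rw [norm_mul A, norm_cpow_of_re_zero hy (by simp), mul_one]
  exact hA0 (norm_eq_zero.mp (tendsto_nhds_unique tendsto_const_nhds hlim4))

theorem tendsto_laplaceInt_atTop {p q : ℂ} (hp : 0 < p.re) (hq : q.re ≤ 0) :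
    Tendsto (fun t : ℝ => (t : ℂ) ^ p * laplaceInt p q t) atTop (𝓝 (Complex.Gamma p)) := by
  have key : Tendsto (fun t : ℝ => ∫ s in Ioi (0 : ℝ), Complex.exp (-s) * (s : ℂ) ^ (p - 1) *
      (1 + (s / t : ℝ) : ℂ) ^ q) atTop
      (𝓝 (∫ s in Ioi (0 : ℝ), Complex.exp (-s) * (s : ℂ) ^ (p - 1))) := by
    refine tendsto_integral_filter_of_dominated_convergence
      (fun s => s ^ (p.re - 1) * Real.exp (-1 * s)) ?_ ?_ ?_ ?_
    · filter_upwards [eventually_gt_atTop 0] with t ht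
      refine ContinuousOn.aestronglyMeasurable ?_ measurableSet_Ioi
      refine ((Continuous.continuousOn (by fun_prop)).mul ?_).mul ?_
      · exact fun s hs => ((Complex.continuousAt_ofReal_cpow_const s (p - 1)
          (Or.inr (ne_of_gt hs)))).continuousWithinAt
      · intro s hs
        have : (1 + (s / t : ℝ) : ℂ) ∈ Complex.slitPlane := by
          rw [one_add_ofReal_eq]
          exact Complex.ofReal_mem_slitPlane.mpr (by have := div_pos (mem_Ioi.mp hs) ht; linarith)
        exact (ContinuousAt.cpow (f := fun s : ℝ => (1 + (s / t : ℝ) : ℂ)) (by fun_prop)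
          continuousAt_const this).continuousWithinAt
    · filter_upwards [eventually_gt_atTop 0] with t ht
      filter_upwards [ae_restrict_mem measurableSet_Ioi] with s hs
      have h0 : 0 < s / t := div_pos hs ht
      rw [norm_mul, norm_mul, Complex.norm_cpow_eq_rpow_re_of_pos hs, one_add_ofReal_eq,
        Complex.norm_cpow_eq_rpow_re_of_pos (by linarith), Complex.norm_exp, mul_comm (Real.exp _)]
      have := Real.rpow_le_one_of_one_le_of_nonpos (show 1 ≤ 1 + s / t by linarith) hq
      have hs0 : 0 < s := hs
      refine (mul_le_of_le_one_right (by positivity) this).trans_eq ?_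
      simp
    · exact integrableOn_rpow_mul_exp hp one_pos
    · filter_upwards [ae_restrict_mem measurableSet_Ioi] with s hs
      have h0 : Tendsto (fun t : ℝ => (1 + (s / t : ℝ) : ℂ)) atTop (𝓝 1) := by
        have := (Complex.continuous_ofReal.tendsto 0).comp (tendsto_const_nhds.div_atTop tendsto_id
          : Tendsto (fun t : ℝ => s / t) atTop (𝓝 0))
        simpa using this.const_add 1
      have c1 : ContinuousAt (fun w : ℂ => w ^ q) 1 :=
        ContinuousAt.cpow continuousAt_id continuousAt_const (by simp)
      have := (c1.tendsto.comp h0).const_mul (Complex.exp (-s) * (s : ℂ) ^ (p - 1))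
      simpa using this
  have eG : Complex.Gamma p = ∫ s in Ioi (0 : ℝ), Complex.exp (-s) * (s : ℂ) ^ (p - 1) := by
    rw [Complex.Gamma_eq_integral hp, Complex.GammaIntegral]
    refine setIntegral_congr_fun measurableSet_Ioi fun s hs => ?_
    push_cast; ring
  rw [eG]
  refine key.congr' ?_
  filter_upwards [eventually_gt_atTop 0] with t ht
  have ht' : (t : ℂ) ≠ 0 := by exact_mod_cast ht.ne'
  have hne : (t : ℂ) ^ q ≠ 0 := by simp [Complex.cpow_eq_zero_iff, ht']
  have := laplaceInt_scaling p q ht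
  rw [Complex.cpow_add _ _ ht'] at this
  refine mul_left_cancel₀ hne ?_
  rw [show (t : ℂ) ^ q * ((t : ℂ) ^ p * laplaceInt p q t) =
    (t : ℂ) ^ p * (t : ℂ) ^ q * laplaceInt p q t by ring, this, ← integral_const_mul]
  refine setIntegral_congr_fun measurableSet_Ioi fun s hs => ?_
  rw [show (t : ℂ) + s = (t : ℂ) * ((1 + s / t : ℝ) : ℂ) by push_cast; field_simp,
    Complex.mul_cpow_ofReal_nonneg ht.le (by have := div_pos (mem_Ioi.mp hs) ht; linarith)]
  push_cast
  ring

/-- The size of the Whittaker function at infinity. -/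
theorem exists_le_norm_whittakerW {κ : ℝ} (hκ : κ < 1 / 2) {R : ℝ} (hR : R ≠ 0) :
    ∃ Y : ℝ, 0 < Y ∧ ∀ y, Y ≤ y →
      1 / 2 * (Real.exp (-y / 2) * y ^ κ) ≤ ‖whittakerW κ (Complex.I * R) y‖ := by
  set p : ℂ := 1 / 2 + Complex.I * R - κ with hp
  set q : ℂ := -(1 / 2 - Complex.I * R - κ) with hq
  have hpre : p.re = 1 / 2 - κ := by simp [hp]
  have hqre : q.re = -(1 / 2 - κ) := by simp [hq]
  have hp0 : 0 < p.re := by rw [hpre]; linarith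
  have hG : Complex.Gamma p ≠ 0 := Complex.Gamma_ne_zero_of_re_pos hp0
  have h1 := ((tendsto_laplaceInt_atTop hp0 (q := q) (by rw [hqre]; linarith)).div_const
    (Complex.Gamma p)).norm
  rw [div_self hG, norm_one] at h1
  have h2 := h1.eventually (eventually_gt_nhds (show (1 / 2 : ℝ) < 1 by norm_num))
  obtain ⟨Y, hY⟩ := eventually_atTop.mp h2
  refine ⟨max Y 1, by positivity, fun y hy => ?_⟩
  have hy1 : 0 < y := lt_of_lt_of_le one_pos ((le_max_right Y 1).trans hy)
  have h3 := hY y ((le_max_left _ _).trans hy)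
  rw [whittakerW_eq_laplaceInt hκ hR hy1, ← hp, ← hq]
  rw [norm_div, norm_mul, Complex.norm_cpow_eq_rpow_re_of_pos hy1, hpre] at h3
  rw [norm_mul, norm_div, norm_mul, Complex.norm_cpow_eq_rpow_re_of_pos hy1, Complex.norm_exp]
  have e1 : (-(y : ℂ) / 2).re = -y / 2 := by
    rw [show -(y : ℂ) / 2 = ((-y / 2 : ℝ) : ℂ) by push_cast; ring, Complex.ofReal_re]
  have e2 : (Complex.I * R + 1 / 2 : ℂ).re = 1 / 2 := by simp
  rw [e1, e2, show (1 / 2 : ℝ) = κ + (1 / 2 - κ) by ring, Real.rpow_add hy1,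
    show κ + (1 / 2 - κ) = 1 / 2 by ring]
  calc 1 / 2 * (Real.exp (-y / 2) * y ^ κ)
      ≤ (y ^ (1 / 2 - κ) * ‖laplaceInt p q y‖ / ‖Complex.Gamma p‖) * (Real.exp (-y / 2) * y ^ κ) := by
        gcongr
    _ = _ := by ring

/-! ### Holomorphic integrals and an injectivity theorem of Stieltjes type -/

/-- Cauchy's estimate turns a local bound of the integrand into one of its derivative, so no
separate domination of derivatives is required. -/
theorem differentiableOn_integral {α : Type*} [MeasurableSpace α] {μ : Measure α} {U : Set ℂ}
    (hU : IsOpen U) {F : ℂ → α → ℂ} (hF : ∀ᵐ s ∂μ, DifferentiableOn ℂ (fun ξ => F ξ s) U)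
    (hm : ∀ ξ ∈ U, AEStronglyMeasurable (F ξ) μ)
    (hb : ∀ ξ₀ ∈ U, ∃ r > 0, ∃ b : α → ℝ, Integrable b μ ∧
      ∀ᵐ s ∂μ, ∀ ξ ∈ Metric.ball ξ₀ r, ‖F ξ s‖ ≤ b s) :
    DifferentiableOn ℂ (fun ξ => ∫ s, F ξ s ∂μ) U := by
  intro ξ₀ hξ₀
  obtain ⟨r₁, hr₁, b, hbi, hb⟩ := hb ξ₀ hξ₀
  obtain ⟨r₂, hr₂, hsub⟩ := Metric.isOpen_iff.mp hU ξ₀ hξ₀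
  set r : ℝ := min r₁ r₂ / 2 with hr
  have hr0 : 0 < r := by positivity
  have hlt1 : r + r ≤ r₁ := by rw [hr]; linarith [min_le_left r₁ r₂]
  have hlt2 : r + r ≤ r₂ := by rw [hr]; linarith [min_le_right r₁ r₂]
  have hball : ∀ ξ ∈ Metric.ball ξ₀ r, ∀ w ∈ Metric.closedBall ξ (r / 2),
      w ∈ Metric.ball ξ₀ r₁ ∧ w ∈ U := by
    intro ξ hξ w hw
    have h1 := Metric.mem_ball.mp hξ
    have h2 := Metric.mem_closedBall.mp hw
    have h3 := dist_triangle w ξ ξ₀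
    exact ⟨Metric.mem_ball.mpr (by linarith), hsub (Metric.mem_ball.mpr (by linarith))⟩
  have hmem : ∀ ξ ∈ Metric.ball ξ₀ r, ξ ∈ Metric.ball ξ₀ r₁ ∧ ξ ∈ U := fun ξ hξ =>
    hball ξ hξ ξ (Metric.mem_closedBall_self (by positivity))
  have hmem0 := Metric.mem_ball_self (x := ξ₀) hr0
  have hder : ∀ᵐ s ∂μ, ∀ ξ ∈ Metric.ball ξ₀ r,
      HasDerivAt (fun ξ => F ξ s) (deriv (fun ξ => F ξ s) ξ) ξ := by
    filter_upwards [hF] with s hs ξ hξ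
    exact (hs.differentiableAt (hU.mem_nhds (hmem ξ hξ).2)).hasDerivAt
  have hFm : ∀ᶠ ξ in 𝓝 ξ₀, AEStronglyMeasurable (F ξ) μ :=
    (hU.mem_nhds hξ₀ |> fun h => Filter.mem_of_superset h hm)
  -- The derivative is measurable in $s$ as a limit of difference quotients along a real sequence.
  have hdm : AEStronglyMeasurable (fun s => deriv (fun ξ => F ξ s) ξ₀) μ := by
    have hx : ∀ n : ℕ, ξ₀ + (r / 2 * (1 / ((n : ℝ) + 1)) : ℝ) ∈ U := by
      intro n
      refine (hball ξ₀ hmem0 _ ?_).2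
      rw [Metric.mem_closedBall, dist_eq_norm, add_sub_cancel_left, Complex.norm_real,
        Real.norm_of_nonneg (by positivity)]
      refine mul_le_of_le_one_right (by positivity) ?_
      rw [div_le_one (by positivity)]
      have : (0 : ℝ) ≤ n := n.cast_nonneg
      linarith
    refine aestronglyMeasurable_of_tendsto_ae atTop
      (f := fun (n : ℕ) s => ((r / 2 * (1 / ((n : ℝ) + 1)) : ℝ) : ℂ)⁻¹ •
        (F (ξ₀ + (r / 2 * (1 / ((n : ℝ) + 1)) : ℝ)) s - F ξ₀ s))
      (fun n => ((hm _ (hx n)).sub (hm _ hξ₀)).const_smul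
        (((r / 2 * (1 / ((n : ℝ) + 1)) : ℝ) : ℂ)⁻¹)) ?_
    filter_upwards [hder] with s hs
    have h1 := (hs ξ₀ hmem0).tendsto_slope_zero
    have h2 : Tendsto (fun n : ℕ => ((r / 2 * (1 / ((n : ℝ) + 1)) : ℝ) : ℂ)) atTop (𝓝[≠] 0) := by
      refine tendsto_nhdsWithin_iff.mpr ⟨?_, Eventually.of_forall fun n => ?_⟩
      · have := (tendsto_one_div_add_atTop_nhds_zero_nat (𝕜 := ℝ)).const_mul (r / 2)
        rw [mul_zero] at this
        exact_mod_cast (Complex.continuous_ofReal.tendsto 0).comp this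
      · have : r / 2 * (1 / ((n : ℝ) + 1)) ≠ 0 := by positivity
        exact Complex.ofReal_ne_zero.mpr this
    exact h1.comp h2
  have hint : Integrable (F ξ₀) μ :=
    hbi.mono' (hm ξ₀ hξ₀) (hb.mono fun s hs => hs ξ₀ (hmem ξ₀ hmem0).1)
  have hbd : ∀ᵐ s ∂μ, ∀ ξ ∈ Metric.ball ξ₀ r, ‖deriv (fun ξ => F ξ s) ξ‖ ≤ b s / (r / 2) := by
    filter_upwards [hF, hb] with s hs hbs ξ hξ
    refine Complex.norm_deriv_le_of_forall_mem_sphere_norm_le (by positivity) ?_ ?_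
    · refine DifferentiableOn.diffContOnCl ?_
      refine hs.mono fun w hw => (hball ξ hξ w ?_).2
      exact Metric.closure_ball_subset_closedBall hw
    · intro w hw
      exact hbs w (hball ξ hξ w (Metric.sphere_subset_closedBall hw)).1
  exact (hasDerivAt_integral_of_dominated_loc_of_deriv_le (Metric.ball_mem_nhds ξ₀ hr0) hFm hint hdm
    hbd (hbi.div_const _) hder).2.differentiableAt.differentiableWithinAt

theorem hasDerivAt_integral_mul_cpow {α : Type*} [MeasurableSpace α] {μ : Measure α} {ψ : α → ℂ}
    (hψ : Integrable ψ μ) {u : α → ℝ} (hu : AEStronglyMeasurable u μ) (hu0 : ∀ᵐ s ∂μ, 0 ≤ u s)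
    {c : ℂ} (hc : c.re ≤ 0) {p : ℝ} (hp : 0 < p) :
    HasDerivAt (fun p : ℝ => ∫ s, ψ s * ((p + u s : ℝ) : ℂ) ^ c ∂μ)
      (c * ∫ s, ψ s * ((p + u s : ℝ) : ℂ) ^ (c - 1) ∂μ) p := by
  have hm : ∀ (p : ℝ) (c : ℂ), AEStronglyMeasurable (fun s => ψ s * ((p + u s : ℝ) : ℂ) ^ c) μ := by
    intro p c
    refine hψ.aestronglyMeasurable.mul ?_
    have : AEMeasurable (fun s => ((p + u s : ℝ) : ℂ) ^ c) μ :=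
      (Complex.measurable_ofReal.comp_aemeasurable (hu.aemeasurable.const_add p)).pow_const c
    exact this.aestronglyMeasurable
  have hle : ∀ {p₀ p : ℝ}, 0 < p₀ → p₀ ≤ p → ∀ {c : ℂ}, c.re ≤ 0 → ∀ s, 0 ≤ u s →
      ‖ψ s * ((p + u s : ℝ) : ℂ) ^ c‖ ≤ ‖ψ s‖ * p₀ ^ c.re := by
    intro p₀ p hp₀ hpp c hc s hs
    rw [norm_mul, Complex.norm_cpow_eq_rpow_re_of_pos (by linarith)]
    exact mul_le_mul_of_nonneg_left (Real.rpow_le_rpow_of_nonpos hp₀ (by linarith) hc) (norm_nonneg _)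
  have hc1 : (c - 1).re ≤ 0 := by simp; linarith
  have := (hasDerivAt_integral_of_dominated_loc_of_deriv_le (𝕜 := ℝ) (μ := μ) (x₀ := p)
    (s := Ioi (p / 2)) (F := fun p s => ψ s * ((p + u s : ℝ) : ℂ) ^ c)
    (F' := fun p s => c * (ψ s * ((p + u s : ℝ) : ℂ) ^ (c - 1)))
    (bound := fun s => ‖c‖ * (‖ψ s‖ * (p / 2) ^ (c - 1).re))
    (Ioi_mem_nhds (by linarith)) (Eventually.of_forall fun p => hm p c)
    ((hψ.norm.mul_const _).mono' (hm p c) (hu0.mono fun s hs => hle hp le_rfl hc s hs))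
    ((hm p (c - 1)).const_mul c) ?_ ((hψ.norm.mul_const _).const_mul _) ?_).2
  · rwa [integral_const_mul] at this
  · filter_upwards [hu0] with s hs x hx
    rw [norm_mul]
    exact mul_le_mul_of_nonneg_left (hle (by linarith) (le_of_lt hx) hc1 s hs) (norm_nonneg _)
  · filter_upwards [hu0] with s hs x hx
    have hx' : p / 2 < x := hx
    have h1 := ((hasDerivAt_ofReal_cpow_pos (show 0 < x + u s by linarith) c).scomp x
      ((hasDerivAt_id x).add_const (u s))).const_mul (ψ s)
    simp only [one_smul] at h1
    refine h1.congr_deriv ?_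
    ring

/-- Differentiating the identity in $p$ lowers the exponent by one; the factor $c-n$ that appears is
nonzero because $\operatorname{Re}c<0$. -/
theorem integral_mul_cpow_sub_natCast_eq {α : Type*} [MeasurableSpace α] {μ : Measure α}
    {ψ₁ ψ₂ : α → ℂ} (h₁ : Integrable ψ₁ μ) (h₂ : Integrable ψ₂ μ) {u₁ u₂ : α → ℝ}
    (hu₁ : AEStronglyMeasurable u₁ μ) (hu₂ : AEStronglyMeasurable u₂ μ)
    (hu₁0 : ∀ᵐ s ∂μ, 0 ≤ u₁ s) (hu₂0 : ∀ᵐ s ∂μ, 0 ≤ u₂ s) {c : ℂ} (hc : c.re < 0)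
    (h : ∀ p : ℝ, 0 < p → ∫ s, ψ₁ s * ((p + u₁ s : ℝ) : ℂ) ^ c ∂μ =
      ∫ s, ψ₂ s * ((p + u₂ s : ℝ) : ℂ) ^ c ∂μ) (n : ℕ) :
    ∀ p : ℝ, 0 < p → ∫ s, ψ₁ s * ((p + u₁ s : ℝ) : ℂ) ^ (c - n) ∂μ =
      ∫ s, ψ₂ s * ((p + u₂ s : ℝ) : ℂ) ^ (c - n) ∂μ := by
  induction n with
  | zero => simpa using h
  | succ n ih =>
    intro p hp
    have hre : (c - n).re < 0 := by
      have : (0 : ℝ) ≤ n := n.cast_nonneg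
      simp; linarith
    have hne : c - n ≠ 0 := fun h => by rw [h] at hre; simp at hre
    have d1 := hasDerivAt_integral_mul_cpow h₁ hu₁ hu₁0 hre.le hp
    have d2 := hasDerivAt_integral_mul_cpow h₂ hu₂ hu₂0 hre.le hp
    have := d1.unique (d2.congr_of_eventuallyEq ((lt_mem_nhds hp).mono ih))
    rw [show c - (n + 1 : ℕ) = c - n - 1 by push_cast; ring]
    exact mul_left_cancel₀ hne this

/-- If the moments of an integrable function on `(0, ∞)` with respect to `(1 - θ)^n - θ^n`,
`θ = 1 / (2 + s)`, all vanish, then so does the function. -/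
theorem ae_eq_zero_of_moments {ψ : ℝ → ℂ} (hψ : IntegrableOn ψ (Ioi 0))
    (h : ∀ n : ℕ, ∫ s in Ioi (0 : ℝ), ψ s * (((1 - 1 / (2 + s)) ^ n - (1 / (2 + s)) ^ n : ℝ) : ℂ) = 0) :
    ∀ᵐ s, s ∈ Ioi (0 : ℝ) → ψ s = 0 := by
  have hm : ∀ g : ℝ → ℝ, Measurable g → ∀ C : ℝ, (∀ s ∈ Ioi (0 : ℝ), |g s| ≤ C) →
      IntegrableOn (fun s => ψ s * (g s : ℂ)) (Ioi 0) := by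
    intro g hg C hC
    refine (hψ.norm.mul_const C).mono' (hψ.aestronglyMeasurable.mul
      (Complex.measurable_ofReal.comp hg).aestronglyMeasurable) ?_
    filter_upwards [ae_restrict_mem measurableSet_Ioi] with s hs
    rw [norm_mul, Complex.norm_real]
    exact mul_le_mul_of_nonneg_left (hC s hs) (norm_nonneg _)
  have hθ : ∀ s ∈ Ioi (0 : ℝ), 0 < 1 / (2 + s) ∧ 1 / (2 + s) < 1 / 2 := by
    intro s hs
    have hs0 : 0 < s := hs
    exact ⟨by positivity, one_div_lt_one_div_of_lt two_pos (by linarith)⟩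
  have hpoly : ∀ P : Polynomial ℝ, ∫ s in Ioi (0 : ℝ),
      ψ s * ((P.eval (1 - 1 / (2 + s)) - P.eval (1 / (2 + s)) : ℝ) : ℂ) = 0 := by
    intro P
    have e : ∀ s, ψ s * ((P.eval (1 - 1 / (2 + s)) - P.eval (1 / (2 + s)) : ℝ) : ℂ) =
        ∑ n ∈ P.support, (P.coeff n : ℂ) *
          (ψ s * (((1 - 1 / (2 + s)) ^ n - (1 / (2 + s)) ^ n : ℝ) : ℂ)) := by
      intro s
      rw [Polynomial.eval_eq_sum, Polynomial.eval_eq_sum, Polynomial.sum, Polynomial.sum,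
        ← Finset.sum_sub_distrib, Complex.ofReal_sum, Finset.mul_sum]
      refine Finset.sum_congr rfl fun n _ => ?_
      push_cast; ring
    simp_rw [e]
    rw [integral_finsetSum]
    · simp_rw [integral_const_mul, h, mul_zero, Finset.sum_const_zero]
    · intro n _
      refine (hm _ (by fun_prop) 2 fun s hs => ?_).const_mul _
      obtain ⟨h1, h2⟩ := hθ s hs
      have a1 : |1 - 1 / (2 + s)| ≤ 1 := abs_le.mpr ⟨by linarith, by linarith⟩
      have a2 : |1 / (2 + s)| ≤ 1 := abs_le.mpr ⟨by linarith, by linarith⟩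
      refine (abs_sub _ _).trans ?_
      rw [abs_pow, abs_pow]
      linarith [pow_le_one₀ (n := n) (abs_nonneg _) a1, pow_le_one₀ (n := n) (abs_nonneg _) a2]
  -- Weierstrass approximation on $[0,1]$; the bound is $2\cdot\varepsilon/(2(D+1))$ times
  -- $D=\int|\psi|$, hence at most $\varepsilon$.
  have hcont : ∀ g : ℝ → ℝ, Measurable g → ContinuousOn g (Icc 0 1) → ∫ s in Ioi (0 : ℝ),
      ψ s * ((g (1 - 1 / (2 + s)) - g (1 / (2 + s)) : ℝ) : ℂ) = 0 := by
    intro g hgm hg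
    obtain ⟨C, hC⟩ := isCompact_Icc.exists_bound_of_continuousOn hg
    have hmem : ∀ s ∈ Ioi (0 : ℝ), 1 - 1 / (2 + s) ∈ Icc (0 : ℝ) 1 ∧ 1 / (2 + s) ∈ Icc (0 : ℝ) 1 := by
      intro s hs
      obtain ⟨h1, h2⟩ := hθ s hs
      exact ⟨⟨by linarith, by linarith⟩, ⟨by linarith, by linarith⟩⟩
    have hgi : IntegrableOn (fun s => ψ s * ((g (1 - 1 / (2 + s)) - g (1 / (2 + s)) : ℝ) : ℂ)) (Ioi 0) := by
      refine hm _ ((hgm.comp (by fun_prop)).sub (hgm.comp (by fun_prop))) (C + C) fun s hs => ?_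
      obtain ⟨m1, m2⟩ := hmem s hs
      exact (abs_sub _ _).trans (add_le_add (hC _ m1) (hC _ m2))
    rw [← norm_le_zero_iff]
    refine le_of_forall_pos_le_add fun ε hε => ?_
    rw [zero_add]
    set D : ℝ := ∫ s in Ioi (0 : ℝ), ‖ψ s‖ with hD
    have hD0 : 0 ≤ D := integral_nonneg fun _ => norm_nonneg _
    obtain ⟨P, hP⟩ := exists_polynomial_near_of_continuousOn 0 1 g hg (ε / (2 * (D + 1))) (by positivity)
    have hPi : IntegrableOn (fun s => ψ s * ((P.eval (1 - 1 / (2 + s)) - P.eval (1 / (2 + s)) : ℝ) : ℂ))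
        (Ioi 0) := by
      obtain ⟨C', hC'⟩ := isCompact_Icc.exists_bound_of_continuousOn
        (P.continuous.continuousOn (s := Icc (0 : ℝ) 1))
      refine hm _ ((P.continuous.measurable.comp (by fun_prop)).sub
        (P.continuous.measurable.comp (by fun_prop))) (C' + C') fun s hs => ?_
      obtain ⟨m1, m2⟩ := hmem s hs
      exact (abs_sub _ _).trans (add_le_add (hC' _ m1) (hC' _ m2))
    rw [← sub_zero (∫ s in Ioi (0 : ℝ), _), ← hpoly P, ← integral_sub hgi hPi]
    calc _ ≤ ∫ s in Ioi (0 : ℝ), ‖ψ s‖ * (ε / (D + 1)) := by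
          refine norm_integral_le_of_norm_le (hψ.norm.mul_const _) ?_
          filter_upwards [ae_restrict_mem measurableSet_Ioi] with s hs
          obtain ⟨m1, m2⟩ := hmem s hs
          rw [← mul_sub, norm_mul, ← Complex.ofReal_sub, Complex.norm_real]
          refine mul_le_mul_of_nonneg_left ?_ (norm_nonneg _)
          have b1 := abs_lt.mp (hP _ m1)
          have b2 := abs_lt.mp (hP _ m2)
          have : ε / (D + 1) = ε / (2 * (D + 1)) + ε / (2 * (D + 1)) := by field_simp; ring
          rw [Real.norm_eq_abs, this]
          exact abs_le.mpr ⟨by linarith [b1.1, b1.2, b2.1, b2.2], by linarith [b1.1, b1.2, b2.1, b2.2]⟩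
      _ = D / (D + 1) * ε := by rw [integral_mul_const]; ring
      _ ≤ ε := mul_le_of_le_one_left hε.le (by rw [div_le_one (by linarith)]; linarith)
  refine isOpen_Ioi.ae_eq_zero_of_integral_contDiff_smul_eq_zero hψ.locallyIntegrableOn ?_
  intro g hg hgc hgs
  have hg0 : ∀ x ≤ 0, g x = 0 := fun x hx => image_eq_zero_of_notMem_tsupport fun h' =>
    absurd (mem_Ioi.mp (hgs h')) (not_lt.mpr hx)
  obtain ⟨M, hM⟩ := hgc.isCompact.isBounded.subset_closedBall 0
  have hgM : ∀ x, M < x → g x = 0 := fun x hx => image_eq_zero_of_notMem_tsupport fun h' => by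
    have := mem_closedBall_zero_iff.mp (hM h')
    exact absurd ((le_abs_self x).trans this) (not_le.mpr hx)
  -- The map $x\mapsto1/(1-x)-2$ sends $1-\theta$ to $s$ and $\theta$ to a nonpositive number, where
  -- $g$ vanishes. Only $\int\psi g$ survives.
  have hG := hcont (fun x => g (1 / (1 - x) - 2))
    (hg.continuous.measurable.comp (by fun_prop)) ?_
  · rw [← setIntegral_eq_integral_of_forall_compl_eq_zero (s := Ioi 0) (fun x hx => by
      rw [hg0 x (not_lt.mp hx), zero_smul])]
    rw [← hG]
    refine setIntegral_congr_fun measurableSet_Ioi fun s hs => ?_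
    have hs0 : 0 < s := hs
    obtain ⟨h1, h2⟩ := hθ s hs
    have e1 : 1 / (1 - (1 - 1 / (2 + s))) - 2 = s := by
      rw [sub_sub_cancel, one_div_one_div]; ring
    have e2 : 1 / (1 - 1 / (2 + s)) - 2 ≤ 0 := by
      rw [sub_nonpos, div_le_iff₀ (by linarith)]; linarith
    simp only [e1, hg0 _ e2, sub_zero]
    rw [Complex.real_smul, mul_comm]
  · intro x hx
    rcases eq_or_lt_of_le hx.2 with rfl | hlt
    -- Compact support of $g$ makes the test function vanish to the left of $x=1$. At $x=1$ itself
    -- division by zero gives the argument $-2$, where $g$ vanishes too.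
    · have hz : (fun x : ℝ => g (1 / (1 - x) - 2)) =ᶠ[𝓝[Icc 0 1] 1] fun _ => 0 := by
        have hpos : (0 : ℝ) < 1 / (|M| + 3) := by positivity
        filter_upwards [self_mem_nhdsWithin, mem_nhdsWithin_of_mem_nhds
          (Ioi_mem_nhds (show 1 - 1 / (|M| + 3) < 1 by linarith))] with x hx hx2
        rcases eq_or_lt_of_le hx.2 with rfl | hlt
        · exact hg0 _ (by norm_num)
        · refine hgM _ ?_
          have h1 : 0 < 1 - x := by linarith
          have h2 : 1 - x < 1 / (|M| + 3) := by have := mem_Ioi.mp hx2; linarith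
          have h3 : |M| + 3 < 1 / (1 - x) := by
            rw [lt_div_iff₀ h1]
            rw [lt_div_iff₀ (by positivity)] at h2
            linarith
          linarith [le_abs_self M]
      exact (continuousWithinAt_const (b := (0 : ℝ))).congr_of_eventuallyEq hz
        (hg0 _ (by norm_num))
    · refine ContinuousAt.continuousWithinAt ?_
      refine hg.continuous.continuousAt.comp ?_
      refine ContinuousAt.sub (ContinuousAt.div continuousAt_const (by fun_prop) ?_) continuousAt_const
      exact sub_ne_zero.mpr hlt.ne'

/-! ### Functions on the right half-plane with an inversion formula -/

/-- Holomorphic functions on the right half-plane that decay exponentially. -/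
structure IsDecaying (Φ : ℂ → ℂ) (r : ℝ) : Prop where
  pos : 0 < r
  differentiableOn : DifferentiableOn ℂ Φ {Q : ℂ | 0 < Q.re}
  bound : ∀ δ > 0, ∃ C, 0 ≤ C ∧ ∀ Q : ℂ, δ ≤ Q.re → ‖Φ Q‖ ≤ C * Real.exp (-r * Q.re)

/-- The integrand of `stieltjesInt`. -/
def stieltjesKer (Φ : ℂ → ℂ) (a c Q T : ℂ) (s : ℝ) : ℂ :=
  Φ (Q + s) * (s : ℂ) ^ (a - 1) * (T + s : ℂ) ^ (-c)

/-- `∫₀^∞ Φ(Q + s) s^{a-1} (T + s)^{-c} ds`. -/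
def stieltjesInt (Φ : ℂ → ℂ) (a c Q T : ℂ) : ℂ := ∫ s in Ioi (0 : ℝ), stieltjesKer Φ a c Q T s

theorem continuousOn_stieltjesKer {Φ : ℂ → ℂ} {r : ℝ} (hΦ : IsDecaying Φ r) (a c : ℂ) {Q T : ℂ}
    (hQ : 0 < Q.re) (hT : 0 < T.re) : ContinuousOn (stieltjesKer Φ a c Q T) (Ioi 0) := by
  refine ((hΦ.differentiableOn.continuousOn.comp (Continuous.continuousOn (by fun_prop)) ?_).mul
    ?_).mul ?_
  · intro s hs
    have := mem_Ioi.mp hs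
    simp only [mem_ofPred_eq, Complex.add_re, Complex.ofReal_re]
    linarith
  · exact fun s hs => ((Complex.continuousAt_ofReal_cpow_const s (a - 1)
      (Or.inr (ne_of_gt hs)))).continuousWithinAt
  · intro s hs
    have hs0 := mem_Ioi.mp hs
    have : (T + (s : ℂ)) ∈ Complex.slitPlane := Or.inl (by simp; linarith)
    exact (ContinuousAt.cpow (f := fun s : ℝ => (T + s : ℂ)) (by fun_prop) continuousAt_const
      this).continuousWithinAt

theorem norm_cpow_neg_le {T c : ℂ} {ε : ℝ} (hε : 0 < ε) (hT : ε ≤ T.re) (hc : 0 ≤ c.re) :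
    ‖T ^ (-c)‖ ≤ ε ^ (-c.re) * Real.exp (Real.pi * |c.im|) := by
  refine (Complex.norm_cpow_le T (-c)).trans ?_
  rw [div_eq_mul_inv, ← Real.exp_neg]
  have h1 : ε ≤ ‖T‖ := hT.trans ((le_abs_self _).trans (Complex.abs_re_le_norm T))
  have h2 : -(T.arg * (-c).im) ≤ Real.pi * |c.im| := by
    refine (neg_le_abs _).trans ?_
    rw [abs_mul, Complex.neg_im, abs_neg]
    exact mul_le_mul_of_nonneg_right (Complex.abs_arg_le_pi T) (abs_nonneg _)
  have h3 : ‖T‖ ^ (-c).re ≤ ε ^ (-c.re) := by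
    rw [Complex.neg_re]
    exact Real.rpow_le_rpow_of_nonpos hε h1 (by linarith)
  gcongr

theorem norm_stieltjesKer_le {Φ : ℂ → ℂ} {r C δ ε : ℝ} (hr : 0 < r) (hC0 : 0 ≤ C)
    (hC : ∀ Q : ℂ, δ ≤ Q.re → ‖Φ Q‖ ≤ C * Real.exp (-r * Q.re)) (hδ : 0 < δ) (hε : 0 < ε) (a : ℂ)
    {c Q T : ℂ} (hc : 0 ≤ c.re) (hQ : δ ≤ Q.re) (hT : ε ≤ T.re) {s : ℝ} (hs : 0 < s) :
    ‖stieltjesKer Φ a c Q T s‖ ≤ C * (ε ^ (-c.re) * Real.exp (Real.pi * |c.im|)) *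
      (s ^ (a.re - 1) * Real.exp (-r * s)) := by
  have h1 : ‖Φ (Q + s)‖ ≤ C * Real.exp (-r * s) := by
    refine (hC _ (by simp; linarith)).trans ?_
    refine mul_le_mul_of_nonneg_left (Real.exp_le_exp.mpr ?_) hC0
    simp only [Complex.add_re, Complex.ofReal_re]
    nlinarith
  have h2 : ‖(T + s : ℂ) ^ (-c)‖ ≤ ε ^ (-c.re) * Real.exp (Real.pi * |c.im|) :=
    norm_cpow_neg_le hε (by simp; linarith) hc
  rw [stieltjesKer, norm_mul, norm_mul, Complex.norm_cpow_eq_rpow_re_of_pos hs, Complex.sub_re,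
    Complex.one_re]
  calc _ ≤ C * Real.exp (-r * s) * s ^ (a.re - 1) *
        (ε ^ (-c.re) * Real.exp (Real.pi * |c.im|)) := by gcongr
    _ = _ := by ring

theorem integrableOn_stieltjesKer {Φ : ℂ → ℂ} {r : ℝ} (hΦ : IsDecaying Φ r) {a c : ℂ}
    (ha : 0 < a.re) (hc : 0 ≤ c.re) {Q T : ℂ} (hQ : 0 < Q.re) (hT : 0 < T.re) :
    IntegrableOn (stieltjesKer Φ a c Q T) (Ioi 0) := by
  obtain ⟨C, hC0, hC⟩ := hΦ.bound _ hQ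
  refine ((integrableOn_rpow_mul_exp ha hΦ.pos).const_mul
    (C * (T.re ^ (-c.re) * Real.exp (Real.pi * |c.im|)))).mono'
    ((continuousOn_stieltjesKer hΦ a c hQ hT).aestronglyMeasurable measurableSet_Ioi) ?_
  filter_upwards [ae_restrict_mem measurableSet_Ioi] with s hs
  exact norm_stieltjesKer_le hΦ.pos hC0 hC hQ hT a hc le_rfl le_rfl hs

theorem differentiableOn_stieltjesInt {Φ : ℂ → ℂ} {r : ℝ} (hΦ : IsDecaying Φ r) {a c : ℂ}
    (ha : 0 < a.re) (hc : 0 ≤ c.re) {U : Set ℂ} (hU : IsOpen U) {Q T : ℂ → ℂ}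
    (hQ : DifferentiableOn ℂ Q U) (hT : DifferentiableOn ℂ T U) (hQ0 : ∀ ξ ∈ U, 0 < (Q ξ).re)
    (hT0 : ∀ ξ ∈ U, 0 < (T ξ).re) :
    DifferentiableOn ℂ (fun ξ => stieltjesInt Φ a c (Q ξ) (T ξ)) U := by
  refine differentiableOn_integral hU (F := fun ξ s => stieltjesKer Φ a c (Q ξ) (T ξ) s) ?_
    (fun ξ hξ => (continuousOn_stieltjesKer hΦ a c (hQ0 ξ hξ) (hT0 ξ hξ)).aestronglyMeasurable
      measurableSet_Ioi) ?_
  · filter_upwards [ae_restrict_mem measurableSet_Ioi] with s hs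
    have hs0 := mem_Ioi.mp hs
    refine ((hΦ.differentiableOn.comp (hQ.add_const (s : ℂ)) fun ξ hξ => ?_).mul_const _).mul
      ((hT.add_const (s : ℂ)).cpow_const fun ξ hξ => Or.inl ?_)
    · have := hQ0 ξ hξ
      simp only [mem_ofPred_eq, Complex.add_re, Complex.ofReal_re]
      linarith
    · have := hT0 ξ hξ
      simp only [Complex.add_re, Complex.ofReal_re]
      linarith
  · intro ξ₀ hξ₀
    have h1 := hQ0 ξ₀ hξ₀
    have h2 := hT0 ξ₀ hξ₀
    have c1 : ContinuousAt (fun ξ => (Q ξ).re) ξ₀ := Complex.continuous_re.continuousAt.comp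
      (hQ.differentiableAt (hU.mem_nhds hξ₀)).continuousAt
    have c2 : ContinuousAt (fun ξ => (T ξ).re) ξ₀ := Complex.continuous_re.continuousAt.comp
      (hT.differentiableAt (hU.mem_nhds hξ₀)).continuousAt
    obtain ⟨ρ, hρ, hball⟩ := Metric.eventually_nhds_iff_ball.mp
      ((c1.eventually (lt_mem_nhds (show (Q ξ₀).re / 2 < (Q ξ₀).re by linarith))).and
        (c2.eventually (lt_mem_nhds (show (T ξ₀).re / 2 < (T ξ₀).re by linarith))))
    obtain ⟨C, hC0, hC⟩ := hΦ.bound ((Q ξ₀).re / 2) (by linarith)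
    refine ⟨ρ, hρ, _, (integrableOn_rpow_mul_exp ha hΦ.pos).const_mul
      (C * (((T ξ₀).re / 2) ^ (-c.re) * Real.exp (Real.pi * |c.im|))), ?_⟩
    filter_upwards [ae_restrict_mem measurableSet_Ioi] with s hs ξ hξ
    exact norm_stieltjesKer_le hΦ.pos hC0 hC (by linarith) (by linarith) a hc (hball ξ hξ).1.le
      (hball ξ hξ).2.le hs

/-- The two sides of the inversion formula. -/
def inversionLeft (Φ : ℂ → ℂ) (a c σ P Q : ℂ) : ℂ :=
  (1 / P + 1 / Q) ^ σ * stieltjesInt Φ a c (1 / Q) (1 / P + 1 / Q)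

/-- The two sides of the inversion formula. -/
def inversionRight (Φ : ℂ → ℂ) (a c σ : ℂ) (K : ℕ) (P Q : ℂ) : ℂ :=
  (P ^ (1 / 2 : ℂ) / Q ^ (1 / 2 : ℂ)) ^ K * ((P + Q) ^ σ * stieltjesInt Φ a c Q (P + Q))

theorem re_one_div_pos {Q : ℂ} (hQ : 0 < Q.re) : 0 < (1 / Q).re := by
  rw [one_div, Complex.inv_re]
  have : Q ≠ 0 := by rintro rfl; simp at hQ
  exact div_pos hQ (Complex.normSq_pos.mpr this)

/-- An inversion formula for conjugate arguments extends to all real ones. -/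
theorem inversion_real {Φ : ℂ → ℂ} {r : ℝ} (hΦ : IsDecaying Φ r) {a c σ : ℂ} (ha : 0 < a.re)
    (hc : 0 ≤ c.re) (K : ℕ) (h : ∀ x y : ℝ, 0 < y →
      inversionLeft Φ a c σ (y - Complex.I * x) (y + Complex.I * x) =
        inversionRight Φ a c σ K (y - Complex.I * x) (y + Complex.I * x))
    {p q : ℝ} (hp : 0 < p) (hq : 0 < q) :
    inversionLeft Φ a c σ p q = inversionRight Φ a c σ K p q := by
  set y : ℝ := (p + q) / 2 with hy
  have hy0 : 0 < y := by positivity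
  -- The real part $x$ is replaced by a complex $\xi$ in the strip $|\operatorname{Im}\xi|<y$, where
  -- $P=y-i\xi$ and $Q=y+i\xi$ keep positive real parts; the point $\xi=i(p-q)/2$ gives $P=p$,
  -- $Q=q$. Real $\xi$ tending to zero suffice for the identity theorem.
  set U : Set ℂ := {ξ : ℂ | -y < ξ.im} ∩ {ξ : ℂ | ξ.im < y} with hU
  have hUo : IsOpen U := (isOpen_lt continuous_const Complex.continuous_im).inter
    (isOpen_lt Complex.continuous_im continuous_const)
  have hUc : IsPreconnected U :=
    ((convex_halfSpace_im_gt (-y)).inter (convex_halfSpace_im_lt y)).isPreconnected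
  set P : ℂ → ℂ := fun ξ => y - Complex.I * ξ with hP
  set Q : ℂ → ℂ := fun ξ => y + Complex.I * ξ with hQ
  have hP0 : ∀ ξ ∈ U, 0 < (P ξ).re := fun ξ hξ => by
    have := hξ.1
    simp only [mem_ofPred_eq] at this
    simp [hP]; linarith
  have hQ0 : ∀ ξ ∈ U, 0 < (Q ξ).re := fun ξ hξ => by
    have := hξ.2
    simp only [mem_ofPred_eq] at this
    simp [hQ]; linarith
  have ne0 : ∀ {z : ℂ}, 0 < z.re → z ≠ 0 := by rintro z hz rfl; simp at hz
  have dP : DifferentiableOn ℂ P U := by fun_prop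
  have dQ : DifferentiableOn ℂ Q U := by fun_prop
  have dPi : DifferentiableOn ℂ (fun ξ => 1 / P ξ) U :=
    (differentiableOn_const _).div dP fun ξ hξ => ne0 (hP0 ξ hξ)
  have dQi : DifferentiableOn ℂ (fun ξ => 1 / Q ξ) U :=
    (differentiableOn_const _).div dQ fun ξ hξ => ne0 (hQ0 ξ hξ)
  have hs0 : ∀ ξ ∈ U, 0 < (1 / P ξ + 1 / Q ξ).re := fun ξ hξ => by
    rw [Complex.add_re]
    exact add_pos (re_one_div_pos (hP0 ξ hξ)) (re_one_div_pos (hQ0 ξ hξ))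
  have hs1 : ∀ ξ ∈ U, 0 < (P ξ + Q ξ).re := fun ξ hξ => by
    rw [Complex.add_re]
    exact add_pos (hP0 ξ hξ) (hQ0 ξ hξ)
  have dL : DifferentiableOn ℂ (fun ξ => inversionLeft Φ a c σ (P ξ) (Q ξ)) U :=
    ((dPi.add dQi).cpow_const fun ξ hξ => Or.inl (hs0 ξ hξ)).mul
      (differentiableOn_stieltjesInt hΦ ha hc hUo dQi (dPi.add dQi)
        (fun ξ hξ => re_one_div_pos (hQ0 ξ hξ)) hs0)
  have dR : DifferentiableOn ℂ (fun ξ => inversionRight Φ a c σ K (P ξ) (Q ξ)) U := by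
    refine DifferentiableOn.mul (DifferentiableOn.pow (DifferentiableOn.div
      (dP.cpow_const fun ξ hξ => Or.inl (hP0 ξ hξ)) (dQ.cpow_const fun ξ hξ => Or.inl (hQ0 ξ hξ))
      fun ξ hξ => ?_) K) (DifferentiableOn.mul
      ((dP.add dQ).cpow_const fun ξ hξ => Or.inl (hs1 ξ hξ))
      (differentiableOn_stieltjesInt hΦ ha hc hUo dQ (dP.add dQ) hQ0 hs1))
    simp [Complex.cpow_eq_zero_iff, ne0 (hQ0 ξ hξ)]
  have h0 : (0 : ℂ) ∈ U := ⟨by simpa using hy0, by simpa using hy0⟩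
  have hfreq : ∃ᶠ ξ in 𝓝[≠] (0 : ℂ), inversionLeft Φ a c σ (P ξ) (Q ξ) =
      inversionRight Φ a c σ K (P ξ) (Q ξ) := by
    have ht : Tendsto (fun n : ℕ => ((1 / ((n : ℝ) + 1) : ℝ) : ℂ)) atTop (𝓝[≠] 0) := by
      refine tendsto_nhdsWithin_iff.mpr ⟨?_, Eventually.of_forall fun n => ?_⟩
      · exact_mod_cast (Complex.continuous_ofReal.tendsto 0).comp
          (tendsto_one_div_add_atTop_nhds_zero_nat (𝕜 := ℝ))
      · have : 1 / ((n : ℝ) + 1) ≠ 0 := by positivity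
        exact Complex.ofReal_ne_zero.mpr this
    refine ht.frequently (Eventually.frequently (Eventually.of_forall fun n => ?_))
    exact h _ y hy0
  have key := (dL.analyticOnNhd hUo).eqOn_of_preconnected_of_frequently_eq (dR.analyticOnNhd hUo)
    hUc h0 hfreq
  have hξ : Complex.I * ((p - q) / 2 : ℝ) ∈ U := by
    constructor <;> simp [hy] <;> linarith
  have := key hξ
  have e1 : P (Complex.I * ((p - q) / 2 : ℝ)) = p := by
    simp only [hP, hy]
    rw [← mul_assoc, Complex.I_mul_I]
    push_cast; ring
  have e2 : Q (Complex.I * ((p - q) / 2 : ℝ)) = q := by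
    simp only [hQ, hy]
    rw [← mul_assoc, Complex.I_mul_I]
    push_cast; ring
  simpa only [e1, e2] using this

/-- With $Q=1$ the inversion formula compares two Stieltjes transforms of $\Phi(1+s)s^{a-1}$, with
nodes $1/(1+s)$ and $1+s$. Their derivatives at $p=1$ are the moments treated by
`ae_eq_zero_of_moments`. -/
theorem ae_eq_zero_of_inversion {Φ : ℂ → ℂ} {r : ℝ} (hΦ : IsDecaying Φ r) {a c σ : ℂ}
    (ha : 0 < a.re) (hc : 0 < c.re) (K : ℕ) (hσ : c = K / 2 + σ) (h : ∀ x y : ℝ, 0 < y →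
      inversionLeft Φ a c σ (y - Complex.I * x) (y + Complex.I * x) =
        inversionRight Φ a c σ K (y - Complex.I * x) (y + Complex.I * x)) :
    ∀ᵐ s : ℝ, s ∈ Ioi (0 : ℝ) → Φ (1 + s) = 0 := by
  have hreal : ∀ p : ℝ, 0 < p → stieltjesInt Φ a c 1 (1 / p + 1) =
      (p : ℂ) ^ c * stieltjesInt Φ a c 1 (p + 1) := by
    intro p hp
    have hp' : (p : ℂ) ≠ 0 := by exact_mod_cast hp.ne'
    have h1 := inversion_real hΦ ha hc.le K h hp one_pos
    simp only [inversionLeft, inversionRight, Complex.ofReal_one, div_one, Complex.one_cpow] at h1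
    have e1 : (1 / (p : ℂ) + 1) ^ σ = (p : ℂ) ^ (-σ) * ((p : ℂ) + 1) ^ σ := by
      rw [show 1 / (p : ℂ) + 1 = ((p⁻¹ : ℝ) : ℂ) * ((p + 1 : ℝ) : ℂ) by push_cast; field_simp; ring,
        Complex.mul_cpow_ofReal_nonneg (by positivity) (by positivity), Complex.ofReal_inv,
        Complex.inv_cpow _ _ (by rw [Complex.arg_ofReal_of_nonneg hp.le]; exact Real.pi_pos.ne),
        Complex.cpow_neg]
      push_cast; rfl
    have hne : ((p : ℂ) + 1) ^ σ ≠ 0 := by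
      have : (p : ℂ) + 1 ≠ 0 := by exact_mod_cast (by positivity : p + 1 ≠ 0)
      simp [Complex.cpow_eq_zero_iff, this]
    have hne' : (p : ℂ) ^ σ ≠ 0 := by simp [Complex.cpow_eq_zero_iff, hp']
    rw [e1, ← Complex.cpow_nat_mul, Complex.cpow_neg] at h1
    have e2 : (p : ℂ) ^ c = (p : ℂ) ^ (K * (1 / 2) : ℂ) * (p : ℂ) ^ σ := by
      rw [hσ, ← Complex.cpow_add _ _ hp', show (K : ℂ) / 2 = K * (1 / 2) by ring]
    rw [e2]
    field_simp at h1 ⊢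
    linear_combination h1
  set ψ₂ : ℝ → ℂ := fun s => Φ (1 + s) * (s : ℂ) ^ (a - 1) with hψ₂
  set ψ₁ : ℝ → ℂ := fun s => ψ₂ s * ((1 + s : ℝ) : ℂ) ^ (-c) with hψ₁
  have i1 : IntegrableOn ψ₁ (Ioi 0) := by
    have := integrableOn_stieltjesKer hΦ ha hc.le (Q := 1) (T := 1) (by simp) (by simp)
    refine this.congr_fun (fun s _ => ?_) measurableSet_Ioi
    simp [stieltjesKer, hψ₁, hψ₂]
  have i2 : IntegrableOn ψ₂ (Ioi 0) := by
    have := integrableOn_stieltjesKer hΦ ha (c := 0) (by simp) (Q := 1) (T := 1) (by simp) (by simp)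
    refine this.congr_fun (fun s _ => ?_) measurableSet_Ioi
    simp [stieltjesKer, hψ₂]
  -- The identity $1/p+1+s=p^{-1}(1+s)(p+1/(1+s))$ moves the power of $p$ out of the integral and
  -- exposes the node $1/(1+s)$.
  have hbase : ∀ p : ℝ, 0 < p →
      ∫ s in Ioi (0 : ℝ), ψ₁ s * ((p + 1 / (1 + s) : ℝ) : ℂ) ^ (-c) =
        ∫ s in Ioi (0 : ℝ), ψ₂ s * ((p + (1 + s) : ℝ) : ℂ) ^ (-c) := by
    intro p hp
    have hp' : (p : ℂ) ≠ 0 := by exact_mod_cast hp.ne'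
    have hne' : (p : ℂ) ^ c ≠ 0 := by simp [Complex.cpow_eq_zero_iff, hp']
    have e2 : ∫ s in Ioi (0 : ℝ), ψ₂ s * ((p + (1 + s) : ℝ) : ℂ) ^ (-c) =
        stieltjesInt Φ a c 1 (p + 1) := by
      refine setIntegral_congr_fun measurableSet_Ioi fun s _ => ?_
      simp only [stieltjesKer, hψ₂]
      push_cast; rw [add_assoc (p : ℂ)]
    have e1 : (p : ℂ) ^ c * ∫ s in Ioi (0 : ℝ), ψ₁ s * ((p + 1 / (1 + s) : ℝ) : ℂ) ^ (-c) =
        stieltjesInt Φ a c 1 (1 / p + 1) := by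
      rw [← integral_const_mul]
      refine setIntegral_congr_fun measurableSet_Ioi fun s hs => ?_
      have hs0 : 0 < s := hs
      simp only [stieltjesKer, hψ₁, hψ₂]
      have e : (1 / (p : ℂ) + 1 + s) ^ (-c) = (p : ℂ) ^ c * (((1 + s : ℝ) : ℂ) ^ (-c) *
          ((p + 1 / (1 + s) : ℝ) : ℂ) ^ (-c)) := by
        have h1s : (1 + (s : ℂ)) ≠ 0 := by exact_mod_cast (by positivity : 1 + s ≠ 0)
        rw [← Complex.mul_cpow_ofReal_nonneg (by positivity) (by positivity),
          show 1 / (p : ℂ) + 1 + s = ((p⁻¹ : ℝ) : ℂ) * (((1 + s) * (p + 1 / (1 + s)) : ℝ) : ℂ) by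
            push_cast; field_simp; ring,
          Complex.mul_cpow_ofReal_nonneg (by positivity) (by positivity), Complex.ofReal_inv,
          Complex.inv_cpow _ _ (by rw [Complex.arg_ofReal_of_nonneg hp.le]; exact Real.pi_pos.ne),
          Complex.cpow_neg, inv_inv, ← Complex.ofReal_mul]
      rw [e]; ring
    rw [e2]
    exact mul_left_cancel₀ hne' (e1.trans (hreal p hp))
  have hall := integral_mul_cpow_sub_natCast_eq i1 i2 (u₁ := fun s => 1 / (1 + s))
    (u₂ := fun s => 1 + s) (by fun_prop : Measurable fun s : ℝ => 1 / (1 + s)).aestronglyMeasurable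
    (by fun_prop : Measurable fun s : ℝ => 1 + s).aestronglyMeasurable
    ((ae_restrict_mem measurableSet_Ioi).mono fun s hs => by
      have : 0 < s := hs
      positivity)
    ((ae_restrict_mem measurableSet_Ioi).mono fun s hs => by
      have : 0 < s := hs
      positivity) (by simpa using hc) hbase
  set ψ : ℝ → ℂ := fun s => ψ₂ s * ((2 + s : ℝ) : ℂ) ^ (-c) with hψ
  have i0 : IntegrableOn ψ (Ioi 0) := by
    have := integrableOn_stieltjesKer hΦ ha hc.le (Q := 1) (T := 2) (by simp) (by simp)
    refine this.congr_fun (fun s _ => ?_) measurableSet_Ioi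
    simp [stieltjesKer, hψ, hψ₂]
  -- At $p=1$ the reciprocals of $1+1/(1+s)$ and $2+s$ are $1-\theta$ and $\theta$ with
  -- $\theta=1/(2+s)$, and the common factor $(2+s)^{-c}$ goes into $\psi$.
  have hmom := ae_eq_zero_of_moments i0 fun n => by
    have h1 := hall n 1 one_pos
    have e1 : ∀ s ∈ Ioi (0 : ℝ), ψ₁ s * ((1 + 1 / (1 + s) : ℝ) : ℂ) ^ (-c - n) =
        ψ s * (((1 - 1 / (2 + s)) ^ n : ℝ) : ℂ) := by
      intro s hs
      have hs0 : 0 < s := hs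
      have h1s : (1 + (s : ℂ)) ≠ 0 := by exact_mod_cast (by positivity : 1 + s ≠ 0)
      have h2s : (2 + (s : ℂ)) ≠ 0 := by exact_mod_cast (by positivity : 2 + s ≠ 0)
      have hu : ((1 + 1 / (1 + s) : ℝ) : ℂ) ≠ 0 := by
        exact_mod_cast (by positivity : 1 + 1 / (1 + s) ≠ 0)
      rw [Complex.cpow_sub _ _ hu, Complex.cpow_natCast]
      simp only [hψ₁, hψ]
      have e : ((1 + s : ℝ) : ℂ) ^ (-c) * ((1 + 1 / (1 + s) : ℝ) : ℂ) ^ (-c) =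
          ((2 + s : ℝ) : ℂ) ^ (-c) := by
        rw [← Complex.mul_cpow_ofReal_nonneg (by positivity) (by positivity), ← Complex.ofReal_mul,
          show (1 + s) * (1 + 1 / (1 + s)) = 2 + s by field_simp; ring]
      rw [← e]
      have e' : (((1 - 1 / (2 + s)) ^ n : ℝ) : ℂ) = (((1 + 1 / (1 + s) : ℝ) : ℂ) ^ n)⁻¹ := by
        rw [← Complex.ofReal_pow, ← Complex.ofReal_inv, ← inv_pow,
          show (1 + 1 / (1 + s))⁻¹ = 1 - 1 / (2 + s) by field_simp; ring]
      rw [e']; ring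
    have e2 : ∀ s ∈ Ioi (0 : ℝ), ψ₂ s * ((1 + (1 + s) : ℝ) : ℂ) ^ (-c - n) =
        ψ s * (((1 / (2 + s)) ^ n : ℝ) : ℂ) := by
      intro s hs
      have hs0 : 0 < s := hs
      have h2s : ((2 + s : ℝ) : ℂ) ≠ 0 := by exact_mod_cast (by positivity : 2 + s ≠ 0)
      rw [show 1 + (1 + s) = 2 + s by ring, Complex.cpow_sub _ _ h2s, Complex.cpow_natCast]
      simp only [hψ]
      push_cast
      rw [one_div, inv_pow]; ring
    rw [setIntegral_congr_fun measurableSet_Ioi e1, setIntegral_congr_fun measurableSet_Ioi e2] at h1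
    have hb : ∀ g : ℝ → ℝ, Measurable g → (∀ s ∈ Ioi (0 : ℝ), |g s| ≤ 1) →
        IntegrableOn (fun s => ψ s * ((g s ^ n : ℝ) : ℂ)) (Ioi 0) := by
      intro g hg hg1
      refine i0.norm.mono' (i0.aestronglyMeasurable.mul
        (Complex.measurable_ofReal.comp (hg.pow_const n)).aestronglyMeasurable) ?_
      filter_upwards [ae_restrict_mem measurableSet_Ioi] with s hs
      rw [norm_mul, Complex.norm_real, Real.norm_eq_abs, abs_pow]
      exact mul_le_of_le_one_right (norm_nonneg _) (pow_le_one₀ (abs_nonneg _) (hg1 s hs))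
    have hθ : ∀ s ∈ Ioi (0 : ℝ), 0 ≤ 1 / (2 + s) ∧ 1 / (2 + s) ≤ 1 := by
      intro s hs
      have hs0 : 0 < s := hs
      exact ⟨by positivity, by rw [div_le_one (by positivity)]; linarith⟩
    have j1 := hb (fun s => 1 - 1 / (2 + s)) (by fun_prop) fun s hs =>
      abs_le.mpr ⟨by linarith [hθ s hs], by linarith [hθ s hs]⟩
    have j2 := hb (fun s => 1 / (2 + s)) (by fun_prop) fun s hs =>
      abs_le.mpr ⟨by linarith [hθ s hs], by linarith [hθ s hs]⟩
    simp_rw [Complex.ofReal_sub, mul_sub]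
    rw [integral_sub j1 j2, h1, sub_self]
  filter_upwards [hmom] with s hs hs0
  have h1 := hs hs0
  have hs0' : 0 < s := hs0
  have n1 : (s : ℂ) ^ (a - 1) ≠ 0 := by
    simp [Complex.cpow_eq_zero_iff, hs0'.ne']
  have n2 : ((2 + s : ℝ) : ℂ) ^ (-c) ≠ 0 := by
    have : ((2 + s : ℝ) : ℂ) ≠ 0 := by exact_mod_cast (by positivity : 2 + s ≠ 0)
    rw [Ne, Complex.cpow_eq_zero_iff]
    exact fun h => this h.1
  exact (mul_eq_zero.mp ((mul_eq_zero.mp h1).resolve_right n2)).resolve_right n1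

/-! ### One-sided Fourier expansions -/

/-- The sum `∑ b_n e^{-w n Q}`. -/
def dirichletSum (w : ℝ) (b : ℕ → ℂ) (Q : ℂ) : ℂ := ∑' n : ℕ, b n * Complex.exp (-(w * n * Q))

theorem norm_exp_neg_mul (w : ℝ) (n : ℕ) (Q : ℂ) :
    ‖Complex.exp (-(w * n * Q))‖ = Real.exp (-(w * n * Q.re)) := by
  rw [Complex.norm_exp]
  congr 1
  rw [show (w : ℂ) * n = ((w * n : ℝ) : ℂ) by push_cast; ring, Complex.neg_re, Complex.re_ofReal_mul]

theorem norm_dirichletTerm_le {w : ℝ} (hw : 0 < w) {b : ℕ → ℂ} (hb0 : b 0 = 0) (n : ℕ) {δ : ℝ} {Q : ℂ}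
    (hQ : δ ≤ Q.re) : ‖b n * Complex.exp (-(w * n * Q))‖ ≤
      (Real.exp (w * δ) * (‖b n‖ * Real.exp (-(w * n * δ)))) * Real.exp (-w * Q.re) := by
  rcases Nat.eq_zero_or_pos n with rfl | hn
  · simp [hb0]
  · rw [norm_mul, norm_exp_neg_mul]
    have h1 : (1 : ℝ) ≤ n := by exact_mod_cast hn
    -- The exponents differ by $w(n-1)(\operatorname{Re}Q-\delta)\ge0$. The decay
    -- $e^{-w\operatorname{Re}Q}$ relies on the absence of the term $n=0$.
    have h2 : Real.exp (-(w * n * Q.re)) ≤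
        Real.exp (w * δ + -(w * n * δ) + -w * Q.re) := by
      refine Real.exp_le_exp.mpr ?_
      nlinarith [mul_nonneg (mul_nonneg hw.le (sub_nonneg.mpr h1)) (sub_nonneg.mpr hQ)]
    rw [Real.exp_add, Real.exp_add] at h2
    calc _ ≤ ‖b n‖ * (Real.exp (w * δ) * Real.exp (-(w * n * δ)) * Real.exp (-w * Q.re)) := by gcongr
      _ = _ := by ring

theorem differentiable_dirichletTerm (w : ℝ) (b : ℕ → ℂ) (n : ℕ) :
    Differentiable ℂ fun Q => b n * Complex.exp (-(w * n * Q)) := by fun_prop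

theorem isDecaying_dirichletTerm {w : ℝ} (hw : 0 < w) {b : ℕ → ℂ} (hb0 : b 0 = 0) (n : ℕ) :
    IsDecaying (fun Q => b n * Complex.exp (-(w * n * Q))) w where
  pos := hw
  differentiableOn := (differentiable_dirichletTerm w b n).differentiableOn
  bound δ _ := ⟨_, by positivity, fun _ hQ => norm_dirichletTerm_le hw hb0 n hQ⟩

theorem isDecaying_dirichletSum {w : ℝ} (hw : 0 < w) {b : ℕ → ℂ} (hb0 : b 0 = 0)
    (hb : ∀ δ > 0, Summable fun n : ℕ => ‖b n‖ * Real.exp (-(w * n * δ))) :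
    IsDecaying (dirichletSum w b) w where
  pos := hw
  differentiableOn := by
    intro Q hQ
    have hQ0 : 0 < Q.re := hQ
    have hU : IsOpen {Q' : ℂ | Q.re / 2 < Q'.re} := isOpen_lt continuous_const Complex.continuous_re
    have hd := Complex.differentiableOn_tsum_of_summable_norm (hb (Q.re / 2) (by linarith))
      (fun n => (differentiable_dirichletTerm w b n).differentiableOn) hU (fun n Q' hQ' => by
        rw [norm_mul, norm_exp_neg_mul]
        have : Q.re / 2 < Q'.re := hQ'
        gcongr)
    have hQm : Q ∈ {Q' : ℂ | Q.re / 2 < Q'.re} := by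
      rw [mem_ofPred_eq]; linarith
    exact (hd.differentiableAt (hU.mem_nhds hQm)).differentiableWithinAt
  bound δ hδ := by
    refine ⟨Real.exp (w * δ) * ∑' n : ℕ, ‖b n‖ * Real.exp (-(w * n * δ)),
      mul_nonneg (Real.exp_pos _).le (tsum_nonneg fun n => by positivity), fun Q hQ => ?_⟩
    have hs := ((hb δ hδ).mul_left (Real.exp (w * δ))).mul_right (Real.exp (-w * Q.re))
    rw [← tsum_mul_left, ← tsum_mul_right]
    exact tsum_of_norm_bounded hs.hasSum fun n => norm_dirichletTerm_le hw hb0 n hQ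

theorem hasSum_stieltjesInt {w : ℝ} (hw : 0 < w) {b : ℕ → ℂ} (hb0 : b 0 = 0)
    (hb : ∀ δ > 0, Summable fun n : ℕ => ‖b n‖ * Real.exp (-(w * n * δ))) {a c Q T : ℂ}
    (ha : 0 < a.re) (hc : 0 ≤ c.re) (hQ : 0 < Q.re) (hT : 0 < T.re) :
    HasSum (fun n : ℕ => stieltjesInt (fun Q => b n * Complex.exp (-(w * n * Q))) a c Q T)
      (stieltjesInt (dirichletSum w b) a c Q T) := by
  have hint := fun n => integrableOn_stieltjesKer (isDecaying_dirichletTerm hw hb0 n) ha hc hQ hT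
  have hle : ∀ n : ℕ, ∀ s ∈ Ioi (0 : ℝ),
      ‖stieltjesKer (fun Q => b n * Complex.exp (-(w * n * Q))) a c Q T s‖ ≤
      (Real.exp (w * Q.re) * (‖b n‖ * Real.exp (-(w * n * Q.re)))) *
        (T.re ^ (-c.re) * Real.exp (Real.pi * |c.im|)) * (s ^ (a.re - 1) * Real.exp (-w * s)) :=
    fun n s hs => norm_stieltjesKer_le hw (by positivity)
      (fun _ hQ => norm_dirichletTerm_le hw hb0 n hQ) hQ hT a hc le_rfl le_rfl hs
  have h1 := hasSum_integral_of_summable_integral_norm hint (by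
    refine Summable.of_nonneg_of_le (fun n => integral_nonneg fun _ => norm_nonneg _) (fun n =>
      setIntegral_mono_on (hint n).norm ((integrableOn_rpow_mul_exp ha hw).const_mul _)
        measurableSet_Ioi (hle n)) ?_
    simp_rw [integral_const_mul]
    exact (((hb _ hQ).mul_left _).mul_right _).mul_right _)
  have h2 : ∫ s in Ioi (0 : ℝ), ∑' n : ℕ,
      stieltjesKer (fun Q => b n * Complex.exp (-(w * n * Q))) a c Q T s =
        stieltjesInt (dirichletSum w b) a c Q T := by
    refine setIntegral_congr_fun measurableSet_Ioi fun s _ => ?_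
    simp only [stieltjesKer, dirichletSum]
    rw [tsum_mul_right, tsum_mul_right]
  rw [← h2]
  exact h1

/-- In the variable $u=e^{-wQ}$ the sum is a power series at $u=0$ with zeros accumulating there as
$s\to\infty$. -/
theorem dirichletSum_eq_zero {w : ℝ} (hw : 0 < w) {b : ℕ → ℂ}
    (hb : ∀ δ > 0, Summable fun n : ℕ => ‖b n‖ * Real.exp (-(w * n * δ)))
    (h : ∀ᵐ s : ℝ, s ∈ Ioi (0 : ℝ) → dirichletSum w b (1 + s) = 0) : b = 0 := by
  set f : ℂ → ℂ := fun u => ∑' n : ℕ, u ^ n • b n with hf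
  have hseries : HasFPowerSeriesAt f (FormalMultilinearSeries.ofScalars ℂ b) 0 := by
    rw [hasFPowerSeriesAt_iff]
    have hpos : 0 < Real.exp (-(w * 1)) := Real.exp_pos _
    filter_upwards [Metric.ball_mem_nhds (0 : ℂ) hpos] with u hu
    simp only [FormalMultilinearSeries.coeff_ofScalars, zero_add, hf]
    refine Summable.hasSum (Summable.of_norm_bounded (hb 1 one_pos) fun n => ?_)
    rw [norm_smul, norm_pow, mul_comm, show -(w * n * 1) = n * -(w * 1) by ring, Real.exp_nat_mul]
    have := (mem_ball_zero_iff.mp hu).le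
    gcongr
  have hfreq : ∃ᶠ s : ℝ in atTop, dirichletSum w b (1 + s) = 0 := by
    intro hev
    obtain ⟨M, hM⟩ := eventually_atTop.mp hev
    have hsub : Ioi (max M 0) ⊆ {s : ℝ | ¬(s ∈ Ioi (0 : ℝ) → dirichletSum w b (1 + s) = 0)} := by
      intro s hs
      have hs' := max_lt_iff.mp (mem_Ioi.mp hs)
      exact fun h' => hM s hs'.1.le (h' hs'.2)
    have h0 := measure_mono_null hsub (ae_iff.mp h)
    simp at h0
  have ht : Tendsto (fun s : ℝ => ((Real.exp (-(w * (1 + s))) : ℝ) : ℂ)) atTop (𝓝[≠] 0) := by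
    refine tendsto_nhdsWithin_iff.mpr ⟨?_, Eventually.of_forall fun s =>
      Complex.ofReal_ne_zero.mpr (Real.exp_pos _).ne'⟩
    have h1 : Tendsto (fun s : ℝ => -(w * (1 + s))) atTop atBot :=
      tendsto_neg_atTop_atBot.comp ((tendsto_atTop_add_const_left _ _ tendsto_id).const_mul_atTop hw)
    exact_mod_cast (Complex.continuous_ofReal.tendsto 0).comp (Real.tendsto_exp_atBot.comp h1)
  have hfz : ∃ᶠ u in 𝓝[≠] (0 : ℂ), f u = 0 := by
    refine ht.frequently (hfreq.mono fun s hs => ?_)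
    rw [← hs, hf, dirichletSum]
    refine tsum_congr fun n => ?_
    rw [smul_eq_mul, mul_comm, Complex.ofReal_exp, ← Complex.exp_nat_mul]
    congr 2
    push_cast; ring
  have hz := hseries.analyticAt.frequently_zero_iff_eventually_zero.mp hfz
  have hp := hseries.locally_zero_iff.mp hz
  funext n
  have h0 : FormalMultilinearSeries.coeff (0 : FormalMultilinearSeries ℂ ℂ ℂ) n = 0 := by
    simp [FormalMultilinearSeries.coeff]
  rw [← hp, FormalMultilinearSeries.coeff_ofScalars] at h0
  exact h0

/-- The Whittaker function as a Stieltjes integral. -/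
theorem whittakerW_mul_exp_eq (K : ℕ) {R : ℝ} (hR : R ≠ 0) {ω : ℝ} (hω : 0 < ω) (x : ℝ) {y : ℝ}
    (hy : 0 < y) (X : ℂ) :
    X * whittakerW ((-(K / 2 : ℝ) : ℝ) : ℂ) (Complex.I * R) (2 * ω * y) *
        Complex.exp (-(Complex.I * ω * x)) =
      ((2 * y : ℝ) : ℂ) ^ (1 / 2 - Complex.I * R) / Complex.Gamma ((K + 1) / 2 + Complex.I * R) *
        stieltjesInt (fun Q => X * (ω : ℂ) ^ (Complex.I * R + 1 / 2) * Complex.exp (-(ω * Q)))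
          ((K + 1) / 2 + Complex.I * R) ((K + 1) / 2 - Complex.I * R) (y + Complex.I * x) (2 * y : ℝ) := by
  have hK : (0 : ℝ) ≤ K := K.cast_nonneg
  have h2y : (0 : ℝ) < 2 * y := by positivity
  have h2y' : ((2 * y : ℝ) : ℂ) ≠ 0 := by exact_mod_cast h2y.ne'
  set a : ℂ := (K + 1) / 2 + Complex.I * R with ha
  set c : ℂ := (K + 1) / 2 - Complex.I * R with hc
  have e1 : stieltjesInt (fun Q => X * (ω : ℂ) ^ (Complex.I * R + 1 / 2) * Complex.exp (-(ω * Q)))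
      a c (y + Complex.I * x) (2 * y : ℝ) =
      X * (ω : ℂ) ^ (Complex.I * R + 1 / 2) * Complex.exp (-(ω * (y + Complex.I * x))) *
        (((2 * y : ℝ) : ℂ) ^ (a - c) * laplaceInt a (-c) (2 * y * ω)) := by
    rw [sub_eq_add_neg a c, laplaceInt_mul a (-c) h2y ω, ← integral_const_mul, stieltjesInt]
    refine setIntegral_congr_fun measurableSet_Ioi fun s _ => ?_
    simp only [stieltjesKer]
    rw [mul_add (ω : ℂ) _ (s : ℂ), neg_add, Complex.exp_add]
    ring
  have e2 := whittakerW_eq_laplaceInt (κ := -(K / 2 : ℝ)) (by linarith) hR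
    (show 0 < 2 * y * ω by positivity)
  rw [show (1 / 2 + Complex.I * R - ((-(K / 2 : ℝ) : ℝ) : ℂ)) = a by rw [ha]; push_cast; ring,
    show (1 / 2 - Complex.I * R - ((-(K / 2 : ℝ) : ℝ) : ℂ)) = c by rw [hc]; push_cast; ring] at e2
  rw [e1, show 2 * ω * y = 2 * y * ω by ring, e2, Complex.ofReal_mul (2 * y) ω,
    Complex.mul_cpow_ofReal_nonneg h2y.le hω.le,
    show Complex.I * R + 1 / 2 = (1 / 2 - Complex.I * R) + (a - c) by rw [ha, hc]; ring,
    Complex.cpow_add (1 / 2 - Complex.I * R) (a - c) h2y', mul_add (ω : ℂ), neg_add, Complex.exp_add,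
    show -(((2 * y : ℝ) : ℂ) * ω) / 2 = -((ω : ℂ) * y) by push_cast; ring,
    show -(Complex.I * ω * x) = -((ω : ℂ) * (Complex.I * x)) by ring]
  ring

/-- Convergence of the Fourier expansion bounds the coefficients. -/
theorem summable_norm_mul_exp (K : ℕ) {R : ℝ} (hR : R ≠ 0) {w : ℝ} (hw : 0 < w) {X : ℕ → ℂ}
    (hX : ∀ y : ℝ, 0 < y → Summable fun n : ℕ =>
      X n * whittakerW ((-(K / 2 : ℝ) : ℝ) : ℂ) (Complex.I * R) (2 * (w * n) * y)) {δ : ℝ} (hδ : 0 < δ) :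
    Summable fun n : ℕ => ‖X n * ((w * n : ℝ) : ℂ) ^ (Complex.I * R + 1 / 2)‖ *
      Real.exp (-(w * n * δ)) := by
  have hK : (0 : ℝ) ≤ K := K.cast_nonneg
  obtain ⟨Y, hY0, hY⟩ := exists_le_norm_whittakerW (κ := -(K / 2 : ℝ)) (by linarith) hR
  -- At height $\delta/2$ the terms tend to zero, so the lower bound for $W$ gives $|X_n|\ll
  -- e^{w\delta n/2}$ times a power of $n$, and the factor $e^{-w\delta n}$ leaves geometric decay.
  have hlim := (hX (δ / 2) (by linarith)).tendsto_atTop_zero.norm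
  rw [norm_zero] at hlim
  have hev := hlim.eventually (eventually_lt_nhds (show (0 : ℝ) < 1 by norm_num))
  have hev2 : ∀ᶠ n : ℕ in atTop, Y ≤ w * δ * n :=
    (tendsto_natCast_atTop_atTop.const_mul_atTop (by positivity)).eventually_ge_atTop Y
  set A : ℝ := 2 * (w * δ) ^ (K / 2 : ℝ) * w ^ (1 / 2 : ℝ) with hA
  have hgeo : Summable fun n : ℕ => A * ((n : ℝ) ^ (K + 1) * Real.exp (-(w * δ / 2)) ^ n) := by
    refine (summable_pow_mul_geometric_of_norm_lt_one (K + 1) ?_).mul_left A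
    rw [Real.norm_of_nonneg (Real.exp_pos _).le, Real.exp_lt_one_iff]
    have : 0 < w * δ / 2 := by positivity
    linarith
  refine hgeo.of_norm_bounded_eventually_nat ?_
  filter_upwards [hev, hev2, eventually_ge_atTop 1] with n h1 h2 hn
  have hn1 : (1 : ℝ) ≤ n := by exact_mod_cast hn
  have hn0 : (0 : ℝ) < n := by linarith
  have hy : (0 : ℝ) < w * δ * n := by positivity
  rw [show 2 * (w * (n : ℝ)) * (δ / 2) = w * δ * n by ring, norm_mul] at h1
  have h3 := hY _ h2
  have hXn : ‖X n‖ ≤ 2 * (Real.exp (w * δ * n / 2) * (w * δ * n) ^ (K / 2 : ℝ)) := by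
    rw [Real.rpow_neg hy.le, neg_div, Real.exp_neg] at h3
    have hE : 0 < Real.exp (w * δ * n / 2) * (w * δ * n) ^ (K / 2 : ℝ) := by positivity
    rw [← mul_inv] at h3
    have h4 : ‖X n‖ * (1 / 2 * (Real.exp (w * δ * n / 2) * (w * δ * n) ^ (K / 2 : ℝ))⁻¹) ≤ 1 :=
      (mul_le_mul_of_nonneg_left h3 (norm_nonneg _)).trans h1.le
    rw [← mul_assoc, mul_inv_le_iff₀ hE] at h4
    linarith
  rw [norm_mul, norm_norm, norm_mul, Real.norm_of_nonneg (Real.exp_pos _).le,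
    Complex.norm_cpow_eq_rpow_re_of_pos (by positivity)]
  have ere : (Complex.I * R + 1 / 2 : ℂ).re = 1 / 2 := by simp
  rw [ere]
  calc ‖X n‖ * (w * n) ^ (1 / 2 : ℝ) * Real.exp (-(w * n * δ))
      ≤ (2 * (Real.exp (w * δ * n / 2) * (w * δ * n) ^ (K / 2 : ℝ))) * (w * n) ^ (1 / 2 : ℝ) *
        Real.exp (-(w * n * δ)) := by gcongr
    _ = A * ((n : ℝ) ^ (K / 2 : ℝ) * (n : ℝ) ^ (1 / 2 : ℝ)) *
        (Real.exp (w * δ * n / 2) * Real.exp (-(w * n * δ))) := by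
        rw [Real.mul_rpow (by positivity) hn0.le, Real.mul_rpow hw.le hn0.le, hA]; ring
    _ = A * (n : ℝ) ^ (K / 2 + 1 / 2 : ℝ) * Real.exp (-(w * δ / 2)) ^ n := by
        rw [← Real.rpow_add hn0, ← Real.exp_add, ← Real.exp_nat_mul]
        congr 2
        ring
    _ ≤ A * (n : ℝ) ^ (K + 1) * Real.exp (-(w * δ / 2)) ^ n := by
        rw [← Real.rpow_natCast (n : ℝ) (K + 1)]
        have : (n : ℝ) ^ (K / 2 + 1 / 2 : ℝ) ≤ (n : ℝ) ^ ((K + 1 : ℕ) : ℝ) :=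
          Real.rpow_le_rpow_of_exponent_le hn1 (by push_cast; linarith)
        gcongr
    _ = _ := by ring

/-- The weight factor $P/|P|$ is not holomorphic, but this form of it is, once $P$ and its conjugate
become independent variables. -/
theorem cpow_half_div_conj {P : ℂ} (hP : 0 < P.re) :
    P ^ (1 / 2 : ℂ) / ((starRingEnd ℂ) P) ^ (1 / 2 : ℂ) = P / ‖P‖ := by
  have hP0 : P ≠ 0 := by rintro rfl; simp at hP
  have harg : P.arg ≠ Real.pi := fun h => by
    have := Complex.arg_eq_pi_iff.mp h
    linarith [this.1]
  have hconj : ((starRingEnd ℂ) P) ^ (1 / 2 : ℂ) = (starRingEnd ℂ) (P ^ (1 / 2 : ℂ)) := by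
    rw [Complex.conj_cpow _ _ harg]
    simp [Complex.conj_ofNat]
  set u : ℂ := P ^ (1 / 2 : ℂ) with hu
  have hu2 : u * u = P := by
    rw [hu, ← Complex.cpow_add _ _ hP0]; norm_num
  have hu0 : u ≠ 0 := by
    intro h; rw [h] at hu2; simp at hu2; exact hP0 hu2.symm
  have hn : (‖P‖ : ℂ) = u * (starRingEnd ℂ) u := by
    rw [Complex.mul_conj, Complex.normSq_eq_norm_sq, ← hu2, norm_mul]
    push_cast; ring
  have hcu : (starRingEnd ℂ) u ≠ 0 := by simpa using hu0
  rw [hconj, hn]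
  conv_rhs => rw [← hu2]
  field_simp

/-- A function with a one-sided Fourier expansion of the non-holomorphic kind that transforms like a
form of weight `K` under the inversion vanishes. -/
theorem one_sided_eq_zero {K : ℕ} {R : ℝ} (hR : R ≠ 0) {w : ℝ} (hw : 0 < w)
    {X : ℕ → ℂ} (hX0 : X 0 = 0) {g : ℍ → ℂ}
    (hg : ∀ z : ℍ, HasSum (fun n : ℕ => X n *
      whittakerW ((-(K / 2 : ℝ) : ℝ) : ℂ) (Complex.I * R) (2 * (w * n) * z.im) *
        Complex.exp (-(Complex.I * (w * n : ℝ) * z.re))) (g z))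
    (hS : ∀ z : ℍ, g (ModularGroup.S • z) = ((z : ℂ) / (Complex.I * ‖(z : ℂ)‖)) ^ K * g z) : X = 0 := by
  have hK : (0 : ℝ) ≤ K := K.cast_nonneg
  set a : ℂ := (K + 1) / 2 + Complex.I * R with ha
  set c : ℂ := (K + 1) / 2 - Complex.I * R with hc
  set σ : ℂ := 1 / 2 - Complex.I * R with hσ
  set b : ℕ → ℂ := fun n => X n * ((w * n : ℝ) : ℂ) ^ (Complex.I * R + 1 / 2) with hb
  have ha0 : 0 < a.re := by simp [ha]; positivity
  have hc0 : 0 < c.re := by simp [hc]; positivity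
  have hG : Complex.Gamma a ≠ 0 := Complex.Gamma_ne_zero_of_re_pos ha0
  have hb0 : b 0 = 0 := by simp [hb, hX0]
  have hsum : ∀ δ > 0, Summable fun n : ℕ => ‖b n‖ * Real.exp (-(w * n * δ)) := by
    intro δ hδ
    refine summable_norm_mul_exp K hR hw (fun y hy => ?_) hδ
    -- On the imaginary axis the exponentials are $1$, leaving the bare Whittaker series.
    have := (hg ⟨Complex.I * y, by simpa using hy⟩).summable
    simpa [UpperHalfPlane.im, UpperHalfPlane.re] using this
  have hΦ := isDecaying_dirichletSum hw hb0 hsum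
  have hrep : ∀ z : ℍ, Complex.Gamma a * g z = ((2 * z.im : ℝ) : ℂ) ^ σ *
      stieltjesInt (dirichletSum w b) a c (z.im + Complex.I * z.re) (2 * z.im : ℝ) := by
    intro z
    have hz := z.im_pos
    have h1 := (hasSum_stieltjesInt hw hb0 hsum ha0 hc0.le (Q := z.im + Complex.I * z.re)
      (T := (2 * z.im : ℝ)) (by simpa using hz) (by simpa using hz)).mul_left
        (((2 * z.im : ℝ) : ℂ) ^ σ / Complex.Gamma a)
    have h2 := (hg z).unique (h1.congr_fun fun n => ?_)
    · rw [h2]; field_simp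
    · rcases Nat.eq_zero_or_pos n with rfl | hn
      · simp [hX0, hb0, stieltjesInt, stieltjesKer]
      · have hn0 : (0 : ℝ) < n := by exact_mod_cast hn
        have := whittakerW_mul_exp_eq K hR (show 0 < w * n by positivity) z.re hz (X n)
        rw [this]
        simp only [hb, Complex.ofReal_mul w, Complex.ofReal_natCast]
        rw [ha, hc, hσ]
  have hzero := ae_eq_zero_of_inversion hΦ ha0 hc0 K (σ := σ) (by rw [hc, hσ]; ring) ?_
  · have hb1 := dirichletSum_eq_zero hw hsum hzero
    funext n
    rcases Nat.eq_zero_or_pos n with rfl | hn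
    · exact hX0
    · have hn0 : (0 : ℝ) < n := by exact_mod_cast hn
      have hne : ((w * n : ℝ) : ℂ) ≠ 0 := by exact_mod_cast (by positivity : w * n ≠ 0)
      have := congrFun hb1 n
      simp only [hb, Pi.zero_apply] at this
      refine (mul_eq_zero.mp this).resolve_right fun h => hne ?_
      exact ((Complex.cpow_eq_zero_iff _ _).mp h).1
  · intro x y hy
    set z : ℍ := ⟨x + Complex.I * y, by simpa using hy⟩ with hz
    have hzc : (z : ℂ) = x + Complex.I * y := rfl
    have hre : z.re = x := by simp [UpperHalfPlane.re, hzc]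
    have him : z.im = y := by simp [UpperHalfPlane.im, hzc]
    set P : ℂ := y - Complex.I * x with hP
    set Q : ℂ := y + Complex.I * x with hQ
    have hP0 : 0 < P.re := by simpa [hP] using hy
    have hQ0 : 0 < Q.re := by simpa [hQ] using hy
    have ne0 : ∀ {z : ℂ}, 0 < z.re → z ≠ 0 := by rintro z hz rfl; simp at hz
    have hPn := ne0 hP0
    have hQn := ne0 hQ0
    have hzP : (z : ℂ) = Complex.I * P := by
      rw [hzc, hP, mul_sub, ← mul_assoc, Complex.I_mul_I]; ring
    have hconj : (starRingEnd ℂ) P = Q := by simp [hP, hQ]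
    have hSz : ((ModularGroup.S • z : ℍ) : ℂ) = Complex.I / P := by
      rw [UpperHalfPlane.modular_S_smul]
      change (-(z : ℂ))⁻¹ = _
      rw [hzP, eq_div_iff hPn, inv_mul_eq_iff_eq_mul₀ (by simp [hPn]), neg_mul, mul_right_comm,
        Complex.I_mul_I]
      ring
    have hSQ : ((ModularGroup.S • z : ℍ).im : ℂ) + Complex.I * (ModularGroup.S • z : ℍ).re = 1 / Q := by
      have h1 : ((ModularGroup.S • z : ℍ).im : ℂ) + Complex.I * (ModularGroup.S • z : ℍ).re =
          Complex.I * (starRingEnd ℂ) ((ModularGroup.S • z : ℍ) : ℂ) := by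
        apply Complex.ext <;> simp
      rw [h1, hSz, map_div₀, hconj, Complex.conj_I, mul_div_assoc', mul_neg, Complex.I_mul_I, neg_neg]
    have hSP : ((ModularGroup.S • z : ℍ).im : ℂ) - Complex.I * (ModularGroup.S • z : ℍ).re = 1 / P := by
      have h1 : ((ModularGroup.S • z : ℍ).im : ℂ) - Complex.I * (ModularGroup.S • z : ℍ).re =
          -Complex.I * ((ModularGroup.S • z : ℍ) : ℂ) := by
        apply Complex.ext <;> simp
      rw [h1, hSz, mul_div_assoc', neg_mul, Complex.I_mul_I, neg_neg]
    -- The inversion of $z=iP$ replaces $(P,Q)$ by $(1/P,1/Q)$, and $P+Q$ is twice the imaginary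
    -- part.
    have h2im : ((2 * (ModularGroup.S • z : ℍ).im : ℝ) : ℂ) = 1 / P + 1 / Q := by
      rw [← hSP, ← hSQ]; push_cast; ring
    have h2y : ((2 * z.im : ℝ) : ℂ) = P + Q := by rw [him, hP, hQ]; push_cast; ring
    have r1 := hrep (ModularGroup.S • z)
    have r2 := hrep z
    rw [h2im, hSQ] at r1
    rw [h2y, him, hre, ← hQ] at r2
    rw [inversionLeft, inversionRight, ← r1, ← r2, hS z, ← hconj, cpow_half_div_conj hP0, hzP,
      norm_mul, Complex.norm_I, one_mul, mul_div_mul_left _ _ Complex.I_ne_zero]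
    ring

/-! ### Maass waveforms and their Hecke eigenvalues -/

theorem eta_add_one (z : ℂ) :
    ModularForm.eta (z + 1) = Complex.exp (2 * Real.pi * Complex.I / 24) * ModularForm.eta z := by
  rw [ModularForm.eta, ModularForm.eta, ← mul_assoc]
  congr 1
  · rw [Function.Periodic.qParam, Function.Periodic.qParam, ← Complex.exp_add]
    congr 1
    push_cast; ring
  · refine tprod_congr fun n => ?_
    rw [ModularForm.eta_q_eq_pow, ModularForm.eta_q_eq_pow, mul_add, Complex.exp_add, mul_one,
      Complex.exp_two_pi_mul_I, mul_one]

theorem etaMultiplier_T (k : ℤ) : etaMultiplier k ModularGroup.T = e12 k := by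
  have h0 : ModularForm.eta Complex.I ≠ 0 := ModularForm.eta_ne_zero (by simp [upperHalfPlaneSet])
  have h1 : ((ModularGroup.T • UpperHalfPlane.I : ℍ) : ℂ) = Complex.I + 1 := by
    rw [UpperHalfPlane.modular_T_smul]
    simp [add_comm]
  rw [etaMultiplier, h1, eta_add_one]
  have e : (Complex.exp (2 * Real.pi * Complex.I / 24) * ModularForm.eta Complex.I) ^ 2 /
      ((((ModularGroup.T 1 0 : ℤ) : ℂ) * Complex.I + ((ModularGroup.T 1 1 : ℤ) : ℂ)) *
        ModularForm.eta Complex.I ^ 2) = e12 1 := by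
    simp only [ModularGroup.T, e12, mul_pow]
    rw [← Complex.exp_nat_mul]
    simp only [Matrix.of_apply, Matrix.cons_val_one, Matrix.cons_val_zero, Matrix.cons_val',
      Matrix.cons_val_fin_one, Int.cast_zero, zero_mul, Int.cast_one, zero_add, one_mul]
    rw [mul_div_cancel_right₀ _ (pow_ne_zero 2 h0)]
    congr 1
    push_cast; ring
  rw [e, ← e12_mul, one_mul]

/-- As $S$ fixes $i$, the eta values cancel and the automorphy factor leaves $(1/i)^k$. -/
theorem etaMultiplier_S (k : ℤ) : etaMultiplier k ModularGroup.S = e12 (-3 * k) := by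
  have h0 : ModularForm.eta Complex.I ≠ 0 := ModularForm.eta_ne_zero (by simp [upperHalfPlaneSet])
  have h1 : ((ModularGroup.S • UpperHalfPlane.I : ℍ) : ℂ) = Complex.I := by
    rw [UpperHalfPlane.modular_S_smul]
    simp
  rw [etaMultiplier, h1]
  have e : ModularForm.eta Complex.I ^ 2 /
      ((((ModularGroup.S 1 0 : ℤ) : ℂ) * Complex.I + ((ModularGroup.S 1 1 : ℤ) : ℂ)) *
        ModularForm.eta Complex.I ^ 2) = e12 (-3) := by
    rw [e12_neg, ← I_eq_e12]
    simp only [ModularGroup.S, Matrix.of_apply, Matrix.cons_val_one, Matrix.cons_val_zero,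
      Matrix.cons_val', Matrix.cons_val_fin_one, Int.cast_zero, Int.cast_one, add_zero, one_mul]
    field_simp
  rw [e, ← e12_mul]

theorem autFactor_T (k : ℤ) (z : ℍ) : autFactor k ModularGroup.T z = 1 := by
  simp [autFactor, ModularGroup.T]

theorem autFactor_S (k : ℤ) (z : ℍ) :
    autFactor k ModularGroup.S z = ((z : ℂ) / ‖(z : ℂ)‖) ^ k := by
  have hz : (‖(z : ℂ)‖ : ℂ) ≠ 0 := by
    have := z.ne_zero
    simpa using this
  have h1 : (z : ℂ) / ‖(z : ℂ)‖ = Complex.exp (Complex.arg z * Complex.I) := by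
    rw [div_eq_iff hz, mul_comm]
    exact (Complex.norm_mul_exp_arg_mul_I (z : ℂ)).symm
  rw [h1, ← Complex.exp_int_mul, autFactor]
  simp only [ModularGroup.S, Matrix.of_apply, Matrix.cons_val_one, Matrix.cons_val_zero,
    Matrix.cons_val', Matrix.cons_val_fin_one, Int.cast_zero, Int.cast_one, add_zero, one_mul]
  congr 1
  ring

theorem autJ_S (k : ℤ) (z : ℍ) :
    autJ k (ModularGroup.S : GL (Fin 2) ℝ) z = ((z : ℂ) / ‖(z : ℂ)‖) ^ k := by
  rw [autJ, ModularGroup.denom_apply]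
  simp [ModularGroup.S]

theorem IsMaassWaveform.isAutomorphic {k : ℤ} {R : ℝ} {f : ℍ → ℂ} (hf : IsMaassWaveform k R f) :
    IsAutomorphic k k f where
  continuous := by
    have h1 : Continuous fun z : ℍ => f (ofComplex (z : ℂ)) :=
      hf.contDiffOn.continuousOn.comp_continuous UpperHalfPlane.continuous_coe fun z => z.im_pos
    simpa using h1
  map_T z := by
    have := hf.slash_eq ModularGroup.T z
    rwa [autFactor_T, inv_one, one_mul, etaMultiplier_T] at this
  map_S z := by
    have h1 := hf.slash_eq ModularGroup.S z
    have h2 : autFactor k ModularGroup.S z ≠ 0 := Complex.exp_ne_zero _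
    rw [inv_mul_eq_iff_eq_mul₀ h2, etaMultiplier_S, autFactor_S] at h1
    rw [h1, autJ_S]
    ring

theorem IsMaassWaveform.isL2 {k : ℤ} {R : ℝ} {f : ℍ → ℂ} (hf : IsMaassWaveform k R f) : IsL2 f := by
  have h1 := (hf.square_integrable.mono_set ModularGroup.fdo_subset_fd)
  rw [IsL2, memLp_two_iff_integrable_sq_norm hf.isAutomorphic.continuous.aestronglyMeasurable]
  exact h1

theorem IsGood.conj_e12 {k : ℤ} {m : ℕ} (h : IsGood k m) (d : ℕ) (hd : d ∣ m) :
    (starRingEnd ℂ) (e12 (3 * (k * (d - 1)))) = chi k d := by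
  rw [MaassEta.conj_e12, chi_eq]
  refine e12_congr ?_
  have hd' : IsGood k d := ⟨h.1.imp id fun h3 h' => h3 (h'.trans (by exact_mod_cast hd)),
    h.2.imp id fun h3 h' => h3 (h'.trans (by exact_mod_cast hd))⟩
  obtain ⟨t, ht⟩ := hd'.four_dvd_two
  exact ⟨-t, by linear_combination -3 * ht⟩

theorem IsGood.conj_e12_mul {k : ℤ} {m : ℕ} (h : IsGood k m) (d : ℕ) (hd : d ∣ m) :
    (starRingEnd ℂ) (e12 (3 * (k * m * (d - 1)))) = chi k d := by
  rw [MaassEta.conj_e12, chi_eq]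
  refine e12_congr ?_
  have hd' : IsGood k d := ⟨h.1.imp id fun h3 h' => h3 (h'.trans (by exact_mod_cast hd)),
    h.2.imp id fun h3 h' => h3 (h'.trans (by exact_mod_cast hd))⟩
  obtain ⟨t, ht⟩ := hd'.four_dvd_two
  obtain ⟨s, hs⟩ := h.four_dvd hd'
  exact ⟨-t - s, by linear_combination -3 * ht - 3 * hs⟩

theorem petersson_const_mul (c : ℂ) (f g : ℍ → ℂ) :
    petersson (fun z => c * f z) g = c * petersson f g := by
  rw [petersson, petersson, ← integral_const_mul]
  simp only [mul_assoc]

theorem petersson_const_mul_right (c : ℂ) (f g : ℍ → ℂ) :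
    petersson f (fun z => c * g z) = (starRingEnd ℂ) c * petersson f g := by
  rw [← petersson_conj, petersson_const_mul, map_mul, petersson_conj]

/-- When $kn\equiv k\pmod{12}$ the class is unchanged and $\chi_k(n)=1$, so $T_n$ is symmetric for
the Petersson product. -/
theorem conj_eigenvalue {k : ℤ} {n : ℕ} [NeZero n] {f : ℍ → ℂ} (hf : IsAutomorphic k k f)
    (h2 : IsL2 f) (hf0 : f ≠ 0) (hgood : IsGood k n) (hn : (12 : ℤ) ∣ k * n - k) {ev : ℂ}
    (hev : ∀ z, heckeT k n f z = ev * f z) : (starRingEnd ℂ) ev = ev := by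
  have hkn : e12 (k * n) = e12 k := e12_congr hn
  have hg : IsAutomorphic k (k * n) f := by
    refine ⟨hf.continuous, fun z => by rw [hkn, hf.map_T], fun z => ?_⟩
    obtain ⟨t, ht⟩ := hn
    rw [hf.map_S, e12_congr (s := -3 * k) (t := -3 * (k * n)) ⟨3 * t, by linear_combination 3 * ht⟩]
  have e1 : heckeOp k k n f = fun z => ev * f z := funext hev
  have e2 : heckeOp k (k * n) n f = fun z => ev * f z := by
    rw [← e1]
    funext z
    simp only [heckeOp, xi_eq, hkn]
  have h := petersson_heckeOp hf hg h2 h2 hgood hgood.conj_e12 hgood.conj_e12_mul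
  have hchi : chi k n = 1 := by
    rw [chi_eq]
    obtain ⟨t, ht⟩ := hn
    exact e12_eq_one ⟨3 * t, by linear_combination 3 * ht⟩
  rw [e1, e2, petersson_const_mul, petersson_const_mul_right, hchi, one_mul] at h
  have hne : petersson f f ≠ 0 := fun h0 => hf0 (eq_zero_of_petersson_self hf h2 h0)
  exact (mul_right_cancel₀ hne h).symm

/-- By adjointness $\|T_mf\|^2=\chi(m)\langle f,T_mT_mf\rangle=\chi(m)\overline{\Lambda}\,\|f\|^2$.
-/
theorem ne_zero_of_heckeOp_heckeOp {k : ℤ} {m : ℕ} [NeZero m] {f : ℍ → ℂ} (hf : IsAutomorphic k k f)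
    (h2 : IsL2 f) (hgood : IsGood k m) {Λ : ℂ}
    (hΛ : heckeOp k (k * m) m (heckeOp k k m f) = fun z => Λ * f z) (h0 : heckeOp k k m f ≠ 0) :
    Λ ≠ 0 := by
  rintro rfl
  have hg := isAutomorphic_heckeOp hf hgood hgood.conj_e12
  have hg2 := isL2_heckeOp hf h2 hgood hgood.conj_e12
  have h := petersson_heckeOp hf hg h2 hg2 hgood hgood.conj_e12 hgood.conj_e12_mul
  rw [hΛ, petersson_const_mul_right, map_zero, zero_mul, mul_zero] at h
  exact h0 (eq_zero_of_petersson_self hg hg2 h)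

/-! ### Hecke relations on coefficients -/

/-- $N$ and $r$ are the denominator and numerator of $k/12$ in lowest terms. That $r$ is prime to
$N$ is essential: it makes $T_{|r|}$ available. -/
theorem exists_level {k : ℤ} (hk : ¬ (12 : ℤ) ∣ k) : ∃ (N : ℕ) (r : ℤ), 1 < N ∧ N ∣ 12 ∧
    12 * r = N * k ∧ r.natAbs.Coprime N ∧ ∀ a : ℕ, a.Coprime N → IsGood k a := by
  obtain ⟨g, hg⟩ : ∃ g : ℕ, g = Int.gcd k 12 := ⟨_, rfl⟩
  have hg12 : g ∣ 12 := by rw [hg]; exact_mod_cast Int.gcd_dvd_right k 12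
  have hgk : (g : ℤ) ∣ k := by rw [hg]; exact Int.gcd_dvd_left k 12
  have hg0 : 0 < g := Nat.pos_of_dvd_of_pos hg12 (by norm_num)
  obtain ⟨N, hN⟩ := hg12
  obtain ⟨r, hr⟩ := hgk
  have hcop : r.natAbs.Coprime N := by
    have h1 := Int.gcd_mul_left (g : ℤ) r N
    have h2 : Int.gcd ((g : ℤ) * r) (g * N) = g := by
      rw [← hr, show ((g : ℤ) * N) = 12 by exact_mod_cast hN.symm, hg]
    rw [h2] at h1
    have h3 : g * 1 = g * Int.gcd r N := by simpa using h1
    exact (Nat.eq_of_mul_eq_mul_left hg0 h3).symm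
  refine ⟨N, r, ?_, ⟨g, by rw [hN, mul_comm]⟩, ?_, hcop, fun a ha => ⟨?_, ?_⟩⟩
  · rcases Nat.lt_or_ge 1 N with h | h
    · exact h
    · interval_cases N
      · omega
      · exact absurd ⟨r, by rw [hr]; congr 1; omega⟩ hk
  · have : (12 : ℤ) = g * N := by exact_mod_cast hN
    rw [this, hr]; ring
  · by_cases h3 : (3 : ℤ) ∣ a
    · left
      have h3' : 3 ∣ a := by exact_mod_cast h3
      have hc : Nat.Coprime 3 N := Nat.Coprime.coprime_dvd_left h3' ha
      have : 3 ∣ g := hc.dvd_of_dvd_mul_right (hN ▸ by norm_num)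
      rw [hr]
      exact Dvd.dvd.mul_right (by exact_mod_cast this) r
    · exact Or.inr h3
  · by_cases h2 : (2 : ℤ) ∣ a
    · left
      have h2' : 2 ∣ a := by exact_mod_cast h2
      have hc : Nat.Coprime 4 N := by
        have : Nat.Coprime 2 N := Nat.Coprime.coprime_dvd_left h2' ha
        exact Nat.Coprime.pow_left 2 this
      have : 4 ∣ g := hc.dvd_of_dvd_mul_right (hN ▸ by norm_num)
      rw [hr]
      exact Dvd.dvd.mul_right (by exact_mod_cast this) r
    · exact Or.inr h2

section

variable {N : ℕ} {ψ : ℕ → ℂ} {m : ℕ}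

/-- Since $\psi$ is real, the operator commutes with conjugation of the coefficients. -/
theorem heckeCoeff_sub_conj (hψ : IsQuadratic N ψ) (hm : m.Coprime N) (α : ℂ) (x : ℤ → ℂ) (q : ℤ) :
    heckeCoeff ψ m (fun q => α * x q - (starRingEnd ℂ) (α * x q)) q =
      α * heckeCoeff ψ m x q - (starRingEnd ℂ) (α * heckeCoeff ψ m x q) := by
  rw [heckeCoeff, heckeCoeff, Finset.mul_sum, map_sum, ← Finset.sum_sub_distrib]
  refine Finset.sum_congr rfl fun a ha => ?_
  have hd : a ∣ m := Nat.dvd_of_mem_divisors (Finset.mem_filter.mp ha).1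
  have hr := hψ.real (m / a) (Nat.Coprime.coprime_dvd_left (Nat.div_dvd_of_dvd hd) hm)
  simp only [map_mul, hr]
  ring

theorem heckeCoeff_unit (hm0 : 0 < m) (x : ℤ → ℂ) {s : ℤ} (hs : s.natAbs = 1) :
    heckeCoeff ψ m x s = ψ m * x (m * s) := by
  have : (m.divisors.filter fun a : ℕ => (a : ℤ) ∣ s) = {1} := by
    ext a
    simp only [Finset.mem_filter, Nat.mem_divisors, Finset.mem_singleton]
    constructor
    · rintro ⟨-, h⟩
      have := Int.natAbs_dvd_natAbs.mpr h
      rw [hs, Int.natAbs_natCast] at this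
      exact Nat.dvd_one.mp this
    · rintro rfl
      exact ⟨⟨one_dvd _, hm0.ne'⟩, by simp⟩
  rw [heckeCoeff, this, Finset.sum_singleton]
  simp

/-- Passing from $(m/a)(q/a)$ to $q$ multiplies the class by $m$, because $a^2$ and $(m/a)^2$ are
$\equiv1\pmod N$. -/
theorem dvd_sub_of_heckeCoeff_ne_zero (hsq : ∀ a : ℕ, a.Coprime N → (N : ℤ) ∣ (a : ℤ) ^ 2 - 1)
    (hm : m.Coprime N) {x : ℤ → ℂ} {r : ℤ} (hx : ∀ q, x q ≠ 0 → (N : ℤ) ∣ q - r) {q : ℤ}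
    (hq : heckeCoeff ψ m x q ≠ 0) : (N : ℤ) ∣ q - r * m := by
  obtain ⟨a, ha, hne⟩ := Finset.exists_ne_zero_of_sum_ne_zero hq
  obtain ⟨ha1, b, rfl⟩ := Finset.mem_filter.mp ha
  obtain ⟨n, rfl⟩ := Nat.dvd_of_mem_divisors ha1
  have ha0 : 0 < a := Nat.pos_of_mem_divisors ha1
  have ha0' : (a : ℤ) ≠ 0 := by exact_mod_cast ha0.ne'
  rw [Nat.mul_div_cancel_left _ ha0, Int.mul_ediv_cancel_left _ ha0'] at hne
  obtain ⟨t, ht⟩ := hx _ (right_ne_zero_of_mul hne)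
  obtain ⟨u, hu⟩ := hsq a (Nat.Coprime.coprime_mul_right hm)
  obtain ⟨v, hv⟩ := hsq n (Nat.Coprime.coprime_mul_left hm)
  refine ⟨n * a * t - a * b * v, ?_⟩
  push_cast
  linear_combination (n * a : ℤ) * ht - (a * b : ℤ) * hv

/-- A common eigenvector of the Hecke operators whose coefficient at `r` vanishes has no
coefficients on the side of `r`. -/
theorem coeff_eq_zero_of_side (hψ : IsQuadratic N ψ)
    (hsq : ∀ a : ℕ, a.Coprime N → (N : ℤ) ∣ (a : ℤ) ^ 2 - 1)
    (hψ1 : ∀ n : ℕ, (N : ℤ) ∣ n - 1 → ψ n = 1) {D : ℤ → ℂ} {r : ℤ} (hr : r ≠ 0)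
    (hcop : r.natAbs.Coprime N) (hD : ∀ q, D q ≠ 0 → (N : ℤ) ∣ q - r) {lam : ℕ → ℂ}
    (hT : ∀ n : ℕ, 0 < n → (N : ℤ) ∣ n - 1 → ∀ q, heckeCoeff ψ n D q = lam n * D q)
    (hDr : D r = 0)
    (hΛ : ∑ e ∈ r.natAbs.divisors, ψ e * lam ((r.natAbs / e) ^ 2) ≠ 0) {q : ℤ} (hq : 0 < q * r) :
    D q = 0 := by
  set m := r.natAbs with hm
  have hm0 : 0 < m := Int.natAbs_pos.mpr hr
  have hE : ∀ q : ℤ, 0 < q * r → heckeCoeff ψ m D q = 0 := by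
    intro q hq
    by_contra hne
    have h1 := dvd_sub_of_heckeCoeff_ne_zero hsq hcop hD hne
    set n := q.natAbs with hn
    have hq0 : q ≠ 0 := by rintro rfl; simp at hq
    have hn0 : 0 < n := Int.natAbs_pos.mpr hq0
    obtain ⟨s, hs, hs1, hqs, hrs⟩ : ∃ s : ℤ, s.natAbs = 1 ∧ s * s = 1 ∧ q = s * n ∧ r = s * m := by
      rcases lt_or_gt_of_ne hr with h | h
      · have : q < 0 := by nlinarith
        exact ⟨-1, rfl, by norm_num, by omega, by omega⟩
      · have : 0 < q := by nlinarith
        exact ⟨1, rfl, by norm_num, by omega, by omega⟩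
    -- From $q\equiv rm$ with $q=sn$, $r=sm$ and $m^2\equiv1$: so $T_n$ is one of the operators with
    -- $D$ as eigenvector.
    have hn1 : (N : ℤ) ∣ n - 1 := by
      obtain ⟨u, hu⟩ := hsq m hcop
      obtain ⟨t, ht⟩ := h1
      refine ⟨s * t + u, ?_⟩
      rw [hqs, hrs] at ht
      linear_combination s * ht + hu - (n - m * m : ℤ) * hs1
    have hnc : n.Coprime N := by
      obtain ⟨t, ht⟩ := hn1
      have : IsCoprime (n : ℤ) (N : ℤ) := ⟨1, -t, by linear_combination ht⟩
      exact Nat.isCoprime_iff_coprime.mp this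
    have h2 := hT n hn0 hn1 r
    rw [hDr, mul_zero] at h2
    -- Both sums run over the common divisors $a$ of $m$ and $n$ and evaluate $D$ at the same points
    -- $s(m/a)(n/a)$. The characters agree because $\psi(a)\psi(n/a)=\psi(n)=1$ gives
    -- $\psi(m/a)=\psi(m)\psi(n/a)$.
    have h3 : heckeCoeff ψ m D q = ψ m * heckeCoeff ψ n D r := by
      rw [heckeCoeff, heckeCoeff, Finset.mul_sum]
      have hset : (m.divisors.filter fun a : ℕ => (a : ℤ) ∣ q) =
          n.divisors.filter fun a : ℕ => (a : ℤ) ∣ r := by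
        ext a
        simp only [Finset.mem_filter, Nat.mem_divisors, Int.natCast_dvd, ← hm, ← hn]
        constructor
        · rintro ⟨⟨h1, -⟩, h2⟩; exact ⟨⟨h2, hn0.ne'⟩, h1⟩
        · rintro ⟨⟨h1, -⟩, h2⟩; exact ⟨⟨h2, hm0.ne'⟩, h1⟩
      rw [hset]
      refine Finset.sum_congr rfl fun a ha => ?_
      simp only [Finset.mem_filter, Nat.mem_divisors, Int.natCast_dvd, ← hm] at ha
      obtain ⟨⟨⟨n', hn'⟩, -⟩, ⟨m', hm'⟩⟩ := ha
      have ha0 : 0 < a := Nat.pos_of_ne_zero fun h => by rw [h, zero_mul] at hn'; omega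
      have ha0' : (a : ℤ) ≠ 0 := by exact_mod_cast ha0.ne'
      have eq1 : q / (a : ℤ) = s * n' := by
        rw [hqs, hn']; push_cast
        rw [show s * ((a : ℤ) * n') = a * (s * n') by ring, Int.mul_ediv_cancel_left _ ha0']
      have eq2 : r / (a : ℤ) = s * m' := by
        rw [hrs, hm']; push_cast
        rw [show s * ((a : ℤ) * m') = a * (s * m') by ring, Int.mul_ediv_cancel_left _ ha0']
      have en : n / a = n' := by rw [hn', Nat.mul_div_cancel_left _ ha0]
      have em : m / a = m' := by rw [hm', Nat.mul_div_cancel_left _ ha0]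
      have ca : a.Coprime N := by rw [hn'] at hnc; exact Nat.Coprime.coprime_mul_right hnc
      have cn : n'.Coprime N := by rw [hn'] at hnc; exact Nat.Coprime.coprime_mul_left hnc
      have cm : m'.Coprime N := by
        have := hcop; rw [hm'] at this; exact Nat.Coprime.coprime_mul_left this
      rw [en, em, eq1, eq2]
      have p1 : ψ a * ψ n' = 1 := by rw [← hψ.map_mul a n' ca cn, ← hn']; exact hψ1 n hn1
      have p2 : ψ m = ψ a * ψ m' := by rw [← hψ.map_mul a m' ca cm, ← hm']
      rw [p2, show (m' : ℤ) * (s * n') = n' * (s * m') by ring]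
      linear_combination -(ψ m' * D (n' * (s * m'))) * p1
    exact hne (by rw [h3, h2, mul_zero])
  -- Applying $T_m$ once more stays on the same side, so $T_m^2D$ vanishes at $q$; it also equals
  -- the nonzero scalar of `hΛ` times $D(q)$.
  have h1 := heckeCoeff_heckeCoeff hψ hcop hm0 D q
  have h2 : heckeCoeff ψ m (heckeCoeff ψ m D) q = 0 := by
    rw [heckeCoeff]
    refine Finset.sum_eq_zero fun a ha => ?_
    obtain ⟨ha1, b, rfl⟩ := Finset.mem_filter.mp ha
    have ha0 : 0 < a := Nat.pos_of_mem_divisors ha1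
    have hma : 0 < m / a := Nat.div_pos (Nat.divisor_le ha1) ha0
    have ha0' : (0 : ℤ) < a := by exact_mod_cast ha0
    have hma' : (0 : ℤ) < ((m / a : ℕ) : ℤ) := by exact_mod_cast hma
    rw [Int.mul_ediv_cancel_left _ ha0'.ne', hE _ ?_, mul_zero]
    have : 0 < (a : ℤ) * (b * r) := by rw [← mul_assoc]; exact hq
    have hbr : 0 < b * r := pos_of_mul_pos_right this ha0'.le
    rw [mul_assoc]
    exact mul_pos hma' hbr
  rw [h2] at h1
  have h3 : (∑ e ∈ m.divisors, ψ e * lam ((m / e) ^ 2)) * D q = 0 := by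
    rw [h1, Finset.sum_mul]
    refine Finset.sum_congr rfl fun e he => ?_
    have hed := Nat.dvd_of_mem_divisors he
    have hpos : 0 < m / e := Nat.div_pos (Nat.divisor_le he) (Nat.pos_of_mem_divisors he)
    rw [hT ((m / e) ^ 2) (by positivity) (by
      have := hsq (m / e) (Nat.Coprime.coprime_dvd_left (Nat.div_dvd_of_dvd hed) hcop)
      exact_mod_cast this), mul_assoc]
  exact (mul_eq_zero.mp h3).resolve_left hΛ

end

/-! ### Fourier expansions with Whittaker functions -/

/-- The Whittaker function of a Fourier expansion with frequencies in `ℤ / N`. -/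
def whittakerFun (k : ℤ) (N : ℕ) (R : ℝ) (t : ℝ) : ℂ :=
  ((Real.sqrt N : ℝ) : ℂ) * whittakerW (((k : ℝ) / 2 * Real.sign t : ℝ) : ℂ) (Complex.I * R)
    (4 * Real.pi * |t| / N)

theorem sign_mul_of_pos (q : ℝ) {y : ℝ} (hy : 0 < y) : Real.sign (q * y) = Real.sign q := by
  rcases lt_trichotomy q 0 with h | h | h
  · rw [Real.sign_of_neg h, Real.sign_of_neg (mul_neg_of_neg_of_pos h hy)]
  · rw [h, zero_mul]
  · rw [Real.sign_of_pos h, Real.sign_of_pos (mul_pos h hy)]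

theorem conj_whittakerFun (k : ℤ) {N : ℕ} (hN : 0 < N) (R : ℝ) {t : ℝ} (ht : t ≠ 0) :
    (starRingEnd ℂ) (whittakerFun k N R t) = whittakerFun k N R t := by
  have hN' : (0 : ℝ) < N := by exact_mod_cast hN
  have : 0 < 4 * Real.pi * |t| / N := by have := abs_pos.mpr ht; positivity
  rw [whittakerFun, map_mul, Complex.conj_ofReal, conj_whittakerW _ _ this]

theorem exists_whittakerFun_ne_zero (k : ℤ) {N : ℕ} (hN : 0 < N) {R : ℝ} (hR : R ≠ 0) {q : ℤ}
    (hq : q ≠ 0) : ∃ t : ℝ, 0 < t ∧ whittakerFun k N R (q * t) ≠ 0 := by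
  obtain ⟨y, hy, h⟩ := exists_whittakerW_ne_zero ((k : ℝ) / 2 * Real.sign q) hR
  have hN' : (0 : ℝ) < N := by exact_mod_cast hN
  have hq' : 0 < |(q : ℝ)| := abs_pos.mpr (by exact_mod_cast hq)
  have ht : 0 < y * N / (4 * Real.pi * |(q : ℝ)|) := by positivity
  refine ⟨y * N / (4 * Real.pi * |(q : ℝ)|), ht, ?_⟩
  rw [whittakerFun, sign_mul_of_pos _ ht, abs_mul, abs_of_pos ht,
    show 4 * Real.pi * (|(q : ℝ)| * (y * N / (4 * Real.pi * |(q : ℝ)|))) / N = y by field_simp]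
  refine mul_ne_zero ?_ h
  have : Real.sqrt N ≠ 0 := (Real.sqrt_pos.mpr hN').ne'
  exact_mod_cast this

/-- The factor $\sqrt N$ in `whittakerFun` compensates for $|\nu|^{-1/2}=\sqrt N\,|q|^{-1/2}$. -/
theorem fourierTerm_eq_expTerm {k r : ℤ} {N : ℕ} (hN : 0 < N) (hr : 12 * r = N * k) (R : ℝ) (n : ℤ)
    (z : ℍ) : fourierTerm k R n z = expTerm N (whittakerFun k N R) (N * n + r) z := by
  have hN' : (0 : ℝ) < N := by exact_mod_cast hN
  have hr' : 12 * (r : ℝ) = N * k := by exact_mod_cast hr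
  have hy := z.im_pos
  set Q : ℝ := ((N * n + r : ℤ) : ℝ) with hQ
  have hν : (n : ℝ) + (k : ℝ) / 12 = Q * (1 / N) := by
    rw [hQ]; push_cast; field_simp; linear_combination -hr'
  rw [fourierTerm, expTerm, whittakerFun]
  rw [hν, sign_mul_of_pos _ (by positivity), sign_mul_of_pos _ hy, abs_mul, abs_mul,
    abs_of_pos (show (0 : ℝ) < 1 / N by positivity), abs_of_pos hy, Real.sqrt_mul (abs_nonneg _),
    Real.sqrt_div zero_le_one, Real.sqrt_one, ← hQ,
    show 4 * Real.pi * (|Q| * (1 / N)) * z.im = 4 * Real.pi * (|Q| * z.im) / N by ring,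
    show Q * (1 / N) * z.re = Q * z.re / N by ring,
    show 1 / (Real.sqrt |Q| * (1 / Real.sqrt N)) = 1 / Real.sqrt |Q| * Real.sqrt N by
      rw [one_div, mul_inv, one_div, one_div, inv_inv]]
  push_cast
  ring

/-- The coefficients of a Fourier expansion, indexed by the numerators of the frequencies. -/
def numCoeff (N : ℕ) (r : ℤ) (c : ℤ → ℂ) (q : ℤ) : ℂ :=
  if (N : ℤ) ∣ q - r then c ((q - r) / N) else 0

theorem numCoeff_apply {N : ℕ} (hN : 0 < N) (r : ℤ) (c : ℤ → ℂ) (n : ℤ) :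
    numCoeff N r c (N * n + r) = c n := by
  have : (N : ℤ) ≠ 0 := by exact_mod_cast hN.ne'
  rw [numCoeff, add_sub_cancel_right, if_pos (dvd_mul_right _ _), Int.mul_ediv_cancel_left _ this]

theorem dvd_of_numCoeff_ne_zero {N : ℕ} {r : ℤ} {c : ℤ → ℂ} (q : ℤ) (h : numCoeff N r c q ≠ 0) :
    (N : ℤ) ∣ q - r := by
  by_contra hd
  exact h (if_neg hd)

theorem HasFourierCoeffs.hasSum_expTerm {k r : ℤ} {N : ℕ} (hN : 0 < N) (hr : 12 * r = N * k) {R : ℝ}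
    {f : ℍ → ℂ} {c : ℤ → ℂ} (hc : HasFourierCoeffs k R f c) (z : ℍ) :
    HasSum (fun q => numCoeff N r c q * expTerm N (whittakerFun k N R) q z) (f z) := by
  have hN' : (N : ℤ) ≠ 0 := by exact_mod_cast hN.ne'
  have hinj : Function.Injective fun n : ℤ => (N : ℤ) * n + r := fun a b h =>
    mul_left_cancel₀ hN' (add_right_cancel h)
  refine (hinj.hasSum_iff fun q hq => ?_).mp ?_
  · rw [numCoeff, if_neg, zero_mul]
    rintro ⟨n, hn⟩
    exact hq ⟨n, by simp only; linear_combination -hn⟩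
  · refine (hc z).congr_fun fun n => ?_
    simp only [Function.comp]
    rw [numCoeff_apply hN, fourierTerm_eq_expTerm hN hr]

/-! ### The reflection and one-sided Whittaker expansions -/

/-- The reflection `z ↦ -z̄` of the upper half-plane. -/
def reflection (z : ℍ) : ℍ := ⟨-(starRingEnd ℂ) (z : ℂ), by simpa using z.im_pos⟩

theorem coe_reflection (z : ℍ) : (reflection z : ℂ) = -(starRingEnd ℂ) (z : ℂ) := rfl

theorem im_reflection (z : ℍ) : (reflection z).im = z.im := by
  rw [← coe_im, coe_reflection]; simp

theorem re_reflection (z : ℍ) : (reflection z).re = -z.re := by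
  rw [← coe_re, coe_reflection]; simp

theorem reflection_S (z : ℍ) : reflection (ModularGroup.S • z) = ModularGroup.S • reflection z := by
  apply UpperHalfPlane.ext
  rw [coe_reflection, UpperHalfPlane.modular_S_smul, UpperHalfPlane.modular_S_smul]
  simp [coe_reflection, inv_neg]

/-- A real radial profile makes each term invariant under reflection followed by conjugation, so
$\overline{f(-\bar z)}$ has the conjugate coefficients. -/
theorem conj_expTerm_reflection {N : ℕ} {w : ℝ → ℂ}
    (hw : ∀ t, t ≠ 0 → (starRingEnd ℂ) (w t) = w t) {q : ℤ} (hq : q ≠ 0) (z : ℍ) :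
    (starRingEnd ℂ) (expTerm N w q (reflection z)) = expTerm N w q z := by
  have hy := z.im_pos
  have h0 : (q : ℝ) * z.im ≠ 0 := mul_ne_zero (by exact_mod_cast hq) hy.ne'
  rw [expTerm, expTerm, map_mul, map_mul, Complex.conj_ofReal, im_reflection, re_reflection, hw _ h0,
    ← Complex.exp_conj]
  congr 2
  simp only [map_mul, Complex.conj_ofReal, Complex.conj_I, map_ofNat]
  push_cast
  ring

theorem expTerm_whittakerFun {k : ℤ} {N : ℕ} (hN : 0 < N) (R : ℝ) {q : ℤ} (hq : q * k < 0) {z : ℍ} :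
    expTerm N (whittakerFun k N R) q z =
      ((Real.sqrt N / Real.sqrt q.natAbs : ℝ) : ℂ) *
        whittakerW ((-((k.natAbs : ℕ) / 2 : ℝ) : ℝ) : ℂ) (Complex.I * R)
          (2 * (2 * Real.pi / N * q.natAbs) * z.im) *
        Complex.exp (2 * Real.pi * Complex.I * ((q * z.re / N : ℝ) : ℂ)) := by
  have hN' : (0 : ℝ) < N := by exact_mod_cast hN
  have hy := z.im_pos
  have e1 : (k : ℝ) / 2 * Real.sign (q * z.im) = -((k.natAbs : ℕ) / 2 : ℝ) := by
    rw [sign_mul_of_pos _ hy, Nat.cast_natAbs, Int.cast_abs]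
    rcases lt_trichotomy q 0 with h | h | h
    · have hk : 0 < k := by nlinarith
      rw [Real.sign_of_neg (by exact_mod_cast h), abs_of_pos (by exact_mod_cast hk)]
      ring
    · simp [h] at hq
    · have hk : k < 0 := by nlinarith
      rw [Real.sign_of_pos (by exact_mod_cast h), abs_of_neg (by exact_mod_cast hk)]
      ring
  have e2 : |(q : ℝ)| = (q.natAbs : ℕ) := by rw [Nat.cast_natAbs, Int.cast_abs]
  rw [expTerm, whittakerFun, e1, abs_mul, abs_of_pos hy, e2,
    show 4 * Real.pi * ((q.natAbs : ℕ) * z.im) / N = 2 * (2 * Real.pi / N * (q.natAbs : ℕ)) * z.im by ring]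
  push_cast
  ring

/-- A signed form of `one_sided_eq_zero`, whose frequencies are negative and whose weight is $|k|$.
For $k<0$ the surviving frequencies are positive, and reflection reverses both signs. -/
theorem one_sided_expTerm {k : ℤ} (hk : k ≠ 0) {N : ℕ} (hN : 0 < N) {R : ℝ} (hR : R ≠ 0) {D : ℤ → ℂ}
    {h : ℍ → ℂ} (hsum : ∀ z, HasSum (fun q => D q * expTerm N (whittakerFun k N R) q z) (h z))
    (hS : ∀ z : ℍ, h (ModularGroup.S • z) = ((z : ℂ) / (Complex.I * ‖(z : ℂ)‖)) ^ k * h z)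
    (hD : ∀ q, 0 ≤ q * k → D q = 0) (q : ℤ) : D q = 0 := by
  have hN' : (0 : ℝ) < N := by exact_mod_cast hN
  have hw : 0 < 2 * Real.pi / N := by positivity
  have hfin : ∀ (s : ℤ) (n : ℕ), s.natAbs = 1 → n ≠ 0 →
      ((Real.sqrt N / Real.sqrt n : ℝ) : ℂ) * D (s * n) = 0 → D (s * n) = 0 := by
    intro s n _ hn h
    refine (mul_eq_zero.mp h).resolve_left ?_
    have : (0 : ℝ) < n := by exact_mod_cast Nat.pos_of_ne_zero hn
    exact Complex.ofReal_ne_zero.mpr (by positivity)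
  by_cases hq : 0 ≤ q * k
  · exact hD q hq
  push Not at hq
  have hD0 : D 0 = 0 := hD 0 (by simp)
  rcases lt_or_gt_of_ne hk with hk0 | hk0
  · have hX := one_sided_eq_zero (K := k.natAbs) hR hw
      (X := fun n : ℕ => ((Real.sqrt N / Real.sqrt n : ℝ) : ℂ) * D n) (by simp)
      (g := fun z => h (reflection z)) ?_ ?_
    · have hq0 : 0 < q := by nlinarith
      have h1 := congrFun hX q.natAbs
      simp only [Pi.zero_apply] at h1
      have h2 := hfin 1 q.natAbs rfl (Int.natAbs_ne_zero.mpr hq0.ne') (by simpa using h1)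
      rwa [one_mul, Int.natAbs_of_nonneg hq0.le] at h2
    · intro z
      have hinj : Function.Injective fun n : ℕ => (n : ℤ) := Nat.cast_injective
      have h1 := (hinj.hasSum_iff (fun q hq => by
        rw [hD q, zero_mul]
        have : q < 0 := by
          by_contra hn
          exact hq ⟨q.natAbs, by simp only; omega⟩
        nlinarith)).mpr (hsum (reflection z))
      refine h1.congr_fun fun n => ?_
      simp only [Function.comp]
      rcases Nat.eq_zero_or_pos n with rfl | hn
      · simp [hD0]
      · have hn' : (0 : ℤ) < n := by exact_mod_cast hn
        rw [expTerm_whittakerFun hN R (by nlinarith), im_reflection, re_reflection, Int.natAbs_natCast,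
          show 2 * Real.pi * Complex.I * ((((n : ℤ) : ℝ) * -z.re / N : ℝ) : ℂ) =
            -(Complex.I * ((2 * Real.pi / N * n : ℝ) : ℂ) * z.re) by push_cast; ring]
        ring
    · intro z
      rw [reflection_S, hS, coe_reflection]
      congr 1
      have hz0 : (z : ℂ) ≠ 0 := z.ne_zero
      have hn0 : (‖(z : ℂ)‖ : ℂ) ≠ 0 := by simpa using hz0
      have hc0 : (starRingEnd ℂ) (z : ℂ) ≠ 0 := by simpa using hz0
      rw [norm_neg, RCLike.norm_conj]
      have hkn : k = -((k.natAbs : ℕ) : ℤ) := by omega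
      nth_rewrite 1 [hkn]
      rw [zpow_neg, zpow_natCast, ← inv_pow]
      congr 1
      have hzz : (z : ℂ) * (starRingEnd ℂ) (z : ℂ) = (‖(z : ℂ)‖ : ℂ) * ‖(z : ℂ)‖ := by
        rw [Complex.mul_conj, Complex.normSq_eq_norm_sq]; push_cast; ring
      rw [inv_div, div_eq_div_iff (neg_ne_zero.mpr hc0) (mul_ne_zero Complex.I_ne_zero hn0)]
      linear_combination (‖(z : ℂ)‖ : ℂ) * ‖(z : ℂ)‖ * Complex.I_mul_I + hzz
  · have hX := one_sided_eq_zero (K := k.natAbs) hR hw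
      (X := fun n : ℕ => ((Real.sqrt N / Real.sqrt n : ℝ) : ℂ) * D (-n)) (by simp) (g := h) ?_ ?_
    · have hq0 : q < 0 := by nlinarith
      have h1 := congrFun hX q.natAbs
      simp only [Pi.zero_apply] at h1
      have h2 := hfin (-1) q.natAbs rfl (Int.natAbs_ne_zero.mpr hq0.ne) (by
        rw [neg_one_mul]; exact h1)
      rwa [show -1 * ((q.natAbs : ℕ) : ℤ) = q by omega] at h2
    · intro z
      have hinj : Function.Injective fun n : ℕ => -(n : ℤ) := fun a b hab =>
        Nat.cast_injective (neg_injective hab)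
      have h1 := (hinj.hasSum_iff (fun q hq => by
        rw [hD q, zero_mul]
        have : 0 < q := by
          by_contra hn
          exact hq ⟨q.natAbs, by simp only; omega⟩
        nlinarith)).mpr (hsum z)
      refine h1.congr_fun fun n => ?_
      simp only [Function.comp]
      rcases Nat.eq_zero_or_pos n with rfl | hn
      · simp [hD0]
      · have hn' : (0 : ℤ) < n := by exact_mod_cast hn
        rw [expTerm_whittakerFun hN R (by nlinarith), Int.natAbs_neg, Int.natAbs_natCast,
          show 2 * Real.pi * Complex.I * ((((-(n : ℤ) : ℤ) : ℝ) * z.re / N : ℝ) : ℂ) =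
            -(Complex.I * ((2 * Real.pi / N * n : ℝ) : ℂ) * z.re) by push_cast; ring]
        ring
    · intro z
      rw [hS]
      congr 1
      have hkn : k = ((k.natAbs : ℕ) : ℤ) := by omega
      nth_rewrite 1 [hkn]
      rw [zpow_natCast]

theorem IsAutomorphic.map_S_eq {k : ℤ} {f : ℍ → ℂ} (hf : IsAutomorphic k k f) (z : ℍ) :
    f (ModularGroup.S • z) = ((z : ℂ) / (Complex.I * ‖(z : ℂ)‖)) ^ k * f z := by
  rw [hf.map_S, autJ_S, mul_comm (-3 : ℤ), mul_comm k, e12_mul, e12_neg, ← I_eq_e12, ← mul_zpow]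
  congr 2
  rw [inv_mul_eq_div, div_div, mul_comm Complex.I]

/-! ### Reality of the normalised coefficients -/

/-- Ratios of Fourier coefficients of a Hecke eigenform are real. -/
theorem conj_numCoeff {k r : ℤ} {N : ℕ} (hN1 : 1 < N) (hN12 : N ∣ 12) (hr : 12 * r = N * k)
    (hcop : r.natAbs.Coprime N) (hgood : ∀ a : ℕ, a.Coprime N → IsGood k a) {R : ℝ} (hR : R ≠ 0)
    {f : ℍ → ℂ} (hf : IsMaassWaveform k R f) (hT : IsHeckeEigenfunction k f) {c : ℤ → ℂ}
    (hc : HasFourierCoeffs k R f c) (hc0 : numCoeff N r c r ≠ 0) (q : ℤ) :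
    (starRingEnd ℂ) ((numCoeff N r c r)⁻¹ * numCoeff N r c q) =
      (numCoeff N r c r)⁻¹ * numCoeff N r c q := by
  have hN : 0 < N := by omega
  have hN24 : N ∣ 24 := hN12.trans (by norm_num)
  have hr0 : r ≠ 0 := by
    rintro rfl
    simp at hcop
    omega
  have hk0 : k ≠ 0 := by
    rintro rfl
    rw [mul_zero] at hr
    omega
  have hsq : ∀ a : ℕ, a.Coprime N → (N : ℤ) ∣ (a : ℤ) ^ 2 - 1 := fun a => dvd_sq_sub_one hN hN24
  have hψ : IsQuadratic N (chi k) := isQuadratic_chi hgood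
  have hdvd : ∀ n : ℤ, (N : ℤ) ∣ n - 1 → (12 : ℤ) ∣ k * n - k := by
    rintro n ⟨t, ht⟩
    exact ⟨r * t, by linear_combination k * ht - t * hr⟩
  have hψ1 : ∀ n : ℕ, (N : ℤ) ∣ n - 1 → chi k n = 1 := by
    intro n hn
    obtain ⟨t, ht⟩ := hdvd n hn
    rw [chi_eq]
    exact e12_eq_one ⟨3 * t, by linear_combination 3 * ht⟩
  have hcopn : ∀ n : ℕ, (N : ℤ) ∣ n - 1 → n.Coprime N := by
    rintro n ⟨t, ht⟩
    have : IsCoprime (n : ℤ) (N : ℤ) := ⟨1, -t, by linear_combination ht⟩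
    exact Nat.isCoprime_iff_coprime.mp this
  set w := whittakerFun k N R with hw
  set x := numCoeff N r c with hx
  have haut := hf.isAutomorphic
  have hL2 := hf.isL2
  have hsum : ∀ z, HasSum (fun q => x q * expTerm N w q z) (f z) := hc.hasSum_expTerm hN hr
  have hsupp : ∀ q, x q ≠ 0 → (N : ℤ) ∣ q - r := dvd_of_numCoeff_ne_zero
  have hw0 : ∀ {q : ℤ}, q ≠ 0 → ∃ t : ℝ, 0 < t ∧ w (q * t) ≠ 0 :=
    fun hq => exists_whittakerFun_ne_zero k hN hR hq
  -- Zero is not in the class of $r$, as $r$ is prime to $N>1$; hence the invisible index $q=0$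
  -- causes no loss.
  have hx0 : x 0 = 0 := by
    by_contra h
    have h1 := hsupp 0 h
    rw [zero_sub, dvd_neg, Int.natCast_dvd] at h1
    have := Nat.dvd_gcd h1 dvd_rfl
    rw [hcop] at this
    exact absurd (Nat.dvd_one.mp this) (by omega)
  have hxi : ∀ s : ℤ, xi (k * s) = Complex.exp (2 * Real.pi * Complex.I * ((r * s : ℤ) / N)) := by
    intro s
    have hN' : (N : ℂ) ≠ 0 := by exact_mod_cast hN.ne'
    have hr' : 12 * (r : ℂ) = N * k := by exact_mod_cast hr
    rw [xi]
    congr 2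
    push_cast
    field_simp
    linear_combination -(s : ℂ) * hr'
  have hxi1 : xi k = Complex.exp (2 * Real.pi * Complex.I * (r / N)) := by
    have := hxi 1
    rwa [mul_one, mul_one] at this
  -- the Hecke eigenvalues
  have hlam : ∀ n : ℕ, ∃ ev : ℂ, 0 < n → (N : ℤ) ∣ n - 1 →
      (starRingEnd ℂ) ev = ev ∧ ∀ z, heckeT k n f z = ev * f z := by
    intro n
    by_cases h : 0 < n ∧ (N : ℤ) ∣ n - 1
    · obtain ⟨hn, hd⟩ := h
      have h12 := hdvd n hd
      obtain ⟨ev, hev⟩ := hT.2 n hn (Int.ModEq.symm (Int.modEq_iff_dvd.mpr h12))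
      have : NeZero n := ⟨hn.ne'⟩
      exact ⟨ev, fun _ _ => ⟨conj_eigenvalue haut hL2 hT.1 (hgood n (hcopn n hd)) h12 hev, hev⟩⟩
    · exact ⟨0, fun h1 h2 => absurd ⟨h1, h2⟩ h⟩
  choose lam hlam using hlam
  have hTx : ∀ n : ℕ, 0 < n → (N : ℤ) ∣ n - 1 → ∀ q, heckeCoeff (chi k) n x q = lam n * x q := by
    intro n hn hd q
    by_cases hq : q = 0
    · rw [hq, hx0, mul_zero, heckeCoeff]
      exact Finset.sum_eq_zero fun a _ => by rw [Int.zero_ediv, mul_zero, hx0, mul_zero]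
    · refine expTerm_unique hN.ne' (f := heckeT k n f) (hasSum_heckeOp hN hN24 hxi1 hsum hsupp hn
        (hcopn n hd)) (x' := fun q => lam n * x q) (fun z => ?_) q hq (hw0 hq)
      rw [(hlam n hn hd).2 z]
      refine ((hsum z).mul_left (lam n)).congr_fun fun q => ?_
      ring
  -- nonvanishing of the eigenvalue of the square of the Hecke operator of index `|r|`
  set m := r.natAbs with hm
  have hm0 : 0 < m := Int.natAbs_pos.mpr hr0
  have : NeZero m := ⟨hm0.ne'⟩
  have hΛ : ∑ e ∈ m.divisors, chi k e * lam ((m / e) ^ 2) ≠ 0 := by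
    have hK : ∀ z, HasSum (fun q => heckeCoeff (chi k) m x q * expTerm N w q z)
        (heckeOp k k m f z) := hasSum_heckeOp hN hN24 hxi1 hsum hsupp hm0 hcop
    have hKK := hasSum_heckeOp (k := k) hN hN24 (hxi m) hK
      (fun q => dvd_sub_of_heckeCoeff_ne_zero hsq hcop hsupp) hm0 hcop
    refine ne_zero_of_heckeOp_heckeOp haut hL2 (hgood m hcop) (funext fun z => ?_) fun h0 => ?_
    · refine (hKK z).unique (((hsum z).mul_left _).congr_fun fun q => ?_)
      refine Eq.trans (congrArg (· * expTerm N w q z) ?_) (mul_assoc _ (x q) (expTerm N w q z))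
      rw [heckeCoeff_heckeCoeff hψ hcop hm0, Finset.sum_mul]
      refine Finset.sum_congr rfl fun e he => ?_
      have hed := Nat.dvd_of_mem_divisors he
      have hpos : 0 < m / e := Nat.div_pos (Nat.divisor_le he) (Nat.pos_of_mem_divisors he)
      rw [hTx ((m / e) ^ 2) (by positivity) (by
        have := hsq (m / e) (Nat.Coprime.coprime_dvd_left (Nat.div_dvd_of_dvd hed) hcop)
        exact_mod_cast this), mul_assoc]
    -- At $s=\pm1$, the sign of $r$, only the divisor $1$ contributes to $T_mf$, and the coefficient
    -- is $\chi(m)x(r)\ne0$.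
    · obtain ⟨s, hs, hsr⟩ : ∃ s : ℤ, s.natAbs = 1 ∧ m * s = r := by
        rcases lt_or_gt_of_ne hr0 with h | h
        · exact ⟨-1, rfl, by omega⟩
        · exact ⟨1, rfl, by omega⟩
      have hs0 : s ≠ 0 := by rintro rfl; simp at hs
      have h1 := expTerm_unique hN.ne' hK (x' := fun _ => 0) (fun z => by
        rw [h0]; simp) s hs0 (hw0 hs0)
      rw [heckeCoeff_unit hm0 x hs, hsr] at h1
      rcases mul_eq_zero.mp h1 with h2 | h2
      · have := hψ.sq m hcop
        rw [h2, mul_zero] at this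
        exact zero_ne_one this
      · exact hc0 h2
  -- the difference of the normalised coefficients and their conjugates
  set α : ℂ := (x r)⁻¹ with hα
  set D : ℤ → ℂ := fun q => α * x q - (starRingEnd ℂ) (α * x q) with hD
  have hDsupp : ∀ q, D q ≠ 0 → (N : ℤ) ∣ q - r := by
    intro q hq
    refine hsupp q fun h => hq ?_
    simp [hD, h]
  have hDT : ∀ n : ℕ, 0 < n → (N : ℤ) ∣ n - 1 → ∀ q, heckeCoeff (chi k) n D q = lam n * D q := by
    intro n hn hd q
    rw [hD, heckeCoeff_sub_conj hψ (hcopn n hd), hTx n hn hd]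
    simp only [map_mul, (hlam n hn hd).1]
    ring
  have hDr : D r = 0 := by
    simp only [hD, hα]
    rw [inv_mul_cancel₀ hc0, map_one, sub_self]
  have hkr : ∀ q : ℤ, 0 < q * k → 0 < q * r := by
    intro q hq
    have hN' : (0 : ℤ) < N := by exact_mod_cast hN
    have : 0 < (N : ℤ) * (q * k) := mul_pos hN' hq
    have h2 : (N : ℤ) * (q * k) = 12 * (q * r) := by linear_combination -q * hr
    omega
  -- The numbers $r$ and $k$ have the same sign, so the side of $r$ is the side on which the
  -- Whittaker index would be $+|k|/2$.
  have hDside : ∀ q : ℤ, 0 ≤ q * k → D q = 0 := by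
    intro q hq
    rcases eq_or_lt_of_le hq with h | h
    · have : q = 0 := (mul_eq_zero.mp h.symm).resolve_right hk0
      rw [this]
      simp [hD, hx0]
    · exact coeff_eq_zero_of_side hψ hsq hψ1 hr0 hcop hDsupp hDT hDr hΛ (hkr q h)
  -- This function has coefficients $D$, and reflection followed by conjugation respects the
  -- transformation law under $S$.
  have hfinal := one_sided_expTerm hk0 hN hR (D := D)
    (h := fun z => α * f z - (starRingEnd ℂ) (α * f (reflection z))) ?_ ?_ hDside q
  · exact (sub_eq_zero.mp hfinal).symm
  · intro z
    have h1 := (hsum z).mul_left α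
    have h2 := Complex.hasSum_conj'.mpr ((hsum (reflection z)).mul_left α)
    refine (h1.sub h2).congr_fun fun q => ?_
    by_cases hq : q = 0
    · simp [hD, hq, hx0]
    · simp only [hD, map_mul]
      rw [conj_expTerm_reflection (fun t ht => conj_whittakerFun k hN R ht) hq]
      ring
  · intro z
    rw [reflection_S, haut.map_S_eq, haut.map_S_eq (reflection z)]
    have hnorm : ‖(reflection z : ℂ)‖ = ‖(z : ℂ)‖ := by
      rw [coe_reflection, norm_neg, RCLike.norm_conj]
    have hj : (starRingEnd ℂ) (((reflection z : ℂ) / (Complex.I * ‖(reflection z : ℂ)‖)) ^ k) =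
        ((z : ℂ) / (Complex.I * ‖(z : ℂ)‖)) ^ k := by
      rw [map_zpow₀, hnorm, coe_reflection]
      congr 1
      simp only [map_div₀, map_neg, map_mul, Complex.conj_conj, Complex.conj_I, Complex.conj_ofReal]
      rw [neg_mul, neg_div_neg_eq]
    simp only [map_mul] at hj ⊢
    rw [hj]
    ring

end MaassEta

end

theorem mainTheorem12 (k : ℤ) (hk : ¬ (12 : ℤ) ∣ k) (R : ℝ) (hR : R ≠ 0) (f : ℍ → ℂ)
    (hf : MaassEta.IsMaassWaveform k R f) (hT : MaassEta.IsHeckeEigenfunction k f)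
    (c : ℤ → ℂ) (hc : MaassEta.HasFourierCoeffs k R f c) (hc0 : c 0 ≠ 0)
    (l : ℤ) (hl : k ∣ 12 * l) :
    ∃ r : ℝ, c l / c 0 = (r : ℂ) := by
  obtain ⟨N, r, hN1, hN12, hr, hcop, hgood⟩ := MaassEta.exists_level hk
  have hN : 0 < N := by omega
  have h0 : MaassEta.numCoeff N r c r = c 0 := by
    have := MaassEta.numCoeff_apply hN r c 0
    rwa [mul_zero, zero_add] at this
  have h1 := MaassEta.conj_numCoeff hN1 hN12 hr hcop hgood hR hf hT hc (by rwa [h0]) (N * l + r)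
  rw [h0, MaassEta.numCoeff_apply hN] at h1
  obtain ⟨s, hs⟩ := Complex.conj_eq_iff_real.mp h1
  exact ⟨s, by rw [← hs, div_eq_inv_mul]⟩
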